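/- Let $\mathbb{K}$ be a field of characteristic zero. An $\mathfrak{S}$-module is a functor from the category of finite sets and bijections to the category of $\mathbb{K}$-vector spaces. The category of $\mathfrak{S}$-modules is symmetric monoidal for $(F\otimes G)(I)=\bigoplus_{I=J\sqcup K}F(J)\otimes G(K)$; associative algebras, Lie algebras and their (right) modules are understood in this category. Composition is $(F\circ G)(I)=\bigoplus_{\simeq}F(I/{\simeq})\otimes\bigotimes_{J\in I/\simeq}G(J)$, where $\simeq$ runs over the equivalence relations on $I$. Let $W$ be the $\mathfrak{S}$-module such that $W(I)$ has as basis the rooted trees with vertex set $I$. For rooted trees $S$ on $I$ and $T$ on $J$, let $S\curvearrowleft T\in W(I\sqcup J)$ be the sum, over the vertices $v$ of $S$, of the rooted trees obtained from the disjoint union of $S$ and $T$ by adding an edge between $v$ and the root of $T$, with the root of $S$ as root. The product $\curvearrowleft$ is pre-Lie, so that $[x,y]=x\curvearrowleft y-y\curvearrowleft x$ makes $W$ a Lie algebra, and $\curvearrowleft$ makes the $\mathfrak{S}$-module $W$ a right module over this Lie algebra, denoted by $W_{\mathtt{pL}}$. Let $\mathsf{U}(W)$ be the universal enveloping algebra of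 the Lie algebra $W$; right modules over the Lie algebra $W$ are identified with right $\mathsf{U}(W)$-modules. For a partition $\lambda$ of $n$, let $S^\lambda$ be the $\mathfrak{S}$-module concentrated in degree $n$ given by the irreducible representation of $\mathfrak{S}_n$ associated with $\lambda$ (so that $S^{(n)}$ is the trivial representation). Let $W$ act on $S^\lambda\circ W_{\mathtt{pL}}$ by derivations: $t$ sends $a\otimes\bigotimes_{J}m_J$ to the sum, over the classes $J_0$, of the tensors obtained by replacing $m_{J_0}$ with $m_{J_0}\curvearrowleft t$, where the elements labelling $t$ join the class $J_0$. Then for every non-empty partition $\lambda$, the module $S^\lambda\circ W_{\mathtt{pL}}$ is projective, i.e. a projective object of the category of right $\mathsf{U}(W)$-modules in $\mathfrak{S}$-modules. -/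

import Mathlib

open scoped TensorProduct DirectSum

universe u

set_option linter.unusedSectionVars false

/-! ### Symmetric-group modules -/

/-- An `𝔖`-module over `K`: a functor from the category of finite sets and bijections to the
category of `K`-vector spaces. -/
structure SModule (K : Type u) [Field K] where
  obj (I : Type) [Finite I] : Type u
  [addCommGroup (I : Type) [Finite I] : AddCommGroup (obj I)]
  [module (I : Type) [Finite I] : Module K (obj I)]
  map {I J : Type} [Finite I] [Finite J] (e : I ≃ J) : obj I →ₗ[K] obj J
  map_refl (I : Type) [Finite I] (x : obj I) : map (Equiv.refl I) x = x
  map_trans {I J L : Type} [Finite I] [Finite J] [Finite L] (e : I ≃ J) (f : J ≃ L) (x : obj I) :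
    map (e.trans f) x = map f (map e x)

attribute [instance] SModule.addCommGroup SModule.module

namespace SModule

variable {K : Type u} [Field K]

theorem map_map (M : SModule K) {I J L : Type} [Finite I] [Finite J] [Finite L]
    (e : I ≃ J) (f : J ≃ L) (x : M.obj I) : M.map f (M.map e x) = M.map (e.trans f) x :=
  (M.map_trans e f x).symm

theorem map_congr (M : SModule K) {I J : Type} [Finite I] [Finite J] {e f : I ≃ J}
    (h : ∀ i, e i = f i) (x : M.obj I) : M.map e x = M.map f x := by
  rw [Equiv.ext h]

theorem map_eq_self (M : SModule K) {I : Type} [Finite I] {e : I ≃ I}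
    (h : ∀ i, e i = i) (x : M.obj I) : M.map e x = x := by
  rw [show e = Equiv.refl I from Equiv.ext h, M.map_refl]

end SModule

/-- The bijection `(I ⊔ J) ⊔ L ≃ I ⊔ (L ⊔ J)`. -/
def sumAssocSwap (I J L : Type) : (I ⊕ J) ⊕ L ≃ I ⊕ (L ⊕ J) :=
  (Equiv.sumAssoc I J L).trans (Equiv.sumCongr (Equiv.refl I) (Equiv.sumComm J L))

/-! ### Algebraic structures in the symmetric monoidal category of `𝔖`-modules

A morphism `F ⊗ G ⟶ H` from the tensor product `(F ⊗ G)(I) = ⨁_{I = J ⊔ L} F(J) ⊗ G(L)` is the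
same as a family of bilinear maps `F(J) × G(L) → H(J ⊔ L)`, natural with respect to bijections. -/

/-- A (right) pre-Lie algebra in the category of `𝔖`-modules, with product `x ↶ y = op x y`. -/
structure SPreLieAlgebra (K : Type u) [Field K] extends SModule K where
  op {I J : Type} [Finite I] [Finite J] : obj I →ₗ[K] obj J →ₗ[K] obj (I ⊕ J)
  map_op {I I₁ J J₁ : Type} [Finite I] [Finite I₁] [Finite J] [Finite J₁]
    (e : I ≃ I₁) (f : J ≃ J₁) (x : obj I) (y : obj J) :
    map (Equiv.sumCongr e f) (op x y) = op (map e x) (map f y)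
  /-- `(x ↶ y) ↶ z - x ↶ (y ↶ z) = (x ↶ z) ↶ y - x ↶ (z ↶ y)` -/
  preLie {I J L : Type} [Finite I] [Finite J] [Finite L] (x : obj I) (y : obj J) (z : obj L) :
    map (Equiv.sumAssoc I J L) (op (op x y) z) - op x (op y z) =
      map (sumAssocSwap I L J) (op (op x z) y) - op x (map (Equiv.sumComm L J) (op z y))

/-- A Lie algebra in the category of `𝔖`-modules. -/
structure SLieAlgebra (K : Type u) [Field K] extends SModule K where
  bracket {I J : Type} [Finite I] [Finite J] : obj I →ₗ[K] obj J →ₗ[K] obj (I ⊕ J)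
  map_bracket {I I₁ J J₁ : Type} [Finite I] [Finite I₁] [Finite J] [Finite J₁]
    (e : I ≃ I₁) (f : J ≃ J₁) (x : obj I) (y : obj J) :
    map (Equiv.sumCongr e f) (bracket x y) = bracket (map e x) (map f y)
  /-- `[x, y] = - [y, x]` -/
  skew {I J : Type} [Finite I] [Finite J] (x : obj I) (y : obj J) :
    bracket x y = - map (Equiv.sumComm J I) (bracket y x)
  /-- The Jacobi identity, in the form `[x, [y, z]] = [[x, y], z] - [[x, z], y]`. -/
  jacobi {I J L : Type} [Finite I] [Finite J] [Finite L] (x : obj I) (y : obj J) (z : obj L) :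
    bracket x (bracket y z) =
      map (Equiv.sumAssoc I J L) (bracket (bracket x y) z) -
        map (sumAssocSwap I L J) (bracket (bracket x z) y)

/-- A (right) module over a Lie algebra in the category of `𝔖`-modules. -/
structure SLieModule {K : Type u} [Field K] (L : SLieAlgebra K) extends SModule K where
  act {I J : Type} [Finite I] [Finite J] : obj I →ₗ[K] L.obj J →ₗ[K] obj (I ⊕ J)
  map_act {I I₁ J J₁ : Type} [Finite I] [Finite I₁] [Finite J] [Finite J₁]
    (e : I ≃ I₁) (f : J ≃ J₁) (m : obj I) (x : L.obj J) :
    map (Equiv.sumCongr e f) (act m x) = act (map e m) (L.map f x)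
  /-- `m · [x, y] = (m · x) · y - (m · y) · x` -/
  act_bracket {I J H : Type} [Finite I] [Finite J] [Finite H]
    (m : obj I) (x : L.obj J) (y : L.obj H) :
    act m (L.bracket x y) =
      map (Equiv.sumAssoc I J H) (act (act m x) y) -
        map (sumAssocSwap I H J) (act (act m y) x)

/-- An associative unital algebra in the category of `𝔖`-modules. -/
structure SAlgebra (K : Type u) [Field K] extends SModule K where
  mul {I J : Type} [Finite I] [Finite J] : obj I →ₗ[K] obj J →ₗ[K] obj (I ⊕ J)
  one : obj Empty
  map_mul {I I₁ J J₁ : Type} [Finite I] [Finite I₁] [Finite J] [Finite J₁]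
    (e : I ≃ I₁) (f : J ≃ J₁) (x : obj I) (y : obj J) :
    map (Equiv.sumCongr e f) (mul x y) = mul (map e x) (map f y)
  mul_assoc {I J L : Type} [Finite I] [Finite J] [Finite L] (x : obj I) (y : obj J) (z : obj L) :
    map (Equiv.sumAssoc I J L) (mul (mul x y) z) = mul x (mul y z)
  mul_one {I : Type} [Finite I] (x : obj I) : map (Equiv.sumEmpty I Empty) (mul x one) = x
  one_mul {I : Type} [Finite I] (x : obj I) : map (Equiv.emptySum Empty I) (mul one x) = x

/-- A right module over an algebra in the category of `𝔖`-modules. -/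
structure SRightModule {K : Type u} [Field K] (A : SAlgebra K) extends SModule K where
  act {I J : Type} [Finite I] [Finite J] : obj I →ₗ[K] A.obj J →ₗ[K] obj (I ⊕ J)
  map_act {I I₁ J J₁ : Type} [Finite I] [Finite I₁] [Finite J] [Finite J₁]
    (e : I ≃ I₁) (f : J ≃ J₁) (m : obj I) (a : A.obj J) :
    map (Equiv.sumCongr e f) (act m a) = act (map e m) (A.map f a)
  act_mul {I J L : Type} [Finite I] [Finite J] [Finite L]
    (m : obj I) (a : A.obj J) (b : A.obj L) :
    map (Equiv.sumAssoc I J L) (act (act m a) b) = act m (A.mul a b)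
  act_one {I : Type} [Finite I] (m : obj I) : map (Equiv.sumEmpty I Empty) (act m A.one) = m

/-- A morphism of right modules over an algebra in the category of `𝔖`-modules: a natural
transformation that commutes with the actions. -/
@[ext]
structure SRightModule.Hom {K : Type u} [Field K] {A : SAlgebra K} (M N : SRightModule A) where
  app (I : Type) [Finite I] : M.obj I →ₗ[K] N.obj I
  naturality {I J : Type} [Finite I] [Finite J] (e : I ≃ J) (m : M.obj I) :
    app J (M.map e m) = N.map e (app I m)
  app_act {I J : Type} [Finite I] [Finite J] (m : M.obj I) (a : A.obj J) :
    app (I ⊕ J) (M.act m a) = N.act (app I m) a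

/-- The category of right modules over an algebra in the category of `𝔖`-modules. -/
instance {K : Type u} [Field K] (A : SAlgebra K) : CategoryTheory.Category (SRightModule A) where
  Hom M N := SRightModule.Hom M N
  id M := { app := fun I _ => LinearMap.id, naturality := fun _ _ => rfl, app_act := fun _ _ => rfl }
  comp f g :=
    { app := fun I _ => g.app I ∘ₗ f.app I
      naturality := fun e m => by simp [f.naturality, g.naturality]
      app_act := fun m a => by simp [f.app_act, g.app_act] }

/-! ### From pre-Lie algebras to Lie algebras and modules -/

namespace SPreLieAlgebra

variable {K : Type u} [Field K] (P : SPreLieAlgebra K)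

/-- The bracket `[x, y] = x ↶ y - y ↶ x`. -/
def bracket {I J : Type} [Finite I] [Finite J] : P.obj I →ₗ[K] P.obj J →ₗ[K] P.obj (I ⊕ J) :=
  P.op - (P.op.flip).compr₂ (P.map (Equiv.sumComm J I))

theorem bracket_apply {I J : Type} [Finite I] [Finite J] (x : P.obj I) (y : P.obj J) :
    P.bracket x y = P.op x y - P.map (Equiv.sumComm J I) (P.op y x) := rfl

theorem op_map_right {I J J₁ : Type} [Finite I] [Finite J] [Finite J₁]
    (f : J ≃ J₁) (x : P.obj I) (y : P.obj J) :
    P.op x (P.map f y) = P.map (Equiv.sumCongr (Equiv.refl I) f) (P.op x y) := by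
  rw [P.map_op, P.map_refl]

theorem op_map_left {I I₁ J : Type} [Finite I] [Finite J] [Finite I₁]
    (f : I ≃ I₁) (x : P.obj I) (y : P.obj J) :
    P.op (P.map f x) y = P.map (Equiv.sumCongr f (Equiv.refl J)) (P.op x y) := by
  rw [P.map_op, P.map_refl]

theorem op_bracket {I J L : Type} [Finite I] [Finite J] [Finite L]
    (x : P.obj I) (y : P.obj J) (z : P.obj L) :
    P.op x (P.bracket y z) =
      P.map (Equiv.sumAssoc I J L) (P.op (P.op x y) z) -
        P.map (sumAssocSwap I L J) (P.op (P.op x z) y) := by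
  have h := P.preLie x y z
  rw [bracket_apply, map_sub]
  rw [sub_eq_sub_iff_add_eq_add] at h ⊢
  rw [add_comm, ← h]

/-- The Lie algebra associated with a pre-Lie algebra. -/
def toLie : SLieAlgebra K where
  toSModule := P.toSModule
  bracket := P.bracket
  map_bracket e f x y := by
    simp only [bracket_apply, map_sub, ← P.map_op, P.map_map]
    congr 1
    apply P.map_congr
    rintro (i | i) <;> rfl
  skew x y := by
    simp only [bracket_apply, map_sub, P.map_map]
    rw [P.map_eq_self (e := (Equiv.sumComm _ _).trans (Equiv.sumComm _ _))]
    · abel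
    · rintro (i | i) <;> rfl
  jacobi {I J L} _ _ _ x y z := by
    rw [P.bracket_apply x (P.bracket y z), P.bracket_apply (P.bracket x y) z,
      P.bracket_apply (P.bracket x z) y, P.op_bracket x y z,
      P.op_bracket z x y, P.op_bracket y x z]
    simp only [bracket_apply, map_sub, LinearMap.sub_apply, op_map_left, P.map_map]
    have h1 := P.map_congr (e := (Equiv.sumComm (J ⊕ L) I))
      (f := (((sumAssocSwap J L I).trans (Equiv.sumComm J (I ⊕ L))).trans (sumAssocSwap I L J)))
      (by rintro ((i | i) | i) <;> rfl) (P.op (P.op y z) x)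
    have h2 := P.map_congr
      (e := ((Equiv.sumComm L J).sumCongr (Equiv.refl I)).trans (Equiv.sumComm (J ⊕ L) I))
      (f := ((sumAssocSwap L J I).trans (Equiv.sumComm L (I ⊕ J))).trans (Equiv.sumAssoc I J L))
      (by rintro ((i | i) | i) <;> rfl) (P.op (P.op z y) x)
    have h3 := P.map_congr
      (e := ((Equiv.sumComm J I).sumCongr (Equiv.refl L)).trans (Equiv.sumAssoc I J L))
      (f := ((Equiv.sumAssoc J I L).trans (Equiv.sumComm J (I ⊕ L))).trans (sumAssocSwap I L J))
      (by rintro ((i | i) | i) <;> rfl) (P.op (P.op y x) z)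
    have h4 := P.map_congr
      (e := ((Equiv.sumAssoc L I J).trans (Equiv.sumComm L (I ⊕ J))).trans (Equiv.sumAssoc I J L))
      (f := ((Equiv.sumComm L I).sumCongr (Equiv.refl J)).trans (sumAssocSwap I L J))
      (by rintro ((i | i) | i) <;> rfl) (P.op (P.op z x) y)
    rw [h1, h2, h3, h4]
    abel

/-- The pre-Lie product defines a right module over the associated Lie algebra. -/
def rightModule : SLieModule P.toLie where
  toSModule := P.toSModule
  act := P.op
  map_act e f x y := P.map_op e f x y
  act_bracket x y z := P.op_bracket x y z

end SPreLieAlgebra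

/-! ### Rooted trees -/

/-- A rooted tree with vertex set `I`, given by its root and the map sending every vertex other
than the root to its parent (the neighbour on the path to the root). The edges are
`{i, parent i}` for `i ≠ root`. -/
@[ext]
structure RootedTreeOn (I : Type) where
  root : I
  parent : I → I
  parent_root : parent root = root
  reaches_root (i : I) : ∃ n : ℕ, parent^[n] i = root

namespace RootedTreeOn

/-- Relabelling the vertices of a rooted tree. -/
def map {I J : Type} (e : I ≃ J) (t : RootedTreeOn I) : RootedTreeOn J where
  root := e t.root
  parent j := e (t.parent (e.symm j))
  parent_root := by simp [t.parent_root]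
  reaches_root j := by
    obtain ⟨n, hn⟩ := t.reaches_root (e.symm j)
    refine ⟨n, ?_⟩
    have h : Function.Semiconj e t.parent (fun j => e (t.parent (e.symm j))) := fun i => by simp
    rw [← hn, h.iterate_right n (e.symm j), e.apply_symm_apply]

instance {I : Type} [Finite I] : Finite (RootedTreeOn I) :=
  Finite.of_injective (fun t : RootedTreeOn I => (t.root, t.parent)) fun s t h => by
    cases s; cases t; simp_all

open Classical in
/-- The rooted tree obtained from the disjoint union of `s` and `t` by adding an edge between the
vertex `v` of `s` and the root of `t`, with the root of `s` as root. -/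
noncomputable def graft {I J : Type} (s : RootedTreeOn I) (v : I) (t : RootedTreeOn J) :
    RootedTreeOn (I ⊕ J) where
  root := Sum.inl s.root
  parent := Sum.elim (fun i => Sum.inl (s.parent i))
    (fun j => if j = t.root then Sum.inl v else Sum.inr (t.parent j))
  parent_root := by simp [s.parent_root]
  reaches_root := by
    set p : I ⊕ J → I ⊕ J := Sum.elim (fun i => Sum.inl (s.parent i))
      (fun j => if j = t.root then Sum.inl v else Sum.inr (t.parent j)) with hp
    have hl : ∀ i, ∃ n : ℕ, p^[n] (Sum.inl i) = Sum.inl s.root := by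
      intro i
      obtain ⟨n, hn⟩ := s.reaches_root i
      have h : Function.Semiconj Sum.inl s.parent p := fun i => rfl
      exact ⟨n, by rw [← hn, h.iterate_right n i]⟩
    have hr : ∀ (n : ℕ) (j : J), t.parent^[n] j = t.root →
        ∃ m : ℕ, p^[m] (Sum.inr j) = Sum.inl s.root := by
      intro n
      induction n with
      | zero =>
        intro j hj
        obtain ⟨m, hm⟩ := hl v
        refine ⟨m + 1, ?_⟩
        have : p (Sum.inr j) = Sum.inl v := by
          simp only [hp, Sum.elim_inr]; exact if_pos hj
        rw [Function.iterate_succ_apply, this, hm]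
      | succ n ih =>
        intro j hj
        by_cases hjr : j = t.root
        · obtain ⟨m, hm⟩ := hl v
          refine ⟨m + 1, ?_⟩
          have : p (Sum.inr j) = Sum.inl v := by
            simp only [hp, Sum.elim_inr]; rw [if_pos hjr]
          rw [Function.iterate_succ_apply, this, hm]
        · obtain ⟨m, hm⟩ := ih (t.parent j) (by rwa [Function.iterate_succ_apply] at hj)
          refine ⟨m + 1, ?_⟩
          have : p (Sum.inr j) = Sum.inr (t.parent j) := by
            simp only [hp, Sum.elim_inr]; rw [if_neg hjr]
          rw [Function.iterate_succ_apply, this, hm]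
    rintro (i | j)
    · exact hl i
    · obtain ⟨n, hn⟩ := t.reaches_root j
      exact hr n j hn

theorem graft_parent_inl {I J : Type} (s : RootedTreeOn I) (v : I) (t : RootedTreeOn J) (i : I) :
    (s.graft v t).parent (Sum.inl i) = Sum.inl (s.parent i) := rfl

theorem graft_parent_inr_root {I J : Type} (s : RootedTreeOn I) (v : I) (t : RootedTreeOn J) :
    (s.graft v t).parent (Sum.inr t.root) = Sum.inl v := if_pos rfl

theorem graft_parent_inr_ne {I J : Type} (s : RootedTreeOn I) (v : I) (t : RootedTreeOn J)
    {j : J} (h : j ≠ t.root) : (s.graft v t).parent (Sum.inr j) = Sum.inr (t.parent j) := if_neg h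

theorem map_parent {I J : Type} (e : I ≃ J) (t : RootedTreeOn I) (i : I) :
    (t.map e).parent (e i) = e (t.parent i) := by
  simp [map]

theorem ext_of_map {I J : Type} (e : I ≃ J) {s : RootedTreeOn I} {t : RootedTreeOn J}
    (h : e s.root = t.root) (h' : ∀ i, e (s.parent i) = t.parent (e i)) : s.map e = t := by
  ext i
  · exact h
  · obtain ⟨i, rfl⟩ := e.surjective i
    rw [map_parent, h']

theorem map_graft {I I₁ J J₁ : Type} (e : I ≃ I₁) (f : J ≃ J₁) (s : RootedTreeOn I) (v : I)
    (t : RootedTreeOn J) :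
    (s.graft v t).map (Equiv.sumCongr e f) = (s.map e).graft (e v) (t.map f) := by
  refine ext_of_map _ rfl ?_
  rintro (i | j)
  · exact congrArg Sum.inl (map_parent e s i).symm
  · by_cases h : j = t.root
    · subst h
      rw [graft_parent_inr_root]
      exact (graft_parent_inr_root (s.map e) (e v) (t.map f)).symm
    · rw [graft_parent_inr_ne _ _ _ h]
      refine Eq.trans ?_ (graft_parent_inr_ne (s.map e) (e v) (t.map f) (j := f j)
        (fun h' => h (f.injective h'))).symm
      rw [map_parent]
      rfl

theorem graft_graft_inr {I J L : Type} (s : RootedTreeOn I) (v : I) (t : RootedTreeOn J) (w : J)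
    (r : RootedTreeOn L) :
    ((s.graft v t).graft (Sum.inr w) r).map (Equiv.sumAssoc I J L) = s.graft v (t.graft w r) := by
  refine ext_of_map _ rfl ?_
  rintro ((i | j) | l)
  · rfl
  · rw [graft_parent_inl]
    by_cases h : j = t.root
    · subst h
      rw [graft_parent_inr_root]
      exact (graft_parent_inr_root s v (t.graft w r)).symm
    · rw [graft_parent_inr_ne _ _ _ h]
      exact (graft_parent_inr_ne s v (t.graft w r) (j := Sum.inl j)
        (fun h' => h (Sum.inl_injective h'))).symm
  · refine Eq.trans ?_ (graft_parent_inr_ne s v (t.graft w r) (j := Sum.inr l)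
      (fun h' => Sum.inr_ne_inl h')).symm
    by_cases h : l = r.root
    · subst h
      rw [graft_parent_inr_root, graft_parent_inr_root]
      rfl
    · rw [graft_parent_inr_ne _ _ _ h, graft_parent_inr_ne _ _ _ h]
      rfl

theorem graft_graft_inl {I J L : Type} (s : RootedTreeOn I) (v : I) (t : RootedTreeOn J) (w : I)
    (r : RootedTreeOn L) :
    ((s.graft v t).graft (Sum.inl w) r).map (Equiv.sumAssoc I J L) =
      ((s.graft w r).graft (Sum.inl v) t).map (sumAssocSwap I L J) := by
  refine ext_of_map _ rfl ?_
  rintro ((i | j) | l)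
  · exact (map_parent (sumAssocSwap I L J) ((s.graft w r).graft (Sum.inl v) t)
      (Sum.inl (Sum.inl i))).symm
  · refine Eq.trans ?_ (map_parent (sumAssocSwap I L J) ((s.graft w r).graft (Sum.inl v) t)
      (Sum.inr j)).symm
    rw [graft_parent_inl]
    by_cases h : j = t.root
    · subst h
      rw [graft_parent_inr_root, graft_parent_inr_root]
      rfl
    · rw [graft_parent_inr_ne _ _ _ h, graft_parent_inr_ne _ _ _ h]
      rfl
  · refine Eq.trans ?_ (map_parent (sumAssocSwap I L J) ((s.graft w r).graft (Sum.inl v) t)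
      (Sum.inl (Sum.inr l))).symm
    rw [graft_parent_inl]
    by_cases h : l = r.root
    · subst h
      rw [graft_parent_inr_root, graft_parent_inr_root]
      rfl
    · rw [graft_parent_inr_ne _ _ _ h, graft_parent_inr_ne _ _ _ h]
      rfl

end RootedTreeOn

/-- The product on the `𝔖`-module of rooted trees: `s ↶ t` is the sum over the vertices `v` of
`s` of the trees obtained by grafting the root of `t` on `v`. -/
noncomputable def treeOp (K : Type u) [Field K] {I J : Type} [Finite I] [Finite J] :
    (RootedTreeOn I →₀ K) →ₗ[K] (RootedTreeOn J →₀ K) →ₗ[K] (RootedTreeOn (I ⊕ J) →₀ K) :=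
  Finsupp.lift _ K _ fun s => Finsupp.lift _ K _ fun t =>
    ∑ᶠ v : I, Finsupp.single (s.graft v t) 1

theorem treeOp_single (K : Type u) [Field K] {I J : Type} [Fintype I] [Finite J]
    (s : RootedTreeOn I) (t : RootedTreeOn J) :
    treeOp K (Finsupp.single s 1) (Finsupp.single t 1) =
      ∑ v : I, Finsupp.single (s.graft v t) 1 := by
  simp [treeOp, finsum_eq_sum_of_fintype]

/-- Relabelling of linear combinations of rooted trees. -/
noncomputable def treeMap (K : Type u) [Field K] {I J : Type} (e : I ≃ J) :
    (RootedTreeOn I →₀ K) →ₗ[K] (RootedTreeOn J →₀ K) :=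
  Finsupp.lmapDomain K K (RootedTreeOn.map e)

theorem treeMap_single (K : Type u) [Field K] {I J : Type} (e : I ≃ J) (t : RootedTreeOn I) :
    treeMap K e (Finsupp.single t 1) = Finsupp.single (t.map e) 1 :=
  Finsupp.mapDomain_single

theorem treeMap_trans (K : Type u) [Field K] {I J L : Type} (e : I ≃ J) (f : J ≃ L)
    (x : RootedTreeOn I →₀ K) : treeMap K (e.trans f) x = treeMap K f (treeMap K e x) := by
  rw [treeMap, treeMap, treeMap, Finsupp.lmapDomain_apply, Finsupp.lmapDomain_apply,
    Finsupp.lmapDomain_apply, ← Finsupp.mapDomain_comp]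
  rfl

theorem treeMap_treeOp (K : Type u) [Field K] {I I₁ J J₁ : Type} [Finite I] [Finite I₁]
    [Finite J] [Finite J₁] (e : I ≃ I₁) (f : J ≃ J₁) (x : RootedTreeOn I →₀ K)
    (y : RootedTreeOn J →₀ K) :
    treeMap K (Equiv.sumCongr e f) (treeOp K x y) = treeOp K (treeMap K e x) (treeMap K f y) := by
  have := Fintype.ofFinite I
  have := Fintype.ofFinite I₁
  suffices h : (treeOp K).compr₂ (treeMap K (Equiv.sumCongr e f))
      = (treeOp K).compl₁₂ (treeMap K e) (treeMap K f) from
    LinearMap.congr_fun (LinearMap.congr_fun h x) y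
  refine Finsupp.lhom_ext' fun s => LinearMap.ext_ring ?_
  refine Finsupp.lhom_ext' fun t => LinearMap.ext_ring ?_
  simp only [LinearMap.comp_apply, Finsupp.lsingle_apply, LinearMap.compr₂_apply,
    LinearMap.compl₁₂_apply, treeMap_single, treeOp_single]
  rw [map_sum, ← e.sum_comp]
  simp only [treeMap_single, RootedTreeOn.map_graft]

theorem treeOp_associator (K : Type u) [Field K] {I J L : Type} [Fintype I] [Fintype J] [Fintype L]
    (s : RootedTreeOn I) (t : RootedTreeOn J) (r : RootedTreeOn L) :
    treeMap K (Equiv.sumAssoc I J L)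
        (treeOp K (treeOp K (Finsupp.single s 1) (Finsupp.single t 1)) (Finsupp.single r 1)) -
      treeOp K (Finsupp.single s 1) (treeOp K (Finsupp.single t 1) (Finsupp.single r 1)) =
    ∑ v : I, ∑ w : I,
      Finsupp.single (((s.graft v t).graft (Sum.inl w) r).map (Equiv.sumAssoc I J L)) 1 := by
  simp only [treeOp_single, map_sum, LinearMap.sum_apply, treeMap_single, Fintype.sum_sum_type,
    map_add, RootedTreeOn.graft_graft_inr, Finset.sum_add_distrib]
  rw [Finset.sum_comm (γ := J)]
  abel

theorem treeOp_preLie (K : Type u) [Field K] {I J L : Type} [Finite I] [Finite J] [Finite L]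
    (x : RootedTreeOn I →₀ K) (y : RootedTreeOn J →₀ K) (z : RootedTreeOn L →₀ K) :
    treeMap K (Equiv.sumAssoc I J L) (treeOp K (treeOp K x y) z) - treeOp K x (treeOp K y z) =
      treeMap K (sumAssocSwap I L J) (treeOp K (treeOp K x z) y) -
        treeOp K x (treeMap K (Equiv.sumComm L J) (treeOp K z y)) := by
  have := Fintype.ofFinite I
  have := Fintype.ofFinite J
  have := Fintype.ofFinite L
  induction x using Finsupp.induction_linear with
  | zero => simp
  | add x₁ x₂ h₁ h₂ => simp only [map_add, LinearMap.add_apply, add_sub_add_comm, h₁, h₂]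
  | single s a =>
  induction y using Finsupp.induction_linear with
  | zero => simp
  | add x₁ x₂ h₁ h₂ => simp only [map_add, LinearMap.add_apply, add_sub_add_comm, h₁, h₂]
  | single t b =>
  induction z using Finsupp.induction_linear with
  | zero => simp
  | add x₁ x₂ h₁ h₂ => simp only [map_add, LinearMap.add_apply, add_sub_add_comm, h₁, h₂]
  | single r c =>
  rw [← mul_one a, ← mul_one b, ← mul_one c, ← smul_eq_mul a, ← smul_eq_mul b, ← smul_eq_mul c]
  simp only [← Finsupp.smul_single, map_smul, LinearMap.smul_apply, ← smul_sub]
  rw [smul_comm c b]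
  congr 3
  rw [treeOp_associator]
  have h := congrArg (treeMap K (Equiv.sumCongr (Equiv.refl I) (Equiv.sumComm L J)))
    (treeOp_associator K s r t)
  rw [map_sub, ← treeMap_trans, treeMap_treeOp, treeMap_single,
    show s.map (Equiv.refl I) = s from rfl] at h
  refine Eq.trans ?_ h.symm
  simp only [map_sum, treeMap_single]
  rw [Finset.sum_comm]
  refine Finset.sum_congr rfl fun v _ => Finset.sum_congr rfl fun w _ => ?_
  rw [RootedTreeOn.graft_graft_inl]
  rfl

/-- The pre-Lie algebra `W` in the category of `𝔖`-modules: `W(I)` is the vector space spanned by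
the rooted trees with vertex set `I`. -/
noncomputable def treeSPreLie (K : Type u) [Field K] : SPreLieAlgebra K where
  obj I _ := RootedTreeOn I →₀ K
  map e := treeMap K e
  map_refl _ _ _ := Finsupp.mapDomain_id
  map_trans e f x := treeMap_trans K e f x
  op := treeOp K
  map_op e f x y := treeMap_treeOp K e f x y
  preLie x y z := treeOp_preLie K x y z

/-- The Lie algebra `W` in the category of `𝔖`-modules. -/
noncomputable def treeSLie (K : Type u) [Field K] : SLieAlgebra K := (treeSPreLie K).toLie

/-- The right `W`-module `W_pL`: the `𝔖`-module of rooted trees, on which the Lie algebra `W` acts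
through the pre-Lie product. -/
noncomputable def treePL (K : Type u) [Field K] : SLieModule (treeSLie K) :=
  (treeSPreLie K).rightModule

/-! ### The `𝔖`-modules `S^λ` -/

section Specht

open Classical in
/-- The product of the filling `σ` of the cells of `μ` with the Young symmetrizer of `μ`: the sum,
over the permutations `p` of the cells preserving each row and `q` preserving each column, of
`sign q` times the filling `σ ∘ p ∘ q`. -/
noncomputable def youngSymmetrized (K : Type u) [Field K] (μ : YoungDiagram) {I : Type}
    (σ : μ.cells ≃ I) : (μ.cells ≃ I) →₀ K :=
  ∑ p : {p : Equiv.Perm μ.cells // ∀ c, (p c).1.1 = c.1.1},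
    ∑ q : {q : Equiv.Perm μ.cells // ∀ c, (q c).1.2 = c.1.2},
      Finsupp.single ((p.1 * q.1).trans σ) (((Equiv.Perm.sign q.1 : ℤˣ) : ℤ) : K)

/-- Relabelling of fillings. -/
noncomputable def fillingMap (K : Type u) [Field K] (μ : YoungDiagram) {I J : Type} (e : I ≃ J) :
    ((μ.cells ≃ I) →₀ K) →ₗ[K] ((μ.cells ≃ J) →₀ K) :=
  Finsupp.lmapDomain K K fun σ => σ.trans e

theorem fillingMap_youngSymmetrized (K : Type u) [Field K] (μ : YoungDiagram) {I J : Type}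
    (e : I ≃ J) (σ : μ.cells ≃ I) :
    fillingMap K μ e (youngSymmetrized K μ σ) = youngSymmetrized K μ (σ.trans e) := by
  simp only [youngSymmetrized, map_sum, fillingMap, Finsupp.lmapDomain_apply,
    Finsupp.mapDomain_single]
  rfl

/-- The space `S^μ(I)`. For `I = μ.cells` it is the left ideal of the group algebra of the
permutations of `I` generated by the Young symmetrizer of `μ`; it vanishes if the cardinality of
`I` is not the size of `μ`. -/
noncomputable def spechtSubmodule (K : Type u) [Field K] (μ : YoungDiagram) (I : Type) :
    Submodule K ((μ.cells ≃ I) →₀ K) :=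
  Submodule.span K (Set.range (youngSymmetrized K μ))

/-- The `𝔖`-module `S^μ`, concentrated in degree `|μ|`, given by the irreducible representation of
the symmetric group associated with the partition `μ`. -/
noncomputable def specht (K : Type u) [Field K] (μ : YoungDiagram) : SModule K where
  obj I _ := spechtSubmodule K μ I
  map {I J} _ _ e := (fillingMap K μ e).restrict (p := spechtSubmodule K μ I)
    (q := spechtSubmodule K μ J) (by
      change spechtSubmodule K μ I ≤ (spechtSubmodule K μ J).comap (fillingMap K μ e)
      rw [← Submodule.map_le_iff_le_comap, spechtSubmodule, Submodule.map_span,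
        Submodule.span_le]
      rintro _ ⟨_, ⟨σ, rfl⟩, rfl⟩
      rw [fillingMap_youngSymmetrized]
      exact Submodule.subset_span ⟨_, rfl⟩)
  map_refl I _ x := by
    ext1
    exact Finsupp.mapDomain_id
  map_trans e f x := by
    ext1
    exact Finsupp.mapDomain_comp (f := fun σ : μ.cells ≃ _ => σ.trans e)
      (g := fun σ => σ.trans f)

end Specht

/-! ### Composition of `𝔖`-modules -/

namespace SModule

variable {K : Type u} [Field K] (F G : SModule K)

/-- The value of the composition `F ∘ G` on `I`: the direct sum, over the equivalence relations `r`
on `I`, of `F(I/r) ⊗ ⨂_{c ∈ I/r} G(c)`, where the classes `c` are regarded as subsets of `I`. -/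
abbrev CompObj (I : Type) [Finite I] : Type u :=
  ⨁ r : Setoid I, F.obj (Quotient r) ⊗[K] (⨂[K] c : Quotient r, G.obj {i // Quotient.mk r i = c})

section

variable {I J Q R : Type} [Finite I] [Finite J] [Finite Q] [Finite R]

/-- A bijection between fibres induced by a bijection of the ambient sets. -/
def fiberEquiv (e : I ≃ J) (p : I → Q) (q : Q) (p₁ : J → R) (q₁ : R)
    (h : ∀ i, p i = q ↔ p₁ (e i) = q₁) : {i // p i = q} ≃ {j // p₁ j = q₁} :=
  e.subtypeEquiv h

/-- The bijection from the quotient of `I` by the kernel of a surjection `p : I → Q` to `Q`. -/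
noncomputable abbrev kerEquiv (p : I → Q) (hp : Function.Surjective p) :
    Quotient (Setoid.ker p) ≃ Q :=
  Setoid.quotientKerEquivOfSurjective p hp

theorem kerEquiv_eq_iff (p : I → Q) (hp : Function.Surjective p) (c : Quotient (Setoid.ker p))
    (i : I) :
    p i = kerEquiv p hp c ↔ Quotient.mk (Setoid.ker p) (Equiv.refl I i) = c :=
  (kerEquiv p hp).apply_eq_iff_eq (x := Quotient.mk (Setoid.ker p) i) (y := c)

theorem fiberReindex_aux [DecidableEq Q] (p : I → Q)
    [DecidableEq (Quotient (Setoid.ker p))] (hp : Function.Surjective p)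
    (m : ∀ q, G.obj {i // p i = q}) (c : Quotient (Setoid.ker p))
    (x : G.obj {i // p i = kerEquiv p hp c}) :
    (fun d => G.map (fiberEquiv (Equiv.refl I) p (kerEquiv p hp d)
        (Quotient.mk (Setoid.ker p)) d (kerEquiv_eq_iff p hp d))
          (Function.update m (kerEquiv p hp c) x (kerEquiv p hp d))) =
      Function.update (fun d => G.map (fiberEquiv (Equiv.refl I) p (kerEquiv p hp d)
        (Quotient.mk (Setoid.ker p)) d (kerEquiv_eq_iff p hp d)) (m (kerEquiv p hp d))) c
        (G.map (fiberEquiv (Equiv.refl I) p (kerEquiv p hp c)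
          (Quotient.mk (Setoid.ker p)) c (kerEquiv_eq_iff p hp c)) x) := by
  ext d
  by_cases h : d = c
  · subst h
    simp
  · rw [Function.update_of_ne h, Function.update_of_ne fun h' => h ((kerEquiv p hp).injective h')]

/-- The identification of tensor products indexed by `Q` and by the quotient of `I` by the kernel
of a surjection `p : I → Q`. -/
noncomputable def fiberReindex (p : I → Q) (hp : Function.Surjective p) :
    (⨂[K] q : Q, G.obj {i // p i = q}) →ₗ[K]
      ⨂[K] c : Quotient (Setoid.ker p), G.obj {i // Quotient.mk (Setoid.ker p) i = c} :=
  PiTensorProduct.lift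
    { toFun := fun m => PiTensorProduct.tprod K fun c =>
        G.map (fiberEquiv (Equiv.refl I) p (kerEquiv p hp c)
          (Quotient.mk (Setoid.ker p)) c (kerEquiv_eq_iff p hp c)) (m (kerEquiv p hp c))
      map_update_add' := fun m q x y => by
        classical
        obtain ⟨c, rfl⟩ := (kerEquiv p hp).surjective q
        have key := fun z => fiberReindex_aux G p hp m c z
        simp only [key, map_add, MultilinearMap.map_update_add]
      map_update_smul' := fun m q a x => by
        classical
        obtain ⟨c, rfl⟩ := (kerEquiv p hp).surjective q
        have key := fun z => fiberReindex_aux G p hp m c z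
        simp only [key, map_smul, MultilinearMap.map_update_smul] }

theorem fiberReindex_tprod (p : I → Q) (hp : Function.Surjective p)
    (m : ∀ q, G.obj {i // p i = q}) :
    fiberReindex G p hp (PiTensorProduct.tprod K m) = PiTensorProduct.tprod K fun c =>
      G.map (fiberEquiv (Equiv.refl I) p (kerEquiv p hp c)
        (Quotient.mk (Setoid.ker p)) c (kerEquiv_eq_iff p hp c)) (m (kerEquiv p hp c)) :=
  PiTensorProduct.lift.tprod m

open Classical in
/-- The inclusion in `(F ∘ G)(I)` of the summand given by the equivalence relation whose classes
are the fibres of a surjection `p : I → Q`, where the quotient is identified with `Q`. -/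
noncomputable def compIncl (p : I → Q) (hp : Function.Surjective p) :
    F.obj Q ⊗[K] (⨂[K] q : Q, G.obj {i // p i = q}) →ₗ[K] CompObj F G I :=
  DirectSum.lof K (Setoid I)
      (fun r => F.obj (Quotient r) ⊗[K] (⨂[K] c : Quotient r, G.obj {i // Quotient.mk r i = c}))
      (Setoid.ker p) ∘ₗ
    TensorProduct.map (F.map (kerEquiv p hp).symm) (fiberReindex G p hp)

/-- The image in `(F ∘ G)(I)` of a pure tensor. -/
noncomputable def compMk (p : I → Q) (hp : Function.Surjective p) (a : F.obj Q)
    (m : ∀ q, G.obj {i // p i = q}) : CompObj F G I :=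
  compIncl F G p hp (a ⊗ₜ[K] PiTensorProduct.tprod K m)

open Classical in
theorem lof_congr {r r₁ : Setoid I} (ρ : Quotient r ≃ Quotient r₁)
    (hρ : ∀ i, ρ (Quotient.mk r i) = Quotient.mk r₁ i) {a : F.obj (Quotient r)}
    {a₁ : F.obj (Quotient r₁)} (ha : F.map ρ a = a₁)
    {m : ∀ c, G.obj {i // Quotient.mk r i = c}} {m₁ : ∀ c, G.obj {i // Quotient.mk r₁ i = c}}
    (hm : ∀ c, G.map (fiberEquiv (Equiv.refl I) (Quotient.mk r) c (Quotient.mk r₁) (ρ c)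
      fun i => by rw [Equiv.refl_apply, ← hρ i, ρ.apply_eq_iff_eq]) (m c) = m₁ (ρ c)) :
    DirectSum.lof K (Setoid I)
      (fun r => F.obj (Quotient r) ⊗[K] (⨂[K] c : Quotient r, G.obj {i // Quotient.mk r i = c}))
      r (a ⊗ₜ[K] PiTensorProduct.tprod K m) =
    DirectSum.lof K (Setoid I)
      (fun r => F.obj (Quotient r) ⊗[K] (⨂[K] c : Quotient r, G.obj {i // Quotient.mk r i = c}))
      r₁ (a₁ ⊗ₜ[K] PiTensorProduct.tprod K m₁) := by
  have hr : r = r₁ := by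
    ext i j
    have h := ρ.apply_eq_iff_eq (x := Quotient.mk r i) (y := Quotient.mk r j)
    rw [hρ, hρ, Quotient.eq, Quotient.eq] at h
    exact h.symm
  subst hr
  obtain rfl : ρ = Equiv.refl _ := by
    ext c
    induction c using Quotient.ind
    exact hρ _
  rw [F.map_refl] at ha
  subst ha
  congr 3
  ext c
  rw [← show _ = m₁ c from hm c]
  exact (G.map_eq_self (fun _ => rfl) _).symm

theorem map_fiber_congr {p : I → Q} (m : ∀ q, G.obj {i // p i = q}) {q q₁ : Q} (hq : q = q₁)
    (e : {i // p i = q} ≃ J) (f : {i // p i = q₁} ≃ J)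
    (h : ∀ i hi hi₁, e ⟨i, hi⟩ = f ⟨i, hi₁⟩) : G.map e (m q) = G.map f (m q₁) := by
  subst hq
  exact G.map_congr (fun ⟨i, hi⟩ => h i hi hi) _

open Classical in
theorem compMk_def (p : I → Q) (hp : Function.Surjective p) (a : F.obj Q)
    (m : ∀ q, G.obj {i // p i = q}) :
    compMk F G p hp a m = DirectSum.lof K (Setoid I)
      (fun r => F.obj (Quotient r) ⊗[K] (⨂[K] c : Quotient r, G.obj {i // Quotient.mk r i = c}))
      (Setoid.ker p) (F.map (kerEquiv p hp).symm a ⊗ₜ[K]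
        PiTensorProduct.tprod K fun c => G.map (fiberEquiv (Equiv.refl I) p (kerEquiv p hp c)
          (Quotient.mk (Setoid.ker p)) c (kerEquiv_eq_iff p hp c)) (m (kerEquiv p hp c))) := by
  rw [compMk, compIncl, LinearMap.comp_apply, TensorProduct.map_tmul, fiberReindex_tprod]

theorem compMk_congr {p : I → Q} {hp : Function.Surjective p} {p₁ : I → R}
    {hp₁ : Function.Surjective p₁} (σ : Q ≃ R) (hσ : ∀ i, σ (p i) = p₁ i)
    {a : F.obj Q} {a₁ : F.obj R} (ha : F.map σ a = a₁)
    {m : ∀ q, G.obj {i // p i = q}} {m₁ : ∀ q, G.obj {i // p₁ i = q}}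
    (hm : ∀ q, ∃ e : {i // p i = q} ≃ {i // p₁ i = σ q}, (∀ i, (e i).1 = i.1) ∧
      G.map e (m q) = m₁ (σ q)) :
    compMk F G p hp a m = compMk F G p₁ hp₁ a₁ m₁ := by
  rw [compMk_def, compMk_def]
  refine lof_congr F G (((kerEquiv p hp).trans σ).trans (kerEquiv p₁ hp₁).symm) ?_ ?_ ?_
  · intro i
    exact (Equiv.symm_apply_eq (kerEquiv p₁ hp₁)).2 (hσ i)
  · rw [← ha, F.map_map, F.map_map]
    refine F.map_congr (fun q => ?_) a
    simp
  · intro c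
    obtain ⟨e, he, h⟩ := hm (kerEquiv p hp c)
    rw [G.map_map]
    have hq : kerEquiv p₁ hp₁ ((((kerEquiv p hp).trans σ).trans (kerEquiv p₁ hp₁).symm) c) =
        σ (kerEquiv p hp c) := by simp
    have hq' : ∀ i, p₁ i = σ (kerEquiv p hp c) ↔ Quotient.mk (Setoid.ker p₁) i =
        ((((kerEquiv p hp).trans σ).trans (kerEquiv p₁ hp₁).symm) c) := fun i => by
      rw [← hq]
      exact kerEquiv_eq_iff p₁ hp₁ _ i
    refine Eq.trans ?_ (map_fiber_congr G m₁ hq.symm (fiberEquiv (Equiv.refl I) p₁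
      (σ (kerEquiv p hp c)) (Quotient.mk (Setoid.ker p₁)) _ hq') _ fun i hi hi₁ => rfl)
    rw [← h, G.map_map]
    refine G.map_congr (fun i => Subtype.ext (he i).symm) _

theorem compMk_congr' {p : I → Q} {hp : Function.Surjective p} {p₁ : I → Q}
    {hp₁ : Function.Surjective p₁} (hσ : ∀ i, p i = p₁ i) {a : F.obj Q}
    {m : ∀ q, G.obj {i // p i = q}} {m₁ : ∀ q, G.obj {i // p₁ i = q}}
    (hm : ∀ q, G.map (fiberEquiv (Equiv.refl I) p q p₁ q fun i => by
      rw [hσ, Equiv.refl_apply]) (m q) = m₁ q) :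
    compMk F G p hp a m = compMk F G p₁ hp₁ a m₁ :=
  compMk_congr F G (Equiv.refl Q) hσ (F.map_refl Q a) fun q => ⟨_, fun _ => rfl, hm q⟩

open Classical in
theorem compMk_mk (r : Setoid I) (a : F.obj (Quotient r))
    (m : ∀ c, G.obj {i // Quotient.mk r i = c}) :
    compMk F G (Quotient.mk r) Quotient.mk_surjective a m = DirectSum.lof K (Setoid I)
      (fun r => F.obj (Quotient r) ⊗[K] (⨂[K] c : Quotient r, G.obj {i // Quotient.mk r i = c}))
      r (a ⊗ₜ[K] PiTensorProduct.tprod K m) := by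
  rw [compMk_def]
  refine lof_congr F G (kerEquiv (Quotient.mk r) Quotient.mk_surjective) (fun i => rfl) ?_ ?_
  · rw [F.map_map]
    exact F.map_eq_self (fun i => by simp) _
  · intro c
    rw [G.map_map]
    exact G.map_eq_self (fun i => rfl) _

variable {F G} in
theorem comp_induction {P : CompObj F G I → Prop} (x : CompObj F G I) (zero : P 0)
    (add : ∀ x y, P x → P y → P (x + y))
    (mk : ∀ (r : Setoid I) (a : F.obj (Quotient r)) (m : ∀ c, G.obj {i // Quotient.mk r i = c}),
      P (compMk F G (Quotient.mk r) Quotient.mk_surjective a m)) : P x := by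
  classical
  induction x using DirectSum.induction_on with
  | zero => exact zero
  | add x y hx hy => exact add x y hx hy
  | of r x =>
    induction x using TensorProduct.induction_on with
    | zero => simpa using zero
    | add x y hx hy => rw [map_add]; exact add _ _ hx hy
    | tmul a y =>
      induction y using PiTensorProduct.induction_on with
      | add x y hx hy => rw [TensorProduct.tmul_add, map_add]; exact add _ _ hx hy
      | smul_tprod c m =>
        rw [← TensorProduct.smul_tmul]
        exact compMk_mk F G r (c • a) m ▸ mk r (c • a) m

open Classical in
/-- The functoriality of the composition of `𝔖`-modules. -/
noncomputable def compMap (e : I ≃ J) : CompObj F G I →ₗ[K] CompObj F G J :=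
  DirectSum.toModule K (Setoid I) (CompObj F G J) fun r =>
    compIncl F G (fun j => Quotient.mk r (e.symm j))
        (Quotient.mk_surjective.comp e.symm.surjective) ∘ₗ
      TensorProduct.map LinearMap.id (PiTensorProduct.map
        fun c => G.map (fiberEquiv e (Quotient.mk r) c (fun j => Quotient.mk r (e.symm j)) c
          fun i => by rw [e.symm_apply_apply]))

theorem compMap_compMk (e : I ≃ J) (p : I → Q) (hp : Function.Surjective p) (a : F.obj Q)
    (m : ∀ q, G.obj {i // p i = q}) :
    compMap F G e (compMk F G p hp a m) =
      compMk F G (fun j => p (e.symm j)) (hp.comp e.symm.surjective) a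
        (fun q => G.map (fiberEquiv e p q (fun j => p (e.symm j)) q
          fun i => by rw [e.symm_apply_apply]) (m q)) := by
  rw [compMk_def, compMap, DirectSum.toModule_lof, LinearMap.comp_apply, TensorProduct.map_tmul,
    PiTensorProduct.map_tprod]
  refine compMk_congr F G (kerEquiv p hp) (fun j => rfl) ?_ ?_
  · rw [LinearMap.id_apply, F.map_map]
    exact F.map_eq_self (fun i => by simp) _
  · intro c
    refine ⟨fiberEquiv (Equiv.refl J) _ _ _ _ fun j =>
      (kerEquiv_eq_iff p hp c (e.symm j)).symm, fun i => rfl, ?_⟩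
    rw [G.map_map, G.map_map]
    exact G.map_congr (fun i => rfl) _

end

/-- The composition `F ∘ G` of `𝔖`-modules. -/
noncomputable def comp : SModule K where
  obj I _ := CompObj F G I
  map e := compMap F G e
  map_refl I _ x := by
    induction x using comp_induction with
    | zero => simp
    | add x y hx hy => rw [map_add, hx, hy]
    | mk r a m =>
      rw [compMap_compMk]
      refine compMk_congr' F G (fun i => rfl) fun q => ?_
      rw [G.map_map]
      exact G.map_eq_self (fun i => rfl) _
  map_trans e f x := by
    induction x using comp_induction with
    | zero => simp
    | add x y hx hy => rw [map_add, map_add, map_add, hx, hy]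
    | mk r a m =>
      rw [compMap_compMk, compMap_compMk, compMap_compMk]
      refine compMk_congr' F G (fun i => rfl) fun q => ?_
      rw [G.map_map, G.map_map]
      exact G.map_congr (fun i => rfl) _

end SModule

/-! ### Extension of a module by derivations -/

namespace SLieModule

variable {K : Type u} [Field K] {L : SLieAlgebra K} (F : SModule K) (M : SLieModule L)

theorem act_map_left {I I₁ J : Type} [Finite I] [Finite J] [Finite I₁]
    (f : I ≃ I₁) (x : M.obj I) (y : L.obj J) :
    M.act (M.map f x) y = M.map (Equiv.sumCongr f (Equiv.refl J)) (M.act x y) := by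
  rw [M.map_act, L.map_refl]

section

variable {I J Q : Type}

theorem extend_surjective (J : Type) {p : I → Q} (hp : Function.Surjective p) (q₀ : Q) :
    Function.Surjective (Sum.elim p fun _ : J => q₀) := fun q =>
  (hp q).elim fun i hi => ⟨Sum.inl i, hi⟩

/-- The fibre of `q₀` under the map `p` extended to `I ⊔ J` by the constant value `q₀` on `J`. -/
def extendFiberSelf (J : Type) (p : I → Q) (q₀ : Q) :
    {i // p i = q₀} ⊕ J ≃ {x : I ⊕ J // Sum.elim p (fun _ => q₀) x = q₀} where
  toFun := Sum.elim (fun i => ⟨Sum.inl i.1, i.2⟩) fun j => ⟨Sum.inr j, rfl⟩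
  invFun := fun
    | ⟨Sum.inl i, h⟩ => Sum.inl ⟨i, h⟩
    | ⟨Sum.inr j, _⟩ => Sum.inr j
  left_inv := by rintro (i | j) <;> rfl
  right_inv := by rintro ⟨i | j, h⟩ <;> rfl

/-- The fibre of `q ≠ q₀` under the map `p` extended to `I ⊔ J` by the constant value `q₀`
on `J`. -/
def extendFiberOther (J : Type) (p : I → Q) {q₀ q : Q} (h : q ≠ q₀) :
    {i // p i = q} ≃ {x : I ⊕ J // Sum.elim p (fun _ => q₀) x = q} where
  toFun i := ⟨Sum.inl i.1, i.2⟩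
  invFun := fun
    | ⟨Sum.inl i, h⟩ => ⟨i, h⟩
    | ⟨Sum.inr _, h'⟩ => absurd h'.symm h
  left_inv _ := rfl
  right_inv := by
    rintro ⟨i | j, h'⟩
    · rfl
    · exact absurd h'.symm h

variable [Finite I] [Finite J] [Finite Q]

open Classical in
/-- The linear map sending `t` to the map `⨂_q m_q ↦ ⨂_q m'_q`, where `m'_{q₀} = m_{q₀} · t` and
`m'_q = m_q` for `q ≠ q₀`. -/
noncomputable def actFactor (p : I → Q) (q₀ : Q) : L.obj J →ₗ[K]
    (⨂[K] q : Q, M.obj {i // p i = q}) →ₗ[K]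
      ⨂[K] q : Q, M.obj {x : I ⊕ J // Sum.elim p (fun _ => q₀) x = q} :=
  (PiTensorProduct.mapMultilinear K (fun q : Q => M.obj {i // p i = q})
      (fun q : Q => M.obj {x : I ⊕ J // Sum.elim p (fun _ => q₀) x = q})).toLinearMap
    (fun q => if h : q = q₀ then 0 else M.map (extendFiberOther J p h)) q₀ ∘ₗ
  M.act.flip.compr₂ (M.map (extendFiberSelf J p q₀))

open Classical in
/-- The family `m'` with `m'_{q₀} = m_{q₀} · t` and `m'_q = m_q` for `q ≠ q₀`. -/
noncomputable def actFamily (p : I → Q) (q₀ : Q) (t : L.obj J) (m : ∀ q, M.obj {i // p i = q})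
    (q : Q) : M.obj {x : I ⊕ J // Sum.elim p (fun _ => q₀) x = q} :=
  Function.update (fun q => (if h : q = q₀ then 0 else M.map (extendFiberOther J p h) :
      M.obj {i // p i = q} →ₗ[K] M.obj {x : I ⊕ J // Sum.elim p (fun _ => q₀) x = q}))
    q₀ (M.act.flip.compr₂ (M.map (extendFiberSelf J p q₀)) t) q (m q)

theorem actFamily_self (p : I → Q) (q₀ : Q) (t : L.obj J) (m : ∀ q, M.obj {i // p i = q}) :
    M.actFamily p q₀ t m q₀ = M.map (extendFiberSelf J p q₀) (M.act (m q₀) t) := by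
  classical
  rw [actFamily, Function.update_self]
  rfl

theorem actFamily_ne (p : I → Q) {q₀ q : Q} (h : q ≠ q₀) (t : L.obj J)
    (m : ∀ q, M.obj {i // p i = q}) :
    M.actFamily p q₀ t m q = M.map (extendFiberOther J p h) (m q) := by
  classical
  rw [actFamily, Function.update_of_ne h, dif_neg h]

theorem actFactor_tprod (p : I → Q) (q₀ : Q) (t : L.obj J) (m : ∀ q, M.obj {i // p i = q}) :
    M.actFactor p q₀ t (PiTensorProduct.tprod K m) =
      PiTensorProduct.tprod K (M.actFamily p q₀ t m) := by
  classical
  simp only [actFactor, LinearMap.comp_apply, MultilinearMap.toLinearMap_apply,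
    PiTensorProduct.mapMultilinear_apply, PiTensorProduct.map_tprod]
  rfl

open Classical in
/-- The action of `L` on `F ∘ M` by derivations: `t` sends `a ⊗ ⨂_c m_c` to the sum over the
classes `c₀` of the tensors obtained by replacing `m_{c₀}` with `m_{c₀} · t`. -/
noncomputable def compAct : SModule.CompObj F M.toSModule I →ₗ[K] L.obj J →ₗ[K]
    SModule.CompObj F M.toSModule (I ⊕ J) :=
  DirectSum.toModule K (Setoid I) _ fun r =>
    ∑ᶠ c₀ : Quotient r, LinearMap.flip
      ((LinearMap.lTensorHom (F.obj (Quotient r)) ∘ₗ M.actFactor (Quotient.mk r) c₀).compr₂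
        (SModule.compIncl F M.toSModule (Sum.elim (Quotient.mk r) fun _ : J => c₀)
          (extend_surjective J Quotient.mk_surjective c₀)))

theorem compAct_compMk [Fintype Q] (p : I → Q) (hp : Function.Surjective p) (a : F.obj Q)
    (m : ∀ q, M.obj {i // p i = q}) (t : L.obj J) :
    M.compAct F (SModule.compMk F M.toSModule p hp a m) t = ∑ q₀ : Q,
      SModule.compMk F M.toSModule (Sum.elim p fun _ : J => q₀) (extend_surjective J hp q₀) a
        (M.actFamily p q₀ t m) := by
  have := Fintype.ofFinite (Quotient (Setoid.ker p))
  rw [SModule.compMk_def, compAct, DirectSum.toModule_lof, finsum_eq_sum_of_fintype,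
    LinearMap.sum_apply, LinearMap.sum_apply, ← (SModule.kerEquiv p hp).sum_comp]
  refine Finset.sum_congr rfl fun c₀ _ => ?_
  rw [LinearMap.flip_apply, LinearMap.compr₂_apply, LinearMap.comp_apply,
    LinearMap.coe_lTensorHom, LinearMap.lTensor_tmul, actFactor_tprod]
  refine SModule.compMk_congr F M.toSModule (SModule.kerEquiv p hp) ?_ ?_ ?_
  · rintro (i | j) <;> rfl
  · rw [F.map_map]
    exact F.map_eq_self (fun i => by simp) _
  · intro c
    refine ⟨SModule.fiberEquiv (Equiv.refl _) _ _ _ _ ?_, fun i => rfl, ?_⟩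
    · rintro (i | j)
      · exact (SModule.kerEquiv_eq_iff p hp c i).symm
      · exact (SModule.kerEquiv p hp).apply_eq_iff_eq.symm
    · by_cases h : c = c₀
      · subst h
        rw [actFamily_self, actFamily_self, act_map_left, M.map_map, M.map_map]
        refine M.map_congr ?_ _
        rintro (i | j) <;> rfl
      · rw [actFamily_ne _ _ h, actFamily_ne _ _ fun h' => h ((SModule.kerEquiv p hp).injective h'),
          M.map_map, M.map_map]
        refine M.map_congr (fun i => ?_) _
        rfl

theorem compMk_update_sub {p : I → Q} (hp : Function.Surjective p) [DecidableEq Q] (a : F.obj Q)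
    (m : ∀ q, M.obj {i // p i = q}) (q : Q) (x y : M.obj {i // p i = q}) :
    SModule.compMk F M.toSModule p hp a (Function.update m q (x - y)) =
      SModule.compMk F M.toSModule p hp a (Function.update m q x) -
        SModule.compMk F M.toSModule p hp a (Function.update m q y) := by
  simp only [SModule.compMk, MultilinearMap.map_update_sub, TensorProduct.tmul_sub, map_sub]

theorem compMap_compAct {I₁ J₁ : Type} [Finite I₁] [Finite J₁] (e : I ≃ I₁) (f : J ≃ J₁)
    (x : SModule.CompObj F M.toSModule I) (t : L.obj J) :
    SModule.compMap F M.toSModule (Equiv.sumCongr e f) (M.compAct F x t) =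
      M.compAct F (SModule.compMap F M.toSModule e x) (L.map f t) := by
  induction x using SModule.comp_induction with
  | zero => simp
  | add x y hx hy => simp only [map_add, LinearMap.add_apply, hx, hy]
  | mk r a m =>
    have := Fintype.ofFinite (Quotient r)
    rw [compAct_compMk, SModule.compMap_compMk, compAct_compMk, map_sum]
    refine Finset.sum_congr rfl fun q₀ _ => ?_
    rw [SModule.compMap_compMk]
    refine SModule.compMk_congr' F M.toSModule ?_ ?_
    · rintro (i | j) <;> rfl
    · intro q
      by_cases h : q = q₀
      · subst h
        rw [actFamily_self, actFamily_self, ← M.map_act, M.map_map, M.map_map, M.map_map]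
        refine M.map_congr ?_ _
        rintro (i | j) <;> rfl
      · rw [actFamily_ne _ _ h, actFamily_ne _ _ h, M.map_map, M.map_map, M.map_map]
        refine M.map_congr (fun i => ?_) _
        rfl

theorem compAct_bracket {J₁ : Type} [Finite J₁]
    (x : SModule.CompObj F M.toSModule I) (s : L.obj J) (t : L.obj J₁) :
    M.compAct F x (L.bracket s t) =
      SModule.compMap F M.toSModule (Equiv.sumAssoc I J J₁) (M.compAct F (M.compAct F x s) t) -
      SModule.compMap F M.toSModule (sumAssocSwap I J₁ J)
        (M.compAct F (M.compAct F x t) s) := by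
  classical
  induction x using SModule.comp_induction with
  | zero => simp
  | add x y hx hy => simp only [map_add, LinearMap.add_apply, hx, hy]; abel
  | mk r a m =>
    have := Fintype.ofFinite (Quotient r)
    simp only [compAct_compMk, LinearMap.sum_apply, map_sum, SModule.compMap_compMk]
    rw [Finset.sum_comm (f := fun q₀ q₁ => SModule.compMk F M.toSModule _ _ a fun q =>
      M.map (SModule.fiberEquiv (sumAssocSwap I J₁ J) _ q _ q _) _), ← Finset.sum_sub_distrib]
    refine Finset.sum_congr rfl fun q₀ _ => ?_
    rw [← Finset.sum_sub_distrib, Finset.sum_eq_single q₀]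
    · have hx : M.actFamily (Quotient.mk r) q₀ (L.bracket s t) m q₀ =
          M.map (extendFiberSelf (J ⊕ J₁) (Quotient.mk r) q₀) (M.map (Equiv.sumAssoc _ J J₁)
            (M.act (M.act (m q₀) s) t)) -
          M.map (extendFiberSelf (J ⊕ J₁) (Quotient.mk r) q₀) (M.map (sumAssocSwap _ J₁ J)
            (M.act (M.act (m q₀) t) s)) := by
        rw [actFamily_self, M.act_bracket, map_sub]
      rw [← Function.update_eq_self q₀ (M.actFamily (Quotient.mk r) q₀ (L.bracket s t) m), hx,
        compMk_update_sub]
      congr 1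
      · refine SModule.compMk_congr' F M.toSModule ?_ ?_
        · rintro (i | j | j) <;> rfl
        · intro q
          by_cases h : q = q₀
          · subst h
            rw [Function.update_self, actFamily_self, actFamily_self, act_map_left, M.map_map,
              M.map_map, M.map_map, M.map_map]
            refine M.map_congr ?_ _
            rintro ((i | j) | j) <;> rfl
          · rw [Function.update_of_ne h, actFamily_ne _ _ h, actFamily_ne _ _ h,
              actFamily_ne _ _ h, M.map_map, M.map_map, M.map_map]
            refine M.map_congr (fun i => ?_) _
            rfl
      · refine SModule.compMk_congr' F M.toSModule ?_ ?_
        · rintro (i | j | j) <;> rfl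
        · intro q
          by_cases h : q = q₀
          · subst h
            rw [Function.update_self, actFamily_self, actFamily_self, act_map_left, M.map_map,
              M.map_map, M.map_map, M.map_map]
            refine M.map_congr ?_ _
            rintro ((i | j) | j) <;> rfl
          · rw [Function.update_of_ne h, actFamily_ne _ _ h, actFamily_ne _ _ h,
              actFamily_ne _ _ h, M.map_map, M.map_map, M.map_map]
            refine M.map_congr (fun i => ?_) _
            rfl
    · intro q₁ _ h
      rw [sub_eq_zero]
      refine SModule.compMk_congr' F M.toSModule ?_ ?_
      · rintro (i | j | j) <;> rfl
      · intro q
        by_cases h₀ : q = q₀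
        · subst h₀
          rw [actFamily_ne _ _ h.symm, actFamily_self, actFamily_self, actFamily_ne _ _ h.symm,
            act_map_left]
          simp only [M.map_map]
          refine M.map_congr ?_ _
          rintro (i | j) <;> rfl
        · by_cases h₁ : q = q₁
          · subst h₁
            rw [actFamily_ne _ _ h, actFamily_self, actFamily_self, actFamily_ne _ _ h,
              act_map_left]
            simp only [M.map_map]
            refine M.map_congr ?_ _
            rintro (i | j) <;> rfl
          · rw [actFamily_ne _ _ h₀, actFamily_ne _ _ h₁, actFamily_ne _ _ h₀,
              actFamily_ne _ _ h₁]
            simp only [M.map_map]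
            refine M.map_congr (fun i => ?_) _
            rfl
    · intro h
      exact absurd (Finset.mem_univ _) h

end

/-- The composition `F ∘ M` of an `𝔖`-module `F` with a module `M` over a Lie algebra, on which
the Lie algebra acts by derivations. -/
noncomputable def compLeft : SLieModule L where
  toSModule := F.comp M.toSModule
  act := M.compAct F
  map_act e f x t := M.compMap_compAct F e f x t
  act_bracket x s t := M.compAct_bracket F x s t

end SLieModule

/-! ### The universal enveloping algebra -/

namespace SLieAlgebra

variable {K : Type u} [Field K] (L : SLieAlgebra K)

/-- A letter on `I`: an element of `L(S)` for some subset `S` of `I`. -/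
abbrev Letter (I : Type) [Finite I] : Type u := Σ S : Set I, L.obj S

/-- The bijection `S ⊔ T ≃ S ∪ T` for disjoint subsets `S` and `T`. -/
noncomputable def unionEquiv {I : Type} {S T : Set I} (h : Disjoint S T) :
    S ⊕ T ≃ (S ∪ T : Set I) :=
  Equiv.ofBijective
    (Sum.elim (fun i => ⟨i.1, Or.inl i.2⟩) fun i => ⟨i.1, Or.inr i.2⟩) (by
      constructor
      · rintro (⟨i, hi⟩ | ⟨i, hi⟩) (⟨j, hj⟩ | ⟨j, hj⟩) hij <;>
          obtain rfl : i = j := congrArg Subtype.val hij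
        · rfl
        · exact absurd hj (Set.disjoint_left.1 h hi)
        · exact absurd hi (Set.disjoint_left.1 h hj)
        · rfl
      · rintro ⟨i, hi | hi⟩
        · exact ⟨Sum.inl ⟨i, hi⟩, rfl⟩
        · exact ⟨Sum.inr ⟨i, hi⟩, rfl⟩)

section

variable {L} {I J H : Type} [Finite I] [Finite J] [Finite H]

/-- The bracket of two letters with disjoint supports. -/
noncomputable def Letter.bracket (a b : L.Letter I) (h : Disjoint a.1 b.1) : L.Letter I :=
  ⟨a.1 ∪ b.1, L.map (unionEquiv h) (L.bracket a.2 b.2)⟩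

/-- The image of a letter under an injection. -/
noncomputable def Letter.push (f : I ↪ J) (a : L.Letter I) : L.Letter J :=
  ⟨f '' a.1, L.map (Equiv.Set.image f a.1 f.injective) a.2⟩

theorem Letter.ext {S T : Set I} (h : S = T) {x : L.obj S} {y : L.obj T}
    (hx : L.map (Equiv.setCongr h) x = y) : (⟨S, x⟩ : L.Letter I) = ⟨T, y⟩ := by
  subst h
  rw [← hx]
  congr 1
  exact (L.map_eq_self (fun _ => rfl) x).symm

theorem Letter.push_push (f : I ↪ J) (g : J ↪ H) (a : L.Letter I) :
    (a.push f).push g = a.push (f.trans g) := by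
  obtain ⟨S, x⟩ := a
  have hS : g '' (f '' S) = (f.trans g) '' S := Set.image_image _ _ _
  have h : L.map (Equiv.setCongr hS) (L.map (Equiv.Set.image g (f '' S) g.injective)
      (L.map (Equiv.Set.image f S f.injective) x)) =
      L.map (Equiv.Set.image (f.trans g) S (f.trans g).injective) x := by
    rw [L.map_map, L.map_map]
    refine L.map_congr ?_ _
    intro i
    rfl
  exact Letter.ext hS h

theorem Letter.push_refl (a : L.Letter I) : a.push (Function.Embedding.refl I) = a := by
  obtain ⟨S, x⟩ := a
  have hS : Function.Embedding.refl I '' S = S := Set.image_id _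
  have h : L.map (Equiv.setCongr hS) (L.map (Equiv.Set.image (Function.Embedding.refl I) S
      (Function.Embedding.refl I).injective) x) = x := by
    rw [L.map_map]
    exact L.map_eq_self (fun _ => rfl) _
  exact Letter.ext hS h

theorem Letter.push_bracket (f : I ↪ J) (a b : L.Letter I) (h : Disjoint a.1 b.1) :
    (a.bracket b h).push f =
      (a.push f).bracket (b.push f) ((Set.disjoint_image_iff f.injective).2 h) := by
  obtain ⟨S, x⟩ := a
  obtain ⟨T, y⟩ := b
  have hS : f '' (S ∪ T) = f '' S ∪ f '' T := Set.image_union _ _ _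
  have hd : Disjoint S T := h
  have h : L.map (Equiv.setCongr hS) (L.map (Equiv.Set.image f (S ∪ T) f.injective)
      (L.map (unionEquiv hd) (L.bracket x y))) =
      L.map (unionEquiv ((Set.disjoint_image_iff f.injective).2 hd))
        (L.bracket (L.map (Equiv.Set.image f S f.injective) x)
          (L.map (Equiv.Set.image f T f.injective) y)) := by
    rw [← L.map_bracket, L.map_map, L.map_map, L.map_map]
    refine L.map_congr ?_ _
    rintro (i | i) <;> rfl
  exact Letter.ext hS h

theorem map_push_push (f : I ↪ J) (g : J ↪ H) (l : List (L.Letter I)) :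
    (l.map (Letter.push f)).map (Letter.push g) = l.map (Letter.push (f.trans g)) := by
  rw [List.map_map]
  exact List.map_congr_left fun a _ => Letter.push_push f g a

theorem map_push_refl (f : I ↪ I) (hf : ∀ i, f i = i) (l : List (L.Letter I)) :
    l.map (Letter.push f) = l := by
  obtain rfl : f = Function.Embedding.refl I := by ext i; exact hf i
  exact (List.map_congr_left fun a _ => Letter.push_refl a).trans l.map_id

/-- A list of letters is a word on `I` if the supports of its letters form a decomposition of `I`
into disjoint subsets. -/
def IsWord (l : List (L.Letter I)) : Prop :=
  l.Pairwise (fun a b => Disjoint a.1 b.1) ∧ ∀ i : I, ∃ a ∈ l, i ∈ a.1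

variable (L) in
/-- The defining relations of the universal enveloping algebra of `L`. The free vector space on
the words on `I`, modulo multilinearity, is the value on `I` of the tensor algebra of `L`; lists of
letters that are not words on `I` are set to zero. -/
inductive EnvRel (I : Type) [Finite I] : (List (L.Letter I) →₀ K) → Prop
  | not_word (l : List (L.Letter I)) (h : ¬ IsWord l) : EnvRel I (Finsupp.single l 1)
  | add (u v : List (L.Letter I)) (S : Set I) (x y : L.obj S) :
      EnvRel I (Finsupp.single (u ++ ⟨S, x + y⟩ :: v) 1 -
        (Finsupp.single (u ++ ⟨S, x⟩ :: v) 1 + Finsupp.single (u ++ ⟨S, y⟩ :: v) 1))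
  | smul (u v : List (L.Letter I)) (S : Set I) (c : K) (x : L.obj S) :
      EnvRel I (Finsupp.single (u ++ ⟨S, c • x⟩ :: v) 1 -
        c • Finsupp.single (u ++ ⟨S, x⟩ :: v) 1)
  | lie (u v : List (L.Letter I)) (a b : L.Letter I) (h : Disjoint a.1 b.1) :
      EnvRel I (Finsupp.single (u ++ a :: b :: v) 1 - Finsupp.single (u ++ b :: a :: v) 1 -
        Finsupp.single (u ++ a.bracket b h :: v) 1)

variable (L) in
/-- The value on `I` of the universal enveloping algebra of `L`. -/
abbrev EnvObj (I : Type) [Finite I] : Type u :=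
  (List (L.Letter I) →₀ K) ⧸ Submodule.span K {x | EnvRel L I x}

/-- The element of the universal enveloping algebra given by a word. -/
noncomputable def envMk (l : List (L.Letter I)) : L.EnvObj I :=
  Submodule.Quotient.mk (Finsupp.single l 1)

theorem envMk_eq_zero {l : List (L.Letter I)} (h : ¬ IsWord l) : envMk l = 0 :=
  (Submodule.Quotient.mk_eq_zero _).2 (Submodule.subset_span (EnvRel.not_word l h))

theorem envMk_add (u v : List (L.Letter I)) (S : Set I) (x y : L.obj S) :
    envMk (u ++ ⟨S, x + y⟩ :: v) = envMk (u ++ ⟨S, x⟩ :: v) + envMk (u ++ ⟨S, y⟩ :: v) :=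
  (Submodule.Quotient.eq _).2 (Submodule.subset_span (EnvRel.add u v S x y))

theorem envMk_smul (u v : List (L.Letter I)) (S : Set I) (c : K) (x : L.obj S) :
    envMk (u ++ ⟨S, c • x⟩ :: v) = c • envMk (u ++ ⟨S, x⟩ :: v) :=
  (Submodule.Quotient.eq _).2 (Submodule.subset_span (EnvRel.smul u v S c x))

theorem envMk_lie (u v : List (L.Letter I)) (a b : L.Letter I) (h : Disjoint a.1 b.1) :
    envMk (u ++ a :: b :: v) - envMk (u ++ b :: a :: v) = envMk (u ++ a.bracket b h :: v) :=
  (Submodule.Quotient.eq _).2 (Submodule.subset_span (EnvRel.lie u v a b h))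

/-- A function on lists of letters that is compatible with the defining relations. -/
structure EnvCompatible {X : Type*} [AddCommGroup X] [Module K X]
    (φ : List (L.Letter I) → X) : Prop where
  not_word (l : List (L.Letter I)) (h : ¬ IsWord l) : φ l = 0
  add (u v : List (L.Letter I)) (S : Set I) (x y : L.obj S) :
    φ (u ++ ⟨S, x + y⟩ :: v) = φ (u ++ ⟨S, x⟩ :: v) + φ (u ++ ⟨S, y⟩ :: v)
  smul (u v : List (L.Letter I)) (S : Set I) (c : K) (x : L.obj S) :
    φ (u ++ ⟨S, c • x⟩ :: v) = c • φ (u ++ ⟨S, x⟩ :: v)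
  lie (u v : List (L.Letter I)) (a b : L.Letter I) (h : Disjoint a.1 b.1) :
    φ (u ++ a :: b :: v) - φ (u ++ b :: a :: v) = φ (u ++ a.bracket b h :: v)

/-- The linear map on the universal enveloping algebra with given values on words. -/
noncomputable def envLift {X : Type*} [AddCommGroup X] [Module K X] (φ : List (L.Letter I) → X)
    (hφ : EnvCompatible φ) : L.EnvObj I →ₗ[K] X :=
  Submodule.liftQ _ (Finsupp.lift X K _ φ) <| by
    rw [Submodule.span_le]
    have key : ∀ l, Finsupp.lift X K _ φ (Finsupp.single l 1) = φ l := fun l => by simp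
    rintro _ (⟨l, h⟩ | ⟨u, v, S, x, y⟩ | ⟨u, v, S, c, x⟩ | ⟨u, v, a, b, h⟩)
    · rw [SetLike.mem_coe, LinearMap.mem_ker, key, hφ.not_word l h]
    · rw [SetLike.mem_coe, LinearMap.mem_ker, map_sub, map_add, key, key, key, hφ.add, sub_self]
    · rw [SetLike.mem_coe, LinearMap.mem_ker, map_sub, map_smul, key, key, hφ.smul, sub_self]
    · rw [SetLike.mem_coe, LinearMap.mem_ker, map_sub, map_sub, key, key, key, hφ.lie u v a b h,
        sub_self]

theorem envLift_mk {X : Type*} [AddCommGroup X] [Module K X] (φ : List (L.Letter I) → X)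
    (hφ : EnvCompatible φ) (l : List (L.Letter I)) : envLift φ hφ (envMk l) = φ l := by
  simp [envLift, envMk]

theorem env_induction {P : L.EnvObj I → Prop} (x : L.EnvObj I) (zero : P 0)
    (add : ∀ x y, P x → P y → P (x + y)) (smul : ∀ (c : K) x, P x → P (c • x))
    (mk : ∀ l, P (envMk l)) : P x := by
  induction x using Submodule.Quotient.induction_on with
  | H x =>
  induction x using Finsupp.induction_linear with
  | zero => exact zero
  | add x y hx hy => exact add _ _ hx hy
  | single l c =>
    have := smul c _ (mk l)
    rwa [envMk, ← Submodule.Quotient.mk_smul, Finsupp.smul_single, smul_eq_mul, mul_one] at this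

theorem IsWord.of_map (e : I ≃ J) {l : List (L.Letter I)}
    (h : IsWord (l.map (Letter.push e.toEmbedding))) : IsWord l := by
  refine ⟨(List.pairwise_map.1 h.1).imp fun h => (Set.disjoint_image_iff e.injective).1 h,
    fun i => ?_⟩
  obtain ⟨_, hb, hi⟩ := h.2 (e i)
  obtain ⟨a, ha, rfl⟩ := List.mem_map.1 hb
  obtain ⟨j, hj, hji⟩ := hi
  exact ⟨a, ha, e.injective hji ▸ hj⟩

/-- The inclusion of `I` in `I ⊔ J`. -/
abbrev inlEmb (I J : Type) : I ↪ I ⊕ J := Function.Embedding.inl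

/-- The inclusion of `J` in `I ⊔ J`. -/
abbrev inrEmb (I J : Type) : J ↪ I ⊕ J := Function.Embedding.inr

/-- The concatenation of lists of letters on `I` and `J`. -/
noncomputable def concat (u : List (L.Letter I)) (v : List (L.Letter J)) :
    List (L.Letter (I ⊕ J)) :=
  u.map (Letter.push (inlEmb I J)) ++ v.map (Letter.push (inrEmb I J))

theorem IsWord.left {u : List (L.Letter I)} {v : List (L.Letter J)} (h : IsWord (concat u v)) :
    IsWord u := by
  refine ⟨(List.pairwise_map.1 (List.pairwise_append.1 h.1).1).imp
    fun h => (Set.disjoint_image_iff (inlEmb I J).injective).1 h, fun i => ?_⟩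
  obtain ⟨_, hb, hi⟩ := h.2 (Sum.inl i)
  rcases List.mem_append.1 hb with hb | hb
  · obtain ⟨a, ha, rfl⟩ := List.mem_map.1 hb
    obtain ⟨j, hj, hji⟩ := hi
    exact ⟨a, ha, Sum.inl_injective hji ▸ hj⟩
  · obtain ⟨a, ha, rfl⟩ := List.mem_map.1 hb
    obtain ⟨j, hj, hji⟩ := hi
    exact absurd hji Sum.inr_ne_inl

theorem IsWord.right {u : List (L.Letter I)} {v : List (L.Letter J)} (h : IsWord (concat u v)) :
    IsWord v := by
  refine ⟨(List.pairwise_map.1 (List.pairwise_append.1 h.1).2.1).imp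
    fun h => (Set.disjoint_image_iff (inrEmb I J).injective).1 h, fun i => ?_⟩
  obtain ⟨_, hb, hi⟩ := h.2 (Sum.inr i)
  rcases List.mem_append.1 hb with hb | hb
  · obtain ⟨a, ha, rfl⟩ := List.mem_map.1 hb
    obtain ⟨j, hj, hji⟩ := hi
    exact absurd hji Sum.inl_ne_inr
  · obtain ⟨a, ha, rfl⟩ := List.mem_map.1 hb
    obtain ⟨j, hj, hji⟩ := hi
    exact ⟨a, ha, Sum.inr_injective hji ▸ hj⟩

theorem Letter.push_add (f : I ↪ J) (S : Set I) (x y : L.obj S) :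
    Letter.push (L := L) f ⟨S, x + y⟩ = ⟨f '' S, L.map (Equiv.Set.image f S f.injective) x +
      L.map (Equiv.Set.image f S f.injective) y⟩ := by
  rw [← map_add]; rfl

theorem Letter.push_smul (f : I ↪ J) (S : Set I) (c : K) (x : L.obj S) :
    Letter.push (L := L) f ⟨S, c • x⟩ =
      ⟨f '' S, c • L.map (Equiv.Set.image f S f.injective) x⟩ := by
  rw [← map_smul]; rfl

theorem envCompatible_map (f : I ↪ J) (u v : List (L.Letter J))
    (h : ∀ l, IsWord (u ++ (l.map (Letter.push f) ++ v)) → IsWord l) :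
    EnvCompatible fun l : List (L.Letter I) => envMk (u ++ (l.map (Letter.push f) ++ v)) where
  not_word l hl := envMk_eq_zero fun h' => hl (h l h')
  add w z S x y := by
    simp only [List.map_append, List.map_cons, List.append_assoc, List.cons_append,
      Letter.push_add]
    simp only [← List.append_assoc u]
    exact envMk_add _ _ _ _ _
  smul w z S c x := by
    simp only [List.map_append, List.map_cons, List.append_assoc, List.cons_append,
      Letter.push_smul]
    simp only [← List.append_assoc u]
    exact envMk_smul _ _ _ _ _
  lie w z a b hab := by
    simp only [List.map_append, List.map_cons, List.append_assoc, List.cons_append,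
      Letter.push_bracket]
    simp only [← List.append_assoc u]
    exact envMk_lie _ _ _ _ _

/-- The functoriality of the universal enveloping algebra. -/
noncomputable def envMap (e : I ≃ J) : L.EnvObj I →ₗ[K] L.EnvObj J :=
  envLift (fun l => envMk ([] ++ (l.map (Letter.push e.toEmbedding) ++ [])))
    (envCompatible_map _ _ _ fun l h => by
      rw [List.nil_append, List.append_nil] at h
      exact h.of_map)

theorem envMap_mk (e : I ≃ J) (l : List (L.Letter I)) :
    envMap e (envMk l) = envMk (l.map (Letter.push e.toEmbedding)) := by
  rw [envMap, envLift_mk, List.nil_append, List.append_nil]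

/-- Left multiplication by a word in the universal enveloping algebra. -/
noncomputable def envMulWord (u : List (L.Letter I)) : L.EnvObj J →ₗ[K] L.EnvObj (I ⊕ J) :=
  envLift (fun v => envMk (u.map (Letter.push (inlEmb I J)) ++
      (v.map (Letter.push (inrEmb I J)) ++ [])))
    (envCompatible_map _ _ _ fun l h => by
      rw [List.append_nil] at h
      exact IsWord.right (u := u) h)

theorem envMulWord_mk (u : List (L.Letter I)) (v : List (L.Letter J)) :
    envMulWord u (envMk v) = envMk (concat u v) := by
  rw [envMulWord, envLift_mk, List.append_nil, concat]

theorem env_hom_ext {X : Type*} [AddCommGroup X] [Module K X] {f g : L.EnvObj I →ₗ[K] X}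
    (h : ∀ l, f (envMk l) = g (envMk l)) : f = g := by
  refine LinearMap.ext fun x => ?_
  induction x using env_induction with
  | zero => simp
  | add x y hx hy => rw [map_add, map_add, hx, hy]
  | smul c x hx => rw [map_smul, map_smul, hx]
  | mk l => exact h l

theorem envMulWord_compatible :
    EnvCompatible fun u : List (L.Letter I) => envMulWord (J := J) u := by
  have key := fun v : List (L.Letter J) =>
    envCompatible_map (inlEmb I J) [] (v.map (Letter.push (inrEmb I J)))
      fun l h => IsWord.left (u := l) (v := v) h
  constructor
  · intro l hl
    refine env_hom_ext fun v => ?_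
    rw [envMulWord_mk]
    exact (key v).not_word l hl
  · intro u v S x y
    refine env_hom_ext fun w => ?_
    rw [LinearMap.add_apply, envMulWord_mk, envMulWord_mk, envMulWord_mk]
    exact (key w).add u v S x y
  · intro u v S c x
    refine env_hom_ext fun w => ?_
    rw [LinearMap.smul_apply, envMulWord_mk, envMulWord_mk]
    exact (key w).smul u v S c x
  · intro u v a b h
    refine env_hom_ext fun w => ?_
    rw [LinearMap.sub_apply, envMulWord_mk, envMulWord_mk, envMulWord_mk]
    exact (key w).lie u v a b h

/-- The product of the universal enveloping algebra, given by concatenation of words. -/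
noncomputable def envMul : L.EnvObj I →ₗ[K] L.EnvObj J →ₗ[K] L.EnvObj (I ⊕ J) :=
  envLift (fun u => envMulWord u) envMulWord_compatible

theorem envMul_mk (u : List (L.Letter I)) (v : List (L.Letter J)) :
    envMul (envMk u) (envMk v) = envMk (concat u v) := by
  rw [envMul, envLift_mk, envMulWord_mk]

end

/-- The universal enveloping algebra `U(L)` of a Lie algebra `L` in the category of
`𝔖`-modules. -/
noncomputable def env : SAlgebra K where
  obj I _ := L.EnvObj I
  map e := envMap e
  map_refl I _ x := by
    refine LinearMap.congr_fun (f := envMap (Equiv.refl I)) (g := LinearMap.id)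
      (env_hom_ext fun l => ?_) x
    rw [envMap_mk, map_push_refl _ fun i => rfl]
    rfl
  map_trans e f x := by
    refine LinearMap.congr_fun (f := envMap (e.trans f)) (g := envMap f ∘ₗ envMap e)
      (env_hom_ext fun l => ?_) x
    rw [LinearMap.comp_apply, envMap_mk, envMap_mk, envMap_mk, map_push_push]
    rfl
  mul := envMul
  one := envMk []
  map_mul e f x y := by
    induction x using env_induction with
    | zero => simp
    | add x y hx hy => simp only [map_add, LinearMap.add_apply, hx, hy]
    | smul c x hx => simp only [map_smul, LinearMap.smul_apply, hx]
    | mk u =>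
    induction y using env_induction with
    | zero => simp
    | add x y hx hy => simp only [map_add, hx, hy]
    | smul c x hx => simp only [map_smul, hx]
    | mk v =>
    rw [envMul_mk, envMap_mk, envMap_mk, envMap_mk, envMul_mk]
    simp only [concat, List.map_append, map_push_push]
    rfl
  mul_assoc x y z := by
    induction x using env_induction with
    | zero => simp
    | add x y hx hy => simp only [map_add, LinearMap.add_apply, hx, hy]
    | smul c x hx => simp only [map_smul, LinearMap.smul_apply, hx]
    | mk u =>
    induction y using env_induction with
    | zero => simp
    | add x y hx hy => simp only [map_add, LinearMap.add_apply, hx, hy]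
    | smul c x hx => simp only [map_smul, LinearMap.smul_apply, hx]
    | mk v =>
    induction z using env_induction with
    | zero => simp
    | add x y hx hy => simp only [map_add, hx, hy]
    | smul c x hx => simp only [map_smul, hx]
    | mk w =>
    rw [envMul_mk, envMul_mk, envMul_mk, envMul_mk, envMap_mk]
    simp only [concat, List.map_append, map_push_push, List.append_assoc]
    rfl
  mul_one x := by
    induction x using env_induction with
    | zero => simp
    | add x y hx hy => simp only [map_add, LinearMap.add_apply, hx, hy]
    | smul c x hx => simp only [map_smul, LinearMap.smul_apply, hx]
    | mk u =>
    rw [envMul_mk, envMap_mk, concat, List.map_nil, List.append_nil, map_push_push,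
      map_push_refl _ fun i => rfl]
  one_mul x := by
    induction x using env_induction with
    | zero => simp
    | add x y hx hy => simp only [map_add, hx, hy]
    | smul c x hx => simp only [map_smul, hx]
    | mk u =>
    rw [envMul_mk, envMap_mk, concat, List.map_nil, List.nil_append, map_push_push,
      map_push_refl _ fun i => rfl]

end SLieAlgebra

/-! ### Modules over a Lie algebra as modules over its universal enveloping algebra -/

namespace SLieModule

open SLieAlgebra

variable {K : Type u} [Field K] {L : SLieAlgebra K} (M : SLieModule L)

theorem act_map_right {I J J₁ : Type} [Finite I] [Finite J] [Finite J₁]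
    (f : J ≃ J₁) (x : M.obj I) (y : L.obj J) :
    M.act x (L.map f y) = M.map (Equiv.sumCongr (Equiv.refl I) f) (M.act x y) := by
  rw [M.map_act, M.map_refl]

section

variable {I J : Type} [Finite I] [Finite J]

/-- The action of a letter `a` with support disjoint from `A`, from `M(A)` to `M(A ∪ S)`. -/
noncomputable def actLetter (A : Set I) (a : L.Letter I) (h : Disjoint A a.1) :
    M.obj A →ₗ[K] M.obj (A ∪ a.1 : Set I) :=
  M.map (unionEquiv h) ∘ₗ M.act.flip a.2

open Classical in
/-- The successive action of the letters of a list, starting from `M(A)`. The result is set to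
zero if the supports of the letters and `A` do not form a decomposition of `I` into disjoint
subsets. -/
noncomputable def actList : List (L.Letter I) → ∀ A : Set I, M.obj A →ₗ[K] M.obj I
  | [], A => if h : A = Set.univ then M.map ((Equiv.setCongr h).trans (Equiv.Set.univ I)) else 0
  | a :: l, A => if h : Disjoint A a.1 then actList l (A ∪ a.1) ∘ₗ M.actLetter A a h else 0

theorem actList_cons (a : L.Letter I) (l : List (L.Letter I)) (A : Set I) (h : Disjoint A a.1)
    (m : M.obj A) : M.actList (a :: l) A m = M.actList l (A ∪ a.1) (M.actLetter A a h m) := by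
  rw [actList, dif_pos h]
  rfl

theorem actList_cons_of_not (a : L.Letter I) (l : List (L.Letter I)) (A : Set I)
    (h : ¬ Disjoint A a.1) (m : M.obj A) : M.actList (a :: l) A m = 0 := by
  rw [actList, dif_neg h]
  rfl

theorem actList_congr (l : List (L.Letter I)) {A B : Set I} (h : A = B) (m : M.obj A) (n : M.obj B)
    (hm : M.map (Equiv.setCongr h) m = n) : M.actList l A m = M.actList l B n := by
  subst h
  rw [← hm]
  congr 1
  exact (M.map_eq_self (fun _ => rfl) m).symm

theorem actList_append_congr (u : List (L.Letter I)) {v w : List (L.Letter I)}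
    (h : ∀ A m, M.actList v A m = M.actList w A m) (A : Set I) (m : M.obj A) :
    M.actList (u ++ v) A m = M.actList (u ++ w) A m := by
  induction u generalizing A with
  | nil => exact h A m
  | cons a u ih =>
    by_cases hd : Disjoint A a.1
    · rw [List.cons_append, List.cons_append, actList_cons _ _ _ _ hd, actList_cons _ _ _ _ hd, ih]
    · rw [List.cons_append, List.cons_append, actList_cons_of_not _ _ _ _ hd,
        actList_cons_of_not _ _ _ _ hd]

theorem actList_add (u v : List (L.Letter I)) (S : Set I) (x y : L.obj S) (A : Set I)
    (m : M.obj A) : M.actList (u ++ ⟨S, x + y⟩ :: v) A m =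
      M.actList (u ++ ⟨S, x⟩ :: v) A m + M.actList (u ++ ⟨S, y⟩ :: v) A m := by
  induction u generalizing A with
  | nil =>
    by_cases hd : Disjoint A S
    · rw [List.nil_append, List.nil_append, List.nil_append, actList_cons _ _ _ _ hd,
        actList_cons _ _ _ _ hd, actList_cons _ _ _ _ hd, ← map_add]
      congr 1
      simp only [actLetter, LinearMap.comp_apply, map_add, LinearMap.add_apply]
    · rw [List.nil_append, List.nil_append, List.nil_append, actList_cons_of_not _ _ _ _ hd,
        actList_cons_of_not _ _ _ _ hd, actList_cons_of_not _ _ _ _ hd, add_zero]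
  | cons a u ih =>
    by_cases hd : Disjoint A a.1
    · simp only [List.cons_append, actList_cons _ _ _ _ hd, ih]
    · simp only [List.cons_append, actList_cons_of_not _ _ _ _ hd, add_zero]

theorem actList_smul (u v : List (L.Letter I)) (S : Set I) (c : K) (x : L.obj S) (A : Set I)
    (m : M.obj A) : M.actList (u ++ ⟨S, c • x⟩ :: v) A m =
      c • M.actList (u ++ ⟨S, x⟩ :: v) A m := by
  induction u generalizing A with
  | nil =>
    by_cases hd : Disjoint A S
    · rw [List.nil_append, List.nil_append, actList_cons _ _ _ _ hd,
        actList_cons _ _ _ _ hd, ← map_smul]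
      congr 1
      simp only [actLetter, LinearMap.comp_apply, map_smul, LinearMap.smul_apply]
    · rw [List.nil_append, List.nil_append, actList_cons_of_not _ _ _ _ hd,
        actList_cons_of_not _ _ _ _ hd, smul_zero]
  | cons a u ih =>
    by_cases hd : Disjoint A a.1
    · simp only [List.cons_append, actList_cons _ _ _ _ hd, ih]
    · simp only [List.cons_append, actList_cons_of_not _ _ _ _ hd, smul_zero]

theorem actList_lie_aux (v : List (L.Letter I)) (a b : L.Letter I) (h : Disjoint a.1 b.1)
    (A : Set I) (m : M.obj A) :
    M.actList (a :: b :: v) A m - M.actList (b :: a :: v) A m =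
      M.actList (a.bracket b h :: v) A m := by
  by_cases ha : Disjoint A a.1
  · by_cases hb : Disjoint A b.1
    · have hab : Disjoint (A ∪ a.1) b.1 := Set.disjoint_union_left.2 ⟨hb, h⟩
      have hba : Disjoint (A ∪ b.1) a.1 := Set.disjoint_union_left.2 ⟨ha, h.symm⟩
      have hA : Disjoint A (a.bracket b h).1 := Set.disjoint_union_right.2 ⟨ha, hb⟩
      rw [actList_cons _ _ _ _ ha, actList_cons _ _ _ _ hab, actList_cons _ _ _ _ hb,
        actList_cons _ _ _ _ hba, actList_cons _ _ _ _ hA]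
      have e1 : (A ∪ a.1) ∪ b.1 = A ∪ (a.1 ∪ b.1) := Set.union_assoc _ _ _
      have e2 : (A ∪ b.1) ∪ a.1 = A ∪ (a.1 ∪ b.1) := by
        rw [Set.union_assoc, Set.union_comm b.1]
      rw [M.actList_congr v e1 _ _ rfl, M.actList_congr v e2 _ _ rfl, ← map_sub]
      change _ = M.actList v (A ∪ (a.1 ∪ b.1)) _
      congr 1
      obtain ⟨S, x⟩ := a
      obtain ⟨T, y⟩ := b
      change M.map (Equiv.setCongr e1) (M.map (unionEquiv hab)
          (M.act (M.map (unionEquiv ha) (M.act m x)) y)) -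
        M.map (Equiv.setCongr e2) (M.map (unionEquiv hba)
          (M.act (M.map (unionEquiv hb) (M.act m y)) x)) =
        M.map (unionEquiv (T := S ∪ T) hA) (M.act m (L.map (unionEquiv (T := T) h)
          (L.bracket x y)))
      rw [act_map_right, M.act_bracket, map_sub, map_sub, act_map_left, act_map_left]
      simp only [M.map_map]
      congr 1
      · refine M.map_congr ?_ _
        rintro ((i | i) | i) <;> rfl
      · refine M.map_congr ?_ _
        rintro ((i | i) | i) <;> rfl
    · have hA : ¬ Disjoint A (a.bracket b h).1 := fun h' => hb (Set.disjoint_union_right.1 h').2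
      have hab : ¬ Disjoint (A ∪ a.1) b.1 := fun h' => hb (Set.disjoint_union_left.1 h').1
      rw [actList_cons _ _ _ _ ha, actList_cons_of_not _ _ _ _ hab, actList_cons_of_not _ _ _ _ hb,
        actList_cons_of_not _ _ _ _ hA, sub_zero]
  · have hA : ¬ Disjoint A (a.bracket b h).1 := fun h' => ha (Set.disjoint_union_right.1 h').1
    rw [actList_cons_of_not _ _ _ _ ha, actList_cons_of_not _ _ _ _ hA, zero_sub, neg_eq_zero]
    by_cases hb : Disjoint A b.1
    · have hba : ¬ Disjoint (A ∪ b.1) a.1 := fun h' => ha (Set.disjoint_union_left.1 h').1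
      rw [actList_cons _ _ _ _ hb, actList_cons_of_not _ _ _ _ hba]
    · rw [actList_cons_of_not _ _ _ _ hb]

theorem actList_lie (u v : List (L.Letter I)) (a b : L.Letter I) (h : Disjoint a.1 b.1)
    (A : Set I) (m : M.obj A) :
    M.actList (u ++ a :: b :: v) A m - M.actList (u ++ b :: a :: v) A m =
      M.actList (u ++ a.bracket b h :: v) A m := by
  induction u generalizing A with
  | nil => exact M.actList_lie_aux v a b h A m
  | cons c u ih =>
    by_cases hd : Disjoint A c.1
    · simp only [List.cons_append, actList_cons _ _ _ _ hd, ih]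
    · simp only [List.cons_append, actList_cons_of_not _ _ _ _ hd, sub_zero]

/-- The supports of the letters of `l` and the set `A` form a decomposition of `I`. -/
def IsWordFrom (A : Set I) (l : List (L.Letter I)) : Prop :=
  l.Pairwise (fun a b => Disjoint a.1 b.1) ∧ (∀ a ∈ l, Disjoint A a.1) ∧
    ∀ i : I, i ∈ A ∨ ∃ a ∈ l, i ∈ a.1

theorem isWordFrom_cons {A : Set I} {a : L.Letter I} {l : List (L.Letter I)} :
    IsWordFrom A (a :: l) ↔ Disjoint A a.1 ∧ IsWordFrom (A ∪ a.1) l := by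
  simp only [IsWordFrom, List.pairwise_cons, List.mem_cons, forall_eq_or_imp, exists_eq_or_imp,
    Set.disjoint_union_left, Set.mem_union, or_assoc]
  grind

theorem actList_eq_zero (l : List (L.Letter I)) (A : Set I) (h : ¬ IsWordFrom A l) (m : M.obj A) :
    M.actList l A m = 0 := by
  induction l generalizing A with
  | nil =>
    have : A ≠ Set.univ := by
      rintro rfl
      exact h ⟨List.Pairwise.nil, by simp, by simp⟩
    rw [actList, dif_neg this]
    rfl
  | cons a l ih =>
    by_cases hd : Disjoint A a.1
    · rw [actList_cons _ _ _ _ hd, ih]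
      exact fun h' => h (isWordFrom_cons.2 ⟨hd, h'⟩)
    · rw [actList_cons_of_not _ _ _ _ hd]

theorem actList_push (f : I ↪ J) (u : List (L.Letter I)) (v : List (L.Letter J)) (A : Set I)
    (hu : IsWordFrom A u) (m : M.obj A) :
    M.actList (u.map (Letter.push f) ++ v) (f '' A) (M.map (Equiv.Set.image f A f.injective) m) =
      M.actList v (Set.range f) (M.map (Equiv.ofInjective f f.injective) (M.actList u A m)) := by
  induction u generalizing A with
  | nil =>
    obtain rfl : A = Set.univ := by
      ext i
      simpa using hu.2.2 i
    rw [List.map_nil, List.nil_append, actList, dif_pos rfl]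
    refine M.actList_congr v Set.image_univ _ _ ?_
    rw [M.map_map, M.map_map]
    refine M.map_congr ?_ _
    intro i
    rfl
  | cons a u ih =>
    obtain ⟨hd, hu⟩ := isWordFrom_cons.1 hu
    have hd' : Disjoint (f '' A) (a.push f).1 := (Set.disjoint_image_iff f.injective).2 hd
    rw [List.map_cons, List.cons_append, actList_cons _ _ _ _ hd', actList_cons _ _ _ _ hd, ← ih _ hu]
    have hA : f '' A ∪ f '' a.1 = f '' (A ∪ a.1) := (Set.image_union _ _ _).symm
    refine M.actList_congr _ hA _ _ ?_
    obtain ⟨S, x⟩ := a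
    change M.map (Equiv.setCongr hA) (M.map (unionEquiv (T := f '' S) hd')
      (M.act (M.map (Equiv.Set.image f A f.injective) m)
        (L.map (Equiv.Set.image f S f.injective) x))) =
      M.map (Equiv.Set.image f (A ∪ S) f.injective) (M.map (unionEquiv (T := S) hd) (M.act m x))
    rw [← M.map_act]
    simp only [M.map_map]
    refine M.map_congr ?_ _
    rintro (i | i) <;> rfl

theorem isWordFrom_push (e : I ≃ J) (A : Set I) (u : List (L.Letter I))
    (h : IsWordFrom (e '' A) (u.map (Letter.push e.toEmbedding))) : IsWordFrom A u := by
  refine ⟨(List.pairwise_map.1 h.1).imp fun h => (Set.disjoint_image_iff e.injective).1 h,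
    fun a ha => (Set.disjoint_image_iff e.injective).1 (h.2.1 _ (List.mem_map_of_mem ha)),
    fun i => ?_⟩
  rcases h.2.2 (e i) with hi | ⟨_, hb, hi⟩
  · obtain ⟨j, hj, hji⟩ := hi
    exact Or.inl (e.injective hji ▸ hj)
  · obtain ⟨a, ha, rfl⟩ := List.mem_map.1 hb
    obtain ⟨j, hj, hji⟩ := hi
    exact Or.inr ⟨a, ha, e.injective hji ▸ hj⟩

theorem map_actList (e : I ≃ J) (u : List (L.Letter I)) (A : Set I) (m : M.obj A) :
    M.map e (M.actList u A m) =
      M.actList (u.map (Letter.push e.toEmbedding)) (e '' A)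
        (M.map (Equiv.Set.image e A e.injective) m) := by
  by_cases hu : IsWordFrom A u
  · have h := M.actList_push e.toEmbedding u [] A hu m
    rw [List.append_nil] at h
    refine Eq.trans ?_ h.symm
    rw [actList, dif_pos (show Set.range e.toEmbedding = Set.univ from e.surjective.range_eq),
      M.map_map]
    refine M.map_congr ?_ _
    intro i
    rfl
  · rw [M.actList_eq_zero u A hu, M.actList_eq_zero _ _ fun h => hu (isWordFrom_push e A u h),
      map_zero]

/-- The action of a list of letters on `J` from `M(I)` to `M(I ⊔ J)`. -/
noncomputable def actWord (l : List (L.Letter J)) : M.obj I →ₗ[K] M.obj (I ⊕ J) :=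
  M.actList (l.map (Letter.push (inrEmb I J))) (Set.range (inlEmb I J)) ∘ₗ
    M.map (Equiv.ofInjective (inlEmb I J) (inlEmb I J).injective)

theorem isWordFrom_inl (l : List (L.Letter J))
    (h : IsWordFrom (Set.range (inlEmb I J)) (l.map (Letter.push (inrEmb I J)))) : IsWord l := by
  refine ⟨(List.pairwise_map.1 h.1).imp
    fun h => (Set.disjoint_image_iff (inrEmb I J).injective).1 h, fun j => ?_⟩
  rcases h.2.2 (Sum.inr j) with ⟨i, hi⟩ | ⟨_, hb, hi⟩
  · exact absurd hi Sum.inl_ne_inr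
  · obtain ⟨a, ha, rfl⟩ := List.mem_map.1 hb
    obtain ⟨i, hi, hij⟩ := hi
    exact ⟨a, ha, Sum.inr_injective hij ▸ hi⟩

theorem IsWord.isWordFrom {l : List (L.Letter J)} (h : IsWord l) :
    IsWordFrom (Set.range (inlEmb I J)) (l.map (Letter.push (inrEmb I J))) := by
  refine ⟨List.pairwise_map.2 (h.1.imp
    fun h => (Set.disjoint_image_iff (inrEmb I J).injective).2 h), ?_, ?_⟩
  · intro _ hb
    obtain ⟨a, ha, rfl⟩ := List.mem_map.1 hb
    rw [Set.disjoint_left]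
    rintro _ ⟨i, rfl⟩ ⟨j, hj, hij⟩
    exact Sum.inr_ne_inl hij
  · rintro (i | j)
    · exact Or.inl ⟨i, rfl⟩
    · obtain ⟨a, ha, hj⟩ := h.2 j
      exact Or.inr ⟨_, List.mem_map_of_mem ha, j, hj, rfl⟩

theorem actWord_compatible : EnvCompatible fun l : List (L.Letter J) => M.actWord (I := I) l where
  not_word l h := by
    refine LinearMap.ext fun m => ?_
    exact M.actList_eq_zero _ _ (fun h' => h (isWordFrom_inl l h')) _
  add u v S x y := by
    refine LinearMap.ext fun m => ?_
    simp only [actWord, LinearMap.comp_apply, LinearMap.add_apply, List.map_append, List.map_cons,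
      Letter.push_add]
    exact M.actList_add _ _ _ _ _ _ _
  smul u v S c x := by
    refine LinearMap.ext fun m => ?_
    simp only [actWord, LinearMap.comp_apply, LinearMap.smul_apply, List.map_append, List.map_cons,
      Letter.push_smul]
    exact M.actList_smul _ _ _ _ _ _ _
  lie u v a b h := by
    refine LinearMap.ext fun m => ?_
    simp only [actWord, LinearMap.comp_apply, LinearMap.sub_apply, List.map_append, List.map_cons,
      Letter.push_bracket]
    exact M.actList_lie _ _ _ _ _ _ _

/-- The right action of the universal enveloping algebra on a module. -/
noncomputable def envAct : M.obj I →ₗ[K] L.EnvObj J →ₗ[K] M.obj (I ⊕ J) :=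
  (envLift (fun l => M.actWord l) M.actWord_compatible).flip

theorem envAct_mk (m : M.obj I) (l : List (L.Letter J)) :
    M.envAct m (envMk l) = M.actWord l m := by
  rw [envAct, LinearMap.flip_apply, envLift_mk]

theorem map_actWord {I₁ J₁ : Type} [Finite I₁] [Finite J₁] (e : I ≃ I₁) (f : J ≃ J₁)
    (m : M.obj I) (l : List (L.Letter J)) :
    M.map (Equiv.sumCongr e f) (M.actWord l m) =
      M.actWord (l.map (Letter.push f.toEmbedding)) (M.map e m) := by
  rw [actWord, LinearMap.comp_apply, map_actList, actWord, LinearMap.comp_apply, map_push_push,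
    map_push_push]
  have hA : (Equiv.sumCongr e f) '' Set.range (inlEmb I J) = Set.range (inlEmb I₁ J₁) := by
    ext (i | i)
    · simp [e.surjective i]
    · simp
  refine M.actList_congr _ hA _ _ ?_
  simp only [M.map_map]
  refine M.map_congr ?_ _
  intro i
  rfl

theorem actWord_actWord {H : Type} [Finite H] (m : M.obj I) (u : List (L.Letter J))
    (v : List (L.Letter H)) (hu : IsWord u) :
    M.map (Equiv.sumAssoc I J H) (M.actWord v (M.actWord u m)) = M.actWord (concat u v) m := by
  have h := M.actList_push (inlEmb (I ⊕ J) H) (u.map (Letter.push (inrEmb I J)))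
    (v.map (Letter.push (inrEmb (I ⊕ J) H))) _ (IsWord.isWordFrom hu)
    (M.map (Equiv.ofInjective (inlEmb I J) (inlEmb I J).injective) m)
  have h' : M.actWord v (M.actWord u m) = _ := h.symm
  rw [h', map_actList, actWord, LinearMap.comp_apply, concat, List.map_append, List.map_append,
    map_push_push, map_push_push, map_push_push, map_push_push, map_push_push]
  have hA : (Equiv.sumAssoc I J H) '' (inlEmb (I ⊕ J) H '' Set.range (inlEmb I J)) =
      Set.range (inlEmb I (J ⊕ H)) := by
    ext (i | i | i)
    · simp
    · simp
    · simp
  refine M.actList_congr _ hA _ _ ?_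
  simp only [M.map_map]
  refine M.map_congr ?_ _
  intro i
  rfl

theorem map_envAct {I₁ J₁ : Type} [Finite I₁] [Finite J₁] (e : I ≃ I₁) (f : J ≃ J₁)
    (m : M.obj I) (x : L.EnvObj J) :
    M.map (Equiv.sumCongr e f) (M.envAct m x) = M.envAct (M.map e m) (envMap f x) := by
  induction x using env_induction with
  | zero => simp
  | add x y hx hy => simp only [map_add, hx, hy]
  | smul c x hx => simp only [map_smul, hx]
  | mk l => rw [envAct_mk, envMap_mk, envAct_mk, map_actWord]

theorem envAct_envAct {H : Type} [Finite H] (m : M.obj I) (x : L.EnvObj J) (y : L.EnvObj H) :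
    M.map (Equiv.sumAssoc I J H) (M.envAct (M.envAct m x) y) = M.envAct m (envMul x y) := by
  induction x using env_induction with
  | zero => simp
  | add x y hx hy => simp only [map_add, LinearMap.add_apply, hx, hy]
  | smul c x hx => simp only [map_smul, LinearMap.smul_apply, hx]
  | mk u =>
  induction y using env_induction with
  | zero => simp
  | add x y hx hy => simp only [map_add, hx, hy]
  | smul c x hx => simp only [map_smul, hx]
  | mk v =>
  by_cases hu : IsWord u
  · rw [envAct_mk, envAct_mk, envMul_mk, envAct_mk, actWord_actWord _ _ _ _ hu]
  · rw [envMk_eq_zero hu]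
    simp

theorem envAct_one (m : M.obj I) :
    M.map (Equiv.sumEmpty I Empty) (M.envAct m (envMk [])) = m := by
  rw [envAct_mk, actWord, LinearMap.comp_apply, List.map_nil, actList,
    dif_pos (show Set.range (inlEmb I Empty) = Set.univ by
      ext (i | i)
      · simp
      · exact i.elim), M.map_map,
    M.map_map]
  exact M.map_eq_self (fun _ => rfl) _

end

/-- A module over a Lie algebra `L` in the category of `𝔖`-modules, regarded as a right module over
the universal enveloping algebra `U(L)`: the word `x₁ x₂ ⋯ x_k` sends `m` to
`(⋯((m · x₁) · x₂) ⋯) · x_k`. -/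
noncomputable def toEnv : SRightModule L.env where
  toSModule := M.toSModule
  act := M.envAct
  map_act e f m x := M.map_envAct e f m x
  act_mul m x y := M.envAct_envAct m x y
  act_one m := M.envAct_one m

end SLieModule

/-!
The `W`-module `S^μ ∘ W_pL` is projective because it is a direct summand of a free module.

In characteristic zero, `S^μ` is a natural direct summand of the `𝔖`-module of fillings of the cells
of `μ` (`exists_specht_retraction`), so it is enough to treat the module whose basis consists of the
forests with components labelled by the cells of `μ`, on which a tree acts by summing over all its
graftings on the forest (`compAct_compForest`). Fix a cell `c`. This module is free on the forests
`F` in which the root `r` of the component labelled by `c` has no child: indeed, a morphism `h` has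
to satisfy
`h (F ↶_r t) = h F · t - ∑_{v ≠ r} h (F ↶_v t)`,
where `F ↶_v t` is the forest obtained by grafting `t` on the vertex `v`, and in the terms of the
sum the root `r` has fewer children than in `F ↶_r t`. This determines `h` by recursion on the
number of children of `r` (`LabeledForest.extend`). The result does not depend on the child of `r`
that is cut off: if `s` and `t` are two children, expanding twice gives the expression
`h F · s · t - h F · (s ↶ t)` and terms that are symmetric in `s` and `t`, and the symmetry of this
expression is the relation `m · [s, t] = m · s · t - m · t · s` of Lie modules
(`LabeledForest.stepValue_graft_root`, `LabeledForest.extend_map_and_graft_root`).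

To lift a morphism along an epimorphism `g` of right `U(W)`-modules, one uses that `g` is surjective
(`SRightModule.app_surjective_of_epi`), hence has a section that is natural with respect to
bijections, obtained by averaging (`SModule.exists_natural_section`). This section provides the
values of the lift on the free generators. A natural map that commutes with the action of `W` is a
morphism of `U(W)`-modules, since `W` generates `U(W)` (`SRightModule.homOfLie`).
-/

/-! ### Averaging over bijections -/

namespace SModule

variable {K : Type u} [Field K] (A B : SModule K)

open Classical in
/-- The average, over the bijections `σ : Fin n ≃ I`, of the conjugates by `σ` of a linear map
`A(Fin n) → B(Fin n)`. It is zero unless `I` has `n` elements. -/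
noncomputable def averageAt (n : ℕ) (φ : A.obj (Fin n) →ₗ[K] B.obj (Fin n)) (I : Type) [Finite I] :
    A.obj I →ₗ[K] B.obj I :=
  letI := Fintype.ofFinite I
  (n.factorial : K)⁻¹ • ∑ σ : Fin n ≃ I, B.map σ ∘ₗ φ ∘ₗ A.map σ.symm

theorem averageAt_apply (n : ℕ) (φ : A.obj (Fin n) →ₗ[K] B.obj (Fin n)) {I : Type} [Fintype I]
    [DecidableEq I] (x : A.obj I) : averageAt A B n φ I x =
      (n.factorial : K)⁻¹ • ∑ σ : Fin n ≃ I, B.map σ (φ (A.map σ.symm x)) := by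
  rw [averageAt, LinearMap.smul_apply, LinearMap.sum_apply]
  congr 1
  refine Finset.sum_congr ?_ fun _ _ => rfl
  ext
  simp

theorem averageAt_map (n : ℕ) (φ : A.obj (Fin n) →ₗ[K] B.obj (Fin n)) {I J : Type} [Finite I]
    [Finite J] (e : I ≃ J) (x : A.obj I) :
    averageAt A B n φ J (A.map e x) = B.map e (averageAt A B n φ I x) := by
  classical
  have := Fintype.ofFinite I
  have := Fintype.ofFinite J
  rw [averageAt_apply, averageAt_apply, map_smul, map_sum,
    ← (Equiv.equivCongr (Equiv.refl (Fin n)) e).sum_comp]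
  congr 1
  refine Finset.sum_congr rfl fun σ _ => ?_
  rw [A.map_map, B.map_map]
  congr 2
  exact A.map_congr (fun i => by simp [Equiv.equivCongr]) x

/-- The family of linear maps obtained by averaging a family of linear maps
`A(Fin n) → B(Fin n)`. -/
noncomputable def average (φ : ∀ n : ℕ, A.obj (Fin n) →ₗ[K] B.obj (Fin n)) (I : Type) [Finite I] :
    A.obj I →ₗ[K] B.obj I :=
  averageAt A B (Nat.card I) (φ (Nat.card I)) I

theorem average_map (φ : ∀ n : ℕ, A.obj (Fin n) →ₗ[K] B.obj (Fin n)) {I J : Type} [Finite I]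
    [Finite J] (e : I ≃ J) (x : A.obj I) :
    average A B φ J (A.map e x) = B.map e (average A B φ I x) := by
  rw [average, average, ← Nat.card_congr e, averageAt_map]

theorem inv_factorial_smul_sum_const [CharZero K] {V : Type*} [AddCommGroup V] [Module K V]
    {I : Type} [Fintype I] [DecidableEq I] (x : V) :
    ((Nat.card I).factorial : K)⁻¹ • ∑ _σ : Fin (Nat.card I) ≃ I, x = x := by
  rw [Finset.sum_const, Finset.card_univ, Fintype.card_equiv (Finite.equivFin I).symm,
    Fintype.card_fin, ← Nat.cast_smul_eq_nsmul K, inv_smul_smul₀]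
  exact_mod_cast Nat.factorial_ne_zero _

variable {A B}

/-- In characteristic zero, a surjective morphism of `𝔖`-modules has a natural section. -/
theorem exists_natural_section [CharZero K] (g : ∀ (I : Type) [Finite I], A.obj I →ₗ[K] B.obj I)
    (hg : ∀ {I J : Type} [Finite I] [Finite J] (e : I ≃ J) (x : A.obj I),
      g J (A.map e x) = B.map e (g I x))
    (hs : ∀ (I : Type) [Finite I], Function.Surjective (g I)) :
    ∃ s : ∀ (I : Type) [Finite I], B.obj I →ₗ[K] A.obj I,
      (∀ {I J : Type} [Finite I] [Finite J] (e : I ≃ J) (x : B.obj I),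
        s J (B.map e x) = A.map e (s I x)) ∧
      ∀ {I : Type} [Finite I] (x : B.obj I), g I (s I x) = x := by
  classical
  choose φ hφ using fun n : ℕ =>
    (g (Fin n)).exists_rightInverse_of_surjective (LinearMap.range_eq_top.2 (hs (Fin n)))
  refine ⟨fun I _ => average B A φ I, fun e x => average_map B A φ e x, fun {I} _ x => ?_⟩
  have := Fintype.ofFinite I
  change g I (average B A φ I x) = x
  rw [average, averageAt_apply, map_smul, map_sum]
  refine Eq.trans ?_ (inv_factorial_smul_sum_const (K := K) (I := I) x)
  congr 1
  refine Finset.sum_congr rfl fun σ _ => ?_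
  rw [hg, show g _ (φ _ (B.map σ.symm x)) = _ from LinearMap.congr_fun (hφ _) _,
    LinearMap.id_apply, B.map_map]
  exact B.map_eq_self (fun i => by simp) x

/-- In characteristic zero, an injective morphism of `𝔖`-modules has a natural retraction. -/
theorem exists_natural_retraction [CharZero K]
    (g : ∀ (I : Type) [Finite I], A.obj I →ₗ[K] B.obj I)
    (hg : ∀ {I J : Type} [Finite I] [Finite J] (e : I ≃ J) (x : A.obj I),
      g J (A.map e x) = B.map e (g I x))
    (hi : ∀ (I : Type) [Finite I], Function.Injective (g I)) :
    ∃ s : ∀ (I : Type) [Finite I], B.obj I →ₗ[K] A.obj I,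
      (∀ {I J : Type} [Finite I] [Finite J] (e : I ≃ J) (x : B.obj I),
        s J (B.map e x) = A.map e (s I x)) ∧
      ∀ {I : Type} [Finite I] (x : A.obj I), s I (g I x) = x := by
  classical
  choose φ hφ using fun n : ℕ =>
    (g (Fin n)).exists_leftInverse_of_injective (LinearMap.ker_eq_bot.2 (hi (Fin n)))
  refine ⟨fun I _ => average B A φ I, fun e x => average_map B A φ e x, fun {I} _ x => ?_⟩
  have := Fintype.ofFinite I
  change average B A φ I (g I x) = x
  rw [average, averageAt_apply]
  refine Eq.trans ?_ (inv_factorial_smul_sum_const (K := K) (I := I) x)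
  congr 1
  refine Finset.sum_congr rfl fun σ _ => ?_
  rw [← hg, show φ _ (g _ (A.map σ.symm x)) = _ from LinearMap.congr_fun (hφ _) _,
    LinearMap.id_apply, A.map_map]
  exact A.map_eq_self (fun i => by simp) x

end SModule

/-- The `𝔖`-module of fillings of the cells of `μ`: the regular representation of the symmetric
group in degree `|μ|`. -/
noncomputable def fillings (K : Type u) [Field K] (μ : YoungDiagram) : SModule K where
  obj I _ := (μ.cells ≃ I) →₀ K
  map e := fillingMap K μ e
  map_refl _ _ _ := Finsupp.mapDomain_id
  map_trans e f _ := Finsupp.mapDomain_comp (f := fun σ : μ.cells ≃ _ => σ.trans e)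
    (g := fun σ => σ.trans f)

/-- The inclusion of `S^μ` in the `𝔖`-module of fillings has a natural retraction. -/
theorem exists_specht_retraction (K : Type u) [Field K] [CharZero K] (μ : YoungDiagram) :
    ∃ s : ∀ (I : Type) [Finite I], ((μ.cells ≃ I) →₀ K) →ₗ[K] (specht K μ).obj I,
      (∀ {I J : Type} [Finite I] [Finite J] (e : I ≃ J) (x : (μ.cells ≃ I) →₀ K),
        s J (fillingMap K μ e x) = (specht K μ).map e (s I x)) ∧
      ∀ {I : Type} [Finite I] (x : spechtSubmodule K μ I), s I x.1 = x :=
  SModule.exists_natural_retraction (A := specht K μ) (B := fillings K μ)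
    (fun I _ => (spechtSubmodule K μ I).subtype) (fun _ _ => rfl) fun _ _ => Subtype.val_injective

/-! ### Epimorphisms of modules over an algebra -/

namespace SRightModule

variable {K : Type u} [Field K] {A : SAlgebra K} {M N : SRightModule A}

/-- The cokernel of a morphism of right modules. -/
noncomputable def cokernel (g : Hom M N) : SRightModule A where
  obj I _ := N.obj I ⧸ LinearMap.range (g.app I)
  map {I J} _ _ e := Submodule.mapQ _ _ (N.map e) (by
    rintro _ ⟨m, rfl⟩
    exact ⟨M.map e m, g.naturality e m⟩)
  map_refl I _ x := by
    induction x using Submodule.Quotient.induction_on with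
    | H x => rw [Submodule.mapQ_apply, N.map_refl]
  map_trans e f x := by
    induction x using Submodule.Quotient.induction_on with
    | H x => rw [Submodule.mapQ_apply, N.map_trans]; rfl
  act {I J} _ _ := Submodule.liftQ _ (N.act.compr₂ (Submodule.mkQ _)) (by
    rintro _ ⟨m, rfl⟩
    refine LinearMap.ext fun a => (Submodule.Quotient.mk_eq_zero _).2 ?_
    exact ⟨M.act m a, g.app_act m a⟩)
  map_act e f x a := by
    induction x using Submodule.Quotient.induction_on with
    | H x => exact congrArg (Submodule.mkQ _) (N.map_act e f x a)
  act_mul x a b := by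
    induction x using Submodule.Quotient.induction_on with
    | H x => exact congrArg (Submodule.mkQ _) (N.act_mul x a b)
  act_one x := by
    induction x using Submodule.Quotient.induction_on with
    | H x => exact congrArg (Submodule.mkQ _) (N.act_one x)

theorem app_surjective_of_epi (g : M ⟶ N) [CategoryTheory.Epi g] (I : Type) [Finite I] :
    Function.Surjective (Hom.app g I) := by
  let p : N ⟶ cokernel g :=
    { app := fun I _ => Submodule.mkQ (LinearMap.range (Hom.app g I))
      naturality := fun _ _ => rfl
      app_act := fun _ _ => rfl }
  let z : N ⟶ cokernel g :=
    { app := fun I _ => 0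
      naturality := fun _ _ => (map_zero _).symm
      app_act := fun _ _ => by simp }
  have h : CategoryTheory.CategoryStruct.comp g p = CategoryTheory.CategoryStruct.comp g z := by
    refine Hom.ext (funext fun I => funext fun _ => LinearMap.ext fun m => ?_)
    exact (Submodule.Quotient.mk_eq_zero _).2 ⟨m, rfl⟩
  have h' : p = z := (CategoryTheory.cancel_epi g).1 h
  intro n
  have hn : Submodule.mkQ (LinearMap.range (Hom.app g I)) n = 0 :=
    LinearMap.congr_fun (congrFun (congrFun (congrArg Hom.app h') I) _) n
  exact (Submodule.Quotient.mk_eq_zero _).1 hn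

end SRightModule

/-! ### Modules over the universal enveloping algebra as modules over the Lie algebra -/

namespace SLieAlgebra

variable {K : Type u} [Field K] {L : SLieAlgebra K}

section

variable {I J : Type} [Finite I] [Finite J]

/-- An element of `L(J)`, regarded as a letter on `J`. -/
noncomputable def fullLetter (x : L.obj J) : L.Letter J :=
  ⟨Set.univ, L.map (Equiv.Set.univ J).symm x⟩

/-- The canonical map from a Lie algebra to its universal enveloping algebra. -/
noncomputable def envι : L.obj J →ₗ[K] L.env.obj J where
  toFun x := envMk [fullLetter x]
  map_add' x y := by
    rw [fullLetter, map_add]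
    exact envMk_add [] [] _ _ _
  map_smul' c x := by
    rw [fullLetter, map_smul]
    exact envMk_smul [] [] _ _ _

theorem envι_apply (x : L.obj J) : envι x = envMk [fullLetter x] := rfl

theorem push_fullLetter (f : J ↪ I) (x : L.obj J) :
    (fullLetter x).push f = ⟨Set.range f, L.map (Equiv.ofInjective f f.injective) x⟩ := by
  refine Letter.ext (S := f '' Set.univ) Set.image_univ ?_
  change L.map _ (L.map (Equiv.Set.image f Set.univ f.injective) (L.map _ x)) = _
  rw [L.map_map, L.map_map]
  refine L.map_congr ?_ x
  intro i
  rfl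

theorem env_map_envι (e : J ≃ I) (x : L.obj J) : L.env.map e (envι x) = envι (L.map e x) := by
  refine (envMap_mk e [fullLetter x]).trans ?_
  rw [envι_apply, List.map_singleton, push_fullLetter]
  refine congrArg (fun a => envMk [a]) (Letter.ext (I := I)
    (S := Set.range e.toEmbedding) (T := Set.univ) e.surjective.range_eq ?_)
  rw [L.map_map, L.map_map]
  refine L.map_congr ?_ x
  intro i
  rfl

/-- The commutation relation in the universal enveloping algebra. -/
theorem envι_bracket (x : L.obj I) (y : L.obj J) :
    envι (L.bracket x y) =
      L.env.mul (envι x) (envι y) -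
        L.env.map (Equiv.sumComm J I) (L.env.mul (envι y) (envι x)) := by
  change envι (L.bracket x y) = envMul (envMk [fullLetter x]) (envMk [fullLetter y]) -
    envMap (Equiv.sumComm J I) (envMul (envMk [fullLetter y]) (envMk [fullLetter x]))
  rw [envMul_mk, envMul_mk, envMap_mk]
  have hd : Disjoint ((fullLetter x).push (inlEmb I J)).1 ((fullLetter y).push (inrEmb I J)).1 := by
    rw [Set.disjoint_left]
    rintro _ ⟨i, -, rfl⟩ ⟨j, -, h⟩
    exact Sum.inr_ne_inl h
  have h := envMk_lie [] [] _ _ hd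
  have e1 : (concat [fullLetter y] [fullLetter x]).map
      (Letter.push (Equiv.sumComm J I).toEmbedding) =
      [(fullLetter y).push (inrEmb I J), (fullLetter x).push (inlEmb I J)] := by
    simp only [concat, List.map_append, map_push_push]
    rfl
  rw [e1]
  refine Eq.trans ?_ h.symm
  rw [envι_apply]
  simp only [List.nil_append, push_fullLetter]
  congr 2
  have hu : (Set.univ : Set (I ⊕ J)) = Set.range (inlEmb I J) ∪ Set.range (inrEmb I J) :=
    Set.range_inl_union_range_inr.symm
  refine Letter.ext hu ?_
  change L.map _ _ = L.map _ (L.bracket (L.map _ x) (L.map _ y))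
  rw [← L.map_bracket, L.map_map, L.map_map]
  refine L.map_congr ?_ _
  rintro (i | i) <;> rfl

theorem Letter.exists_push_eq (f : I ↪ J) (a : L.Letter J) (h : a.1 ⊆ Set.range f) :
    ∃ b : L.Letter I, b.push f = a := by
  obtain ⟨S, x⟩ := a
  have hS : f '' (f ⁻¹' S) = S := Set.image_preimage_eq_of_subset h
  refine ⟨⟨f ⁻¹' S, L.map ((Equiv.Set.image f (f ⁻¹' S) f.injective).trans
    (Equiv.setCongr hS)).symm x⟩, Letter.ext hS ?_⟩
  rw [L.map_map, L.map_map]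
  exact L.map_eq_self (fun i => by simp) x

end

/-- The universal enveloping algebra is generated by the Lie algebra. -/
theorem env_generated {P : ∀ (J : Type) [Finite J], L.env.obj J → Prop}
    (zero : ∀ (J : Type) [Finite J], P J 0)
    (add : ∀ {J : Type} [Finite J] (x y : L.env.obj J), P J x → P J y → P J (x + y))
    (smul : ∀ {J : Type} [Finite J] (c : K) (x : L.env.obj J), P J x → P J (c • x))
    (map : ∀ {I J : Type} [Finite I] [Finite J] (e : I ≃ J) (x : L.env.obj I),
      P I x → P J (L.env.map e x))
    (one : P Empty L.env.one) (gen : ∀ {J : Type} [Finite J] (x : L.obj J), P J (envι x))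
    (mul : ∀ {I J : Type} [Finite I] [Finite J] (x : L.env.obj I) (y : L.env.obj J),
      P I x → P J y → P (I ⊕ J) (L.env.mul x y)) {J : Type} [Finite J] (x : L.env.obj J) : P J x := by
  classical
  have key : ∀ (l : ℕ) (J : Type) [Finite J] (u : List (L.Letter J)), u.length = l →
      P J (envMk u) := by
    intro l
    induction l with
    | zero =>
      intro J _ u hu
      obtain rfl := List.length_eq_zero_iff.1 hu
      by_cases hJ : IsEmpty J
      · have := map (Equiv.equivOfIsEmpty Empty J) _ one
        exact (congrArg (P J) (envMap_mk _ _)).mp this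
      · rw [envMk_eq_zero]
        · exact zero J
        · intro h
          obtain ⟨i⟩ := not_isEmpty_iff.1 hJ
          obtain ⟨a, ha, -⟩ := h.2 i
          simp at ha
    | succ l ih =>
      intro J _ u hu
      obtain ⟨a, u, rfl⟩ := List.exists_cons_of_length_eq_add_one hu
      by_cases hw : IsWord (a :: u)
      · let f : {j // j ∈ a.1} ↪ J := Function.Embedding.subtype _
        let g : {j // j ∉ a.1} ↪ J := Function.Embedding.subtype _
        obtain ⟨b, hb⟩ := Letter.exists_push_eq f a (by simp [f])
        have hg : u ∈ Set.range (List.map (Letter.push (L := L) g)) := by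
          rw [Set.range_list_map]
          intro c hc
          refine Letter.exists_push_eq g c fun j hj => ?_
          simpa [g] using Set.disjoint_right.1 ((List.pairwise_cons.1 hw.1).1 c hc) hj
        obtain ⟨v, rfl⟩ := hg
        have hb' : P _ (envMk [b]) := by
          by_cases hbu : b.1 = Set.univ
          · obtain ⟨S, y⟩ := b
            obtain rfl : S = Set.univ := hbu
            have := gen (L.map (Equiv.Set.univ _) y)
            rw [envι_apply, fullLetter, L.map_map, L.map_eq_self (by simp)] at this
            exact this
          · rw [envMk_eq_zero]
            · exact zero _
            · intro h
              refine hbu (Set.eq_univ_of_forall fun i => ?_)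
              simpa using h.2 i
        have h := map (Equiv.sumCompl fun j => j ∈ a.1) _ (mul _ _ hb' (ih _ v (by simpa using hu)))
        change P J (envMap _ (envMul _ _)) at h
        rw [envMul_mk, envMap_mk] at h
        rw [concat, List.map_append, map_push_push, map_push_push, List.map_singleton] at h
        exact (congrArg (fun a => P J (envMk (a :: _))) hb).mp h
      · rw [envMk_eq_zero hw]
        exact zero J
  induction x using env_induction with
  | zero => exact zero J
  | add x y hx hy => exact add x y hx hy
  | smul c x hx => exact smul c x hx
  | mk u => exact key _ J u rfl

end SLieAlgebra

section

open SLieAlgebra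

/-- The restriction to `L` of the action of the universal enveloping algebra of `L`. -/
noncomputable def SRightModule.toLieModule {K : Type u} [Field K] {L : SLieAlgebra K}
    (E : SRightModule L.env) : SLieModule L where
  toSModule := E.toSModule
  act := E.act.compl₂ envι
  map_act e f m x := by
    rw [LinearMap.compl₂_apply, LinearMap.compl₂_apply, ← env_map_envι, E.map_act]
  act_bracket {I J H} _ _ _ m x y := by
    simp only [LinearMap.compl₂_apply]
    have h := E.act_mul m (envι x) (envι y)
    have h' := E.act_mul m (envι y) (envι x)
    have h'' := E.map_act (Equiv.refl I) (Equiv.sumComm H J) m (L.env.mul (envι y) (envι x))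
    rw [E.map_refl] at h''
    rw [envι_bracket, map_sub, h, ← h'', ← h', E.map_map]
    rfl

theorem SLieModule.toEnv_act_envι {K : Type u} [Field K] {L : SLieAlgebra K} (M : SLieModule L)
    {I J : Type} [Finite I] [Finite J] (m : M.obj I) (x : L.obj J) :
    M.toEnv.act m (envι x) = M.act m x := by
  change M.envAct m (envMk _) = _
  rw [envAct_mk, actWord, LinearMap.comp_apply, List.map_singleton, push_fullLetter]
  have hd : Disjoint (Set.range (inlEmb I J)) (Set.range (inrEmb I J)) :=
    Set.isCompl_range_inl_range_inr.disjoint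
  have hu : Set.range (inlEmb I J) ∪ Set.range (inrEmb I J) = Set.univ :=
    Set.range_inl_union_range_inr
  rw [actList_cons _ _ _ _ hd, actList, dif_pos hu, actLetter, LinearMap.comp_apply,
    LinearMap.flip_apply, ← M.map_act, M.map_map, M.map_map]
  refine M.map_eq_self ?_ _
  rintro (i | i) <;> rfl

/-- A natural family of linear maps that commutes with the actions of `L` commutes with the actions
of the universal enveloping algebra of `L`. -/
def SRightModule.homOfLie {K : Type u} [Field K] {L : SLieAlgebra K} (M E : SRightModule L.env)
    (h : ∀ (I : Type) [Finite I], M.obj I →ₗ[K] E.obj I)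
    (naturality : ∀ {I J : Type} [Finite I] [Finite J] (e : I ≃ J) (m : M.obj I),
      h J (M.map e m) = E.map e (h I m))
    (map_act : ∀ {I J : Type} [Finite I] [Finite J] (m : M.obj I) (x : L.obj J),
      h (I ⊕ J) (M.act m (envι x)) = E.act (h I m) (envι x)) : M ⟶ E where
  app := h
  naturality := naturality
  app_act {I J} hI _ m a := by
    revert m hI I
    refine @fun I hI m => env_generated (P := fun J _ a => ∀ (I : Type) [Finite I] (m : M.obj I),
      h (I ⊕ J) (M.act m a) = E.act (h I m) a) ?_ ?_ ?_ ?_ ?_ ?_ ?_ a I m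
    · intro J _ I _ m
      simp
    · intro J _ x y hx hy I _ m
      simp only [map_add, hx, hy]
    · intro J _ c x hx I _ m
      simp only [map_smul, hx]
    · intro J J' _ _ e x hx I _ m
      have h1 := M.map_act (Equiv.refl I) e m x
      have h2 := E.map_act (Equiv.refl I) e (h I m) x
      rw [M.map_refl] at h1
      rw [E.map_refl] at h2
      rw [← h1, naturality, hx, h2]
    · intro I _ m
      have h3 := naturality (Equiv.sumEmpty I Empty) (M.act m L.env.one)
      rw [M.act_one] at h3
      nth_rewrite 1 [← E.act_one (h I m)] at h3
      have h4 := congrArg (E.map (Equiv.sumEmpty I Empty).symm) h3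
      rw [E.map_map, E.map_map, E.map_eq_self (by simp), E.map_eq_self (by simp)] at h4
      exact h4.symm
    · intro J _ x I _ m
      exact map_act m x
    · intro J J' _ _ x y hx hy I _ m
      rw [← M.act_mul, naturality, hy, hx, E.act_mul]

end

/-! ### Forests with labelled roots -/

/-- A forest with vertex set `I` whose components are labelled by `Q`: it is given by the root of
each component and the map sending every vertex other than the roots to its parent (a root is sent
to itself). -/
@[ext]
structure LabeledForest (Q I : Type) where
  root : Q → I
  parent : I → I
  root_injective : Function.Injective root
  parent_root (q : Q) : parent (root q) = root q
  reaches_root (i : I) : ∃ (n : ℕ) (q : Q), parent^[n] i = root q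

namespace LabeledForest

variable {Q R I J L : Type}

/-- Relabelling the vertices of a forest. -/
def map (e : I ≃ J) (F : LabeledForest Q I) : LabeledForest Q J where
  root q := e (F.root q)
  parent j := e (F.parent (e.symm j))
  root_injective := e.injective.comp F.root_injective
  parent_root := by simp [F.parent_root]
  reaches_root j := by
    obtain ⟨n, q, hn⟩ := F.reaches_root (e.symm j)
    refine ⟨n, q, ?_⟩
    have h : Function.Semiconj e F.parent (fun j => e (F.parent (e.symm j))) := fun i => by simp
    rw [← hn, h.iterate_right n (e.symm j), e.apply_symm_apply]

/-- Relabelling the components of a forest. -/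
def relabel (σ : Q ≃ R) (F : LabeledForest Q I) : LabeledForest R I where
  root q := F.root (σ.symm q)
  parent := F.parent
  root_injective := F.root_injective.comp σ.symm.injective
  parent_root q := F.parent_root _
  reaches_root i := by
    obtain ⟨n, q, hn⟩ := F.reaches_root i
    exact ⟨n, σ q, by rw [σ.symm_apply_apply, hn]⟩

theorem map_parent (e : I ≃ J) (F : LabeledForest Q I) (i : I) :
    (F.map e).parent (e i) = e (F.parent i) := by
  simp [map]

theorem map_root (e : I ≃ J) (F : LabeledForest Q I) (q : Q) :
    (F.map e).root q = e (F.root q) := rfl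

theorem ext_of_map (e : I ≃ J) {F : LabeledForest Q I} {G : LabeledForest Q J}
    (h : ∀ q, e (F.root q) = G.root q) (h' : ∀ i, e (F.parent i) = G.parent (e i)) :
    F.map e = G := by
  ext i
  · exact h i
  · obtain ⟨i, rfl⟩ := e.surjective i
    rw [map_parent, h']

theorem map_map (e : I ≃ J) (f : J ≃ L) (F : LabeledForest Q I) :
    (F.map e).map f = F.map (e.trans f) := rfl

theorem map_eq_self {e : I ≃ I} (h : ∀ i, e i = i) (F : LabeledForest Q I) : F.map e = F := by
  obtain rfl : e = Equiv.refl I := Equiv.ext h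
  rfl

open Classical in
/-- The forest obtained from the disjoint union of `F` and `t` by adding an edge between the
vertex `v` of `F` and the root of `t`. -/
noncomputable def graft (F : LabeledForest Q I) (v : I) (t : RootedTreeOn J) :
    LabeledForest Q (I ⊕ J) where
  root q := Sum.inl (F.root q)
  parent := Sum.elim (fun i => Sum.inl (F.parent i))
    (fun j => if j = t.root then Sum.inl v else Sum.inr (t.parent j))
  root_injective := Sum.inl_injective.comp F.root_injective
  parent_root := by simp [F.parent_root]
  reaches_root := by
    set p : I ⊕ J → I ⊕ J := Sum.elim (fun i => Sum.inl (F.parent i))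
      (fun j => if j = t.root then Sum.inl v else Sum.inr (t.parent j)) with hp
    have hl : ∀ i, ∃ (n : ℕ) (q : Q), p^[n] (Sum.inl i) = Sum.inl (F.root q) := by
      intro i
      obtain ⟨n, q, hn⟩ := F.reaches_root i
      have h : Function.Semiconj Sum.inl F.parent p := fun i => rfl
      exact ⟨n, q, by rw [← hn, h.iterate_right n i]⟩
    have hroot : ∃ (n : ℕ) (q : Q), p^[n] (Sum.inr t.root) = Sum.inl (F.root q) := by
      obtain ⟨n, q, hn⟩ := hl v
      refine ⟨n + 1, q, ?_⟩
      rw [Function.iterate_succ_apply, show p (Sum.inr t.root) = Sum.inl v by simp [hp], hn]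
    rintro (i | j)
    · exact hl i
    · obtain ⟨n, hn⟩ := t.reaches_root j
      induction n generalizing j with
      | zero =>
        obtain rfl : j = t.root := hn
        exact hroot
      | succ n ih =>
        by_cases hj : j = t.root
        · rw [hj]
          exact hroot
        · obtain ⟨m, q, hm⟩ := ih (t.parent j) hn
          refine ⟨m + 1, q, ?_⟩
          rw [Function.iterate_succ_apply, show p (Sum.inr j) = Sum.inr (t.parent j) by
            simp [hp, hj], hm]

theorem graft_root (F : LabeledForest Q I) (v : I) (t : RootedTreeOn J) (q : Q) :
    (F.graft v t).root q = Sum.inl (F.root q) := rfl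

theorem graft_parent_inl (F : LabeledForest Q I) (v : I) (t : RootedTreeOn J) (i : I) :
    (F.graft v t).parent (Sum.inl i) = Sum.inl (F.parent i) := rfl

theorem graft_parent_inr_root (F : LabeledForest Q I) (v : I) (t : RootedTreeOn J) :
    (F.graft v t).parent (Sum.inr t.root) = Sum.inl v := if_pos rfl

theorem graft_parent_inr_ne (F : LabeledForest Q I) (v : I) (t : RootedTreeOn J) {j : J}
    (h : j ≠ t.root) : (F.graft v t).parent (Sum.inr j) = Sum.inr (t.parent j) := if_neg h

theorem map_graft {I₁ J₁ : Type} (e : I ≃ I₁) (f : J ≃ J₁) (F : LabeledForest Q I) (v : I)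
    (t : RootedTreeOn J) :
    (F.graft v t).map (Equiv.sumCongr e f) = (F.map e).graft (e v) (t.map f) := by
  refine ext_of_map _ (fun _ => rfl) ?_
  rintro (i | j)
  · exact congrArg Sum.inl (map_parent e F i).symm
  · by_cases h : j = t.root
    · subst h
      rw [graft_parent_inr_root]
      exact (graft_parent_inr_root (F.map e) (e v) (t.map f)).symm
    · rw [graft_parent_inr_ne _ _ _ h]
      refine Eq.trans ?_ (graft_parent_inr_ne (F.map e) (e v) (t.map f) (j := f j)
        (fun h' => h (f.injective h'))).symm
      rw [RootedTreeOn.map_parent]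
      rfl

theorem graft_graft_inr (F : LabeledForest Q I) (v : I) (t : RootedTreeOn J) (w : J)
    (r : RootedTreeOn L) :
    ((F.graft v t).graft (Sum.inr w) r).map (Equiv.sumAssoc I J L) = F.graft v (t.graft w r) := by
  refine ext_of_map _ (fun _ => rfl) ?_
  rintro ((i | j) | l)
  · rfl
  · rw [graft_parent_inl]
    by_cases h : j = t.root
    · subst h
      rw [graft_parent_inr_root]
      exact (graft_parent_inr_root F v (t.graft w r)).symm
    · rw [graft_parent_inr_ne _ _ _ h]
      exact (graft_parent_inr_ne F v (t.graft w r) (j := Sum.inl j)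
        (fun h' => h (Sum.inl_injective h'))).symm
  · refine Eq.trans ?_ (graft_parent_inr_ne F v (t.graft w r) (j := Sum.inr l)
      (fun h' => Sum.inr_ne_inl h')).symm
    by_cases h : l = r.root
    · subst h
      rw [graft_parent_inr_root, RootedTreeOn.graft_parent_inr_root]
      rfl
    · rw [graft_parent_inr_ne _ _ _ h, RootedTreeOn.graft_parent_inr_ne _ _ _ h]
      rfl

end LabeledForest

/-- The bijection `(I ⊔ J) ⊔ L ≃ (I ⊔ L) ⊔ J`. -/
def sumRightSwap (I J L : Type) : (I ⊕ J) ⊕ L ≃ (I ⊕ L) ⊕ J :=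
  (Equiv.sumAssoc I J L).trans (sumAssocSwap I L J).symm

namespace LabeledForest

variable {Q R I J L : Type}

theorem graft_graft_inl (F : LabeledForest Q I) (v : I) (t : RootedTreeOn J) (w : I)
    (r : RootedTreeOn L) :
    ((F.graft v t).graft (Sum.inl w) r).map (sumRightSwap I J L) =
      (F.graft w r).graft (Sum.inl v) t := by
  refine ext_of_map _ (fun _ => rfl) ?_
  rintro ((i | j) | l)
  · rfl
  · rw [graft_parent_inl]
    by_cases h : j = t.root
    · subst h
      rw [graft_parent_inr_root]
      exact (graft_parent_inr_root (F.graft w r) (Sum.inl v) t).symm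
    · rw [graft_parent_inr_ne _ _ _ h]
      exact (graft_parent_inr_ne (F.graft w r) (Sum.inl v) t h).symm
  · change _ = (Sum.inl ((F.graft w r).parent (Sum.inr l)) : (I ⊕ L) ⊕ J)
    by_cases h : l = r.root
    · subst h
      rw [graft_parent_inr_root, graft_parent_inr_root]
      rfl
    · rw [graft_parent_inr_ne _ _ _ h, graft_parent_inr_ne _ _ _ h]
      rfl

/-! ### Children of a root -/

/-- The children of the root of the component labelled by `c`. -/
def children (c : Q) (F : LabeledForest Q I) : Set I :=
  {i | F.parent i = F.root c ∧ i ≠ F.root c}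

theorem children_map (c : Q) (e : I ≃ J) (F : LabeledForest Q I) :
    (F.map e).children c = e '' F.children c := by
  ext j
  obtain ⟨i, rfl⟩ := e.surjective j
  simp [children, map_parent, map_root]

theorem children_graft_root (c : Q) (F : LabeledForest Q I) (t : RootedTreeOn J) :
    (F.graft (F.root c) t).children c = insert (Sum.inr t.root) (Sum.inl '' F.children c) := by
  ext (i | j)
  · simp [children, graft_parent_inl, graft_root]
  · by_cases h : j = t.root
    · simp [children, h, graft_parent_inr_root, graft_root]
    · simp [children, h, graft_parent_inr_ne, graft_root]

theorem children_graft_of_ne (c : Q) (F : LabeledForest Q I) {v : I} (hv : v ≠ F.root c)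
    (t : RootedTreeOn J) : (F.graft v t).children c = Sum.inl '' F.children c := by
  ext (i | j)
  · simp [children, graft_parent_inl, graft_root]
  · by_cases h : j = t.root
    · simp [children, h, hv, graft_parent_inr_root, graft_root]
    · simp [children, h, graft_parent_inr_ne, graft_root]

/-- The number of children of the root of the component labelled by `c`. -/
noncomputable def numChildren (c : Q) (F : LabeledForest Q I) : ℕ := (F.children c).ncard

theorem numChildren_map (c : Q) (e : I ≃ J) (F : LabeledForest Q I) :
    (F.map e).numChildren c = F.numChildren c := by
  rw [numChildren, children_map, Set.ncard_image_of_injective _ e.injective, numChildren]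

theorem numChildren_graft_root [Finite I] (c : Q) (F : LabeledForest Q I) (t : RootedTreeOn J) :
    (F.graft (F.root c) t).numChildren c = F.numChildren c + 1 := by
  rw [numChildren, children_graft_root, Set.ncard_insert_of_notMem (by simp)
    (Set.toFinite _), Set.ncard_image_of_injective _ Sum.inl_injective, numChildren]

theorem numChildren_graft_of_ne (c : Q) (F : LabeledForest Q I) {v : I} (hv : v ≠ F.root c)
    (t : RootedTreeOn J) : (F.graft v t).numChildren c = F.numChildren c := by
  rw [numChildren, children_graft_of_ne c F hv,
    Set.ncard_image_of_injective _ Sum.inl_injective, numChildren]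

/-- If an isomorphism between grafted forests matches the roots of the grafted trees, it consists of
an isomorphism between the forests and an isomorphism between the trees. -/
theorem exists_sumCongr_of_map_graft {I₁ J₁ : Type} {F : LabeledForest Q I} {v : I}
    {t : RootedTreeOn J} {F₁ : LabeledForest Q I₁} {v₁ : I₁} {t₁ : RootedTreeOn J₁}
    (e : I ⊕ J ≃ I₁ ⊕ J₁) (h : (F.graft v t).map e = F₁.graft v₁ t₁)
    (hr : e (Sum.inr t.root) = Sum.inr t₁.root) :
    ∃ (a : I ≃ I₁) (b : J ≃ J₁), e = Equiv.sumCongr a b ∧ F.map a = F₁ ∧ t.map b = t₁ := by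
  have key : ∀ {I₁ J₁ I J : Type} {F : LabeledForest Q I} {v : I}
      {t : RootedTreeOn J} {F₁ : LabeledForest Q I₁} {v₁ : I₁} {t₁ : RootedTreeOn J₁}
      (e : I ⊕ J ≃ I₁ ⊕ J₁), (F.graft v t).map e = F₁.graft v₁ t₁ →
      e (Sum.inr t.root) = Sum.inr t₁.root → ∀ j, ∃ j₁, e (Sum.inr j) = Sum.inr j₁ := by
    intro I₁ J₁ I J F v t F₁ v₁ t₁ e h hr j
    obtain ⟨n, hn⟩ := t.reaches_root j
    induction n generalizing j with
    | zero =>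
      obtain rfl : j = t.root := hn
      exact ⟨_, hr⟩
    | succ n ih =>
      by_cases hj : j = t.root
      · exact ⟨_, hj ▸ hr⟩
      · obtain ⟨j₁, hj₁⟩ := ih (t.parent j) hn
        rw [← graft_parent_inr_ne F v t hj, ← map_parent, h] at hj₁
        rcases hx : e (Sum.inr j) with i | j'
        · rw [hx, graft_parent_inl] at hj₁
          exact absurd hj₁ Sum.inl_ne_inr
        · exact ⟨j', rfl⟩
  have h' : (F₁.graft v₁ t₁).map e.symm = F.graft v t := by
    rw [← h, map_map, map_eq_self]
    simp
  have hr' : e.symm (Sum.inr t₁.root) = Sum.inr t.root := by rw [← hr, e.symm_apply_apply]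
  choose f hf using key e h hr
  choose g hg using key e.symm h' hr'
  have hl : ∀ i, ∃ i₁, e (Sum.inl i) = Sum.inl i₁ := by
    intro i
    rcases hx : e (Sum.inl i) with i₁ | j
    · exact ⟨i₁, rfl⟩
    · rw [← e.eq_symm_apply, hg] at hx
      exact absurd hx Sum.inl_ne_inr
  have hl' : ∀ i, ∃ i₁, e.symm (Sum.inl i) = Sum.inl i₁ := by
    intro i
    rcases hx : e.symm (Sum.inl i) with i₁ | j
    · exact ⟨i₁, rfl⟩
    · rw [e.symm_apply_eq, hf] at hx
      exact absurd hx Sum.inl_ne_inr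
  choose k hk using hl
  choose l hl using hl'
  let a : I ≃ I₁ := ⟨k, l, fun i => Sum.inl_injective (β := J) (by
    rw [← hl, ← hk, e.symm_apply_apply]), fun i => Sum.inl_injective (β := J₁) (by
    rw [← hk, ← hl, e.apply_symm_apply])⟩
  let b : J ≃ J₁ := ⟨f, g, fun i => Sum.inr_injective (α := I) (by
    rw [← hg, ← hf, e.symm_apply_apply]), fun i => Sum.inr_injective (α := I₁) (by
    rw [← hf, ← hg, e.apply_symm_apply])⟩
  refine ⟨a, b, Equiv.ext ?_, ext_of_map a (fun q => Sum.inl_injective (β := J₁) ?_)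
    fun i => Sum.inl_injective (β := J₁) ?_, RootedTreeOn.ext_of_map b
    (Sum.inr_injective (α := I₁) ?_) fun j => ?_⟩
  · rintro (i | j)
    · exact hk i
    · exact hf j
  · rw [← graft_root F₁ v₁ t₁, ← h]
    exact (hk _).symm
  · rw [← graft_parent_inl F₁ v₁ t₁, ← h]
    refine (hk _).symm.trans ?_
    rw [← graft_parent_inl F v t, ← map_parent, hk]
    rfl
  · rw [← hr]
    exact (hf _).symm
  · have hb : b t.root = t₁.root := Sum.inr_injective (α := I₁) ((hf _).symm.trans hr)
    by_cases hj : j = t.root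
    · rw [hj, t.parent_root, hb, t₁.parent_root]
    · refine Sum.inr_injective (α := I₁) ?_
      rw [← graft_parent_inr_ne F₁ v₁ t₁ (fun h'' => hj (b.injective (h''.trans hb.symm))), ← h]
      refine (hf _).symm.trans ?_
      rw [← graft_parent_inr_ne F v t hj, ← map_parent, hf]
      rfl

/-- A presentation of the forest `F` as the result of grafting a tree on the root of the component
labelled by `c` of some forest. -/
structure RootSplit (c : Q) (F : LabeledForest Q I) where
  A : Type
  B : Type
  [finite_left : Finite A]
  [finite_right : Finite B]
  e : A ⊕ B ≃ I
  forest : LabeledForest Q A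
  tree : RootedTreeOn B
  map_graft : (forest.graft (forest.root c) tree).map e = F

attribute [instance] RootSplit.finite_left RootSplit.finite_right

/-- Every child of a root gives rise to a splitting, by cutting the edge above it. -/
theorem exists_rootSplit [Finite I] (c : Q) (F : LabeledForest Q I) {b : I}
    (hb : b ∈ F.children c) : ∃ D : RootSplit c F, D.e (Sum.inr D.tree.root) = b := by
  classical
  -- the set of descendants of the child `b`
  let S : I → Prop := fun i => ∃ n : ℕ, F.parent^[n] i = b
  have hS : ∀ i, i ≠ b → S i → S (F.parent i) := by
    rintro i hi ⟨n, hn⟩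
    obtain _ | n := n
    · exact absurd hn hi
    · exact ⟨n, hn⟩
  have hS' : ∀ i, S (F.parent i) → S i := fun i ⟨n, hn⟩ => ⟨n + 1, hn⟩
  have hfix : ∀ q n, F.parent^[n] (F.root q) = F.root q := fun q n =>
    Function.iterate_fixed (F.parent_root q) n
  have hroot : ∀ q, ¬ S (F.root q) := by
    rintro q ⟨n, hn⟩
    rw [hfix] at hn
    obtain ⟨h1, h2⟩ := hb
    rw [← hn, F.parent_root] at h1
    exact h2 (hn ▸ h1)
  let G : LabeledForest Q {i // ¬ S i} :=
    { root := fun q => ⟨F.root q, hroot q⟩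
      parent := fun i => ⟨F.parent i.1, fun h => i.2 (hS' _ h)⟩
      root_injective := fun q q' h => F.root_injective (congrArg Subtype.val h)
      parent_root := fun q => Subtype.ext (F.parent_root q)
      reaches_root := by
        rintro ⟨i, hi⟩
        obtain ⟨n, q, hn⟩ := F.reaches_root i
        induction n generalizing i with
        | zero => exact ⟨0, q, Subtype.ext hn⟩
        | succ n ih =>
          obtain ⟨m, q, hm⟩ := ih (F.parent i) (fun h => hi (hS' _ h)) hn
          exact ⟨m + 1, q, hm⟩ }
  let t : RootedTreeOn {i // S i} :=
    { root := ⟨b, 0, rfl⟩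
      parent := fun i => if h : i.1 = b then ⟨b, 0, rfl⟩ else ⟨F.parent i.1, hS _ h i.2⟩
      parent_root := dif_pos rfl
      reaches_root := by
        rintro ⟨i, n, hn⟩
        induction n generalizing i with
        | zero => exact ⟨0, Subtype.ext hn⟩
        | succ n ih =>
          by_cases hi : i = b
          · exact ⟨0, Subtype.ext hi⟩
          · obtain ⟨m, hm⟩ := ih (F.parent i) hn
            refine ⟨m + 1, ?_⟩
            rw [Function.iterate_succ_apply, dif_neg hi]
            exact hm }
  refine ⟨⟨_, _, (Equiv.sumComm _ _).trans (Equiv.sumCompl S), G, t, ?_⟩, rfl⟩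
  refine ext_of_map _ (fun q => rfl) ?_
  rintro (i | i)
  · rfl
  · by_cases h : i = t.root
    · rw [h, graft_parent_inr_root]
      exact hb.1.symm
    · rw [graft_parent_inr_ne _ _ _ h]
      have h' : i.1 ≠ b := fun h' => h (Subtype.ext h')
      change (t.parent i).1 = _
      rw [show t.parent i = ⟨F.parent i.1, hS _ h' i.2⟩ from dif_neg h']
      rfl

theorem nonempty_rootSplit [Finite I] (c : Q) (F : LabeledForest Q I) (h : F.numChildren c ≠ 0) :
    Nonempty (RootSplit c F) := by
  obtain ⟨b, hb⟩ := Set.nonempty_of_ncard_ne_zero h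
  exact ⟨(F.exists_rootSplit c hb).choose⟩

theorem RootSplit.numChildren_eq {c : Q} {F : LabeledForest Q I} (D : RootSplit c F) :
    F.numChildren c = D.forest.numChildren c + 1 := by
  rw [← numChildren_graft_root c D.forest D.tree, ← numChildren_map c D.e, D.map_graft]

end LabeledForest

/-! ### Extension of functions from forests with a bare root -/

/-- The element of `W(I)` given by a rooted tree. -/
noncomputable def treeSingle (K : Type u) [Field K] {I : Type} [Finite I] (t : RootedTreeOn I) :
    (treeSLie K).obj I :=
  (Finsupp.single t 1 : RootedTreeOn I →₀ K)

namespace LabeledForest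

section

variable {K : Type u} [Field K] (E : SLieModule (treeSLie K)) {Q : Type} (c : Q)
  (gen h : ∀ (I : Type) [Finite I], LabeledForest Q I → E.obj I)
  {I J L : Type} [Finite I] [Finite J] [Finite L]

open Classical in
/-- The value of `h` on the forest obtained by grafting `t` on the vertex `v` of `F`, replaced by
zero if `v` is the root of the component labelled by `c`. -/
noncomputable def graftValue (F : LabeledForest Q I) (v : I) (t : RootedTreeOn J) : E.obj (I ⊕ J) :=
  if v = F.root c then 0 else h (I ⊕ J) (F.graft v t)

/-- The value that a morphism extending `h` has to take on the forest obtained by grafting `t` on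
the root of the component of `F` labelled by `c`. -/
noncomputable def stepValue (F : LabeledForest Q I) (t : RootedTreeOn J) : E.obj (I ⊕ J) :=
  E.act (h I F) (treeSingle K t) - ∑ᶠ v : I, graftValue E c h F v t

theorem stepValue_eq {I J : Type} [Fintype I] [Finite J] (F : LabeledForest Q I)
    (t : RootedTreeOn J) : stepValue E c h F t =
      E.act (h I F) (treeSingle K t) - ∑ v : I, graftValue E c h F v t := by
  rw [stepValue, finsum_eq_sum_of_fintype]

theorem graftValue_root (F : LabeledForest Q I) (t : RootedTreeOn J) :
    graftValue E c h F (F.root c) t = 0 := if_pos rfl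

theorem graftValue_of_ne (F : LabeledForest Q I) {v : I} (hv : v ≠ F.root c) (t : RootedTreeOn J) :
    graftValue E c h F v t = h (I ⊕ J) (F.graft v t) := if_neg hv

open Classical in
/-- The extension of `gen` to the forests in which the root labelled by `c` has `n` children, by
recursion on `n`. The value is computed with an arbitrarily chosen child; the last case does not
occur for a forest in which that root has `n + 1` children. -/
noncomputable def extendRec : ℕ → ∀ (I : Type) [Finite I], LabeledForest Q I → E.obj I
  | 0, I, _, F => gen I F
  | n + 1, _, _, F =>
    if D : Nonempty (RootSplit c F) then
      E.map D.some.e (stepValue E c (extendRec n) D.some.forest D.some.tree)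
    else 0

/-- The extension of `gen` from the forests in which the root labelled by `c` has no child. -/
noncomputable def extend (I : Type) [Finite I] (F : LabeledForest Q I) : E.obj I :=
  extendRec E c gen (F.numChildren c) I F

theorem extend_of_numChildren_eq_zero (F : LabeledForest Q I) (hF : F.numChildren c = 0) :
    extend E c gen I F = gen I F := by
  rw [extend, hF, extendRec]

theorem exists_extend_eq (F : LabeledForest Q I) (hF : F.numChildren c ≠ 0) :
    ∃ D : RootSplit c F, extend E c gen I F =
      E.map D.e (stepValue E c (extend E c gen) D.forest D.tree) := by
  have hD := F.nonempty_rootSplit c hF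
  refine ⟨hD.some, ?_⟩
  rw [extend, hD.some.numChildren_eq, extendRec, dif_pos hD]
  congr 1
  rw [stepValue, stepValue]
  congr 1
  refine finsum_congr fun v => ?_
  by_cases hv : v = hD.some.forest.root c
  · rw [hv, graftValue_root, graftValue_root]
  · rw [graftValue_of_ne _ _ _ _ hv, graftValue_of_ne _ _ _ _ hv, extend,
      numChildren_graft_of_ne c _ hv]

theorem graftValue_map {I₁ J₁ : Type} [Finite I₁] [Finite J₁] (F : LabeledForest Q I) (v : I)
    (t : RootedTreeOn J)
    (hn : ∀ (I J : Type) [Finite I] [Finite J] (e : I ≃ J) (G : LabeledForest Q I),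
      G.numChildren c = F.numChildren c → h J (G.map e) = E.map e (h I G))
    (a : I ≃ I₁) (b : J ≃ J₁) :
    graftValue E c h (F.map a) (a v) (t.map b) =
      E.map (Equiv.sumCongr a b) (graftValue E c h F v t) := by
  by_cases hv : v = F.root c
  · rw [hv, graftValue_root, map_zero]
    exact graftValue_root E c h (F.map a) (t.map b)
  · rw [graftValue_of_ne _ _ _ _ hv, graftValue_of_ne, ← map_graft,
      hn _ _ _ _ (numChildren_graft_of_ne c F hv t)]
    exact fun h' => hv (a.injective h')

theorem stepValue_map {I₁ J₁ : Type} [Finite I₁] [Finite J₁] (F : LabeledForest Q I)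
    (t : RootedTreeOn J)
    (hn : ∀ (I J : Type) [Finite I] [Finite J] (e : I ≃ J) (G : LabeledForest Q I),
      G.numChildren c = F.numChildren c → h J (G.map e) = E.map e (h I G))
    (a : I ≃ I₁) (b : J ≃ J₁) :
    stepValue E c h (F.map a) (t.map b) = E.map (Equiv.sumCongr a b) (stepValue E c h F t) := by
  have := Fintype.ofFinite I
  have := Fintype.ofFinite I₁
  rw [stepValue_eq, stepValue_eq, map_sub, map_sum, E.map_act, hn _ _ a F rfl, ← a.sum_comp]
  congr 1
  · congr 1
    exact (treeMap_single K b t).symm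
  · exact Finset.sum_congr rfl fun v _ => graftValue_map E c h F v t hn a b

theorem bracket_treeSingle {J L : Type} [Fintype J] [Fintype L] (s : RootedTreeOn J)
    (t : RootedTreeOn L) :
    (treeSLie K).bracket (treeSingle K s) (treeSingle K t) =
      ∑ b : J, treeSingle K (s.graft b t) -
      (treeSLie K).map (Equiv.sumComm L J) (∑ d : L, treeSingle K (t.graft d s)) := by
  refine (SPreLieAlgebra.bracket_apply (treeSPreLie K) (treeSingle K s) (treeSingle K t)).trans ?_
  exact congrArg₂ (· - ·) (treeOp_single K s t)
    (congrArg ((treeSLie K).map (Equiv.sumComm L J)) (treeOp_single K t s))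

/-- The expression `m · s · t - m · (s ↶ t)` is symmetric in `s` and `t`: this is the defining
relation of a module over the Lie algebra of trees. -/
theorem map_act_act_sub (m : E.obj I) {J L : Type} [Fintype J] [Fintype L] (s : RootedTreeOn J)
    (t : RootedTreeOn L) :
    E.map (sumRightSwap I J L) (E.act (E.act m (treeSingle K s)) (treeSingle K t) -
        E.map (Equiv.sumAssoc I J L).symm (∑ b : J, E.act m (treeSingle K (s.graft b t)))) =
      E.act (E.act m (treeSingle K t)) (treeSingle K s) -
        E.map (Equiv.sumAssoc I L J).symm (∑ d : L, E.act m (treeSingle K (t.graft d s))) := by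
  have h := E.act_bracket m (treeSingle K s) (treeSingle K t)
  rw [bracket_treeSingle, map_sub, E.act_map_right, map_sum, map_sum] at h
  have h' := congrArg (E.map (sumAssocSwap I L J).symm) h
  rw [map_sub, map_sub, E.map_map, E.map_map, E.map_map,
    E.map_eq_self (e := (sumAssocSwap I L J).trans _) (by simp)] at h'
  rw [map_sub, E.map_map]
  rw [sub_eq_sub_iff_add_eq_add] at h' ⊢
  have h1 := E.map_congr (e := (Equiv.sumAssoc I J L).symm.trans (sumRightSwap I J L))
    (f := (sumAssocSwap I L J).symm) (by rintro (i | i | i) <;> rfl)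
    (∑ b : J, E.act m (treeSingle K (s.graft b t)))
  have h2 := E.map_congr (e := ((Equiv.refl I).sumCongr (Equiv.sumComm L J)).trans
    (sumAssocSwap I L J).symm) (f := (Equiv.sumAssoc I L J).symm)
    (by rintro (i | i | i) <;> rfl) (∑ d : L, E.act m (treeSingle K (t.graft d s)))
  rw [h2] at h'
  rw [h1]
  refine Eq.trans ?_ (h'.symm.trans (add_comm _ _))
  rfl

/-- Two trees may be grafted in either order on the root labelled by `c`. -/
theorem stepValue_graft_root {I J L : Type} [Fintype I] [Fintype J] [Fintype L]
    (F : LabeledForest Q I)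
    (hn : ∀ (I J : Type) [Finite I] [Finite J] (e : I ≃ J) (G : LabeledForest Q I),
      G.numChildren c ≤ F.numChildren c + 1 → h J (G.map e) = E.map e (h I G))
    (hs : ∀ (I J : Type) [Finite I] [Finite J] (G : LabeledForest Q I) (t : RootedTreeOn J),
      G.numChildren c = F.numChildren c →
        h (I ⊕ J) (G.graft (G.root c) t) = stepValue E c h G t)
    (s : RootedTreeOn J) (t : RootedTreeOn L) :
    E.map (sumRightSwap I J L) (stepValue E c h (F.graft (F.root c) s) t) =
      stepValue E c h (F.graft (F.root c) t) s := by
  classical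
  -- grafting both trees on vertices of `F` other than the root
  let V : ∀ {J L : Type} [Fintype J] [Fintype L] (s : RootedTreeOn J) (t : RootedTreeOn L),
      E.obj ((I ⊕ J) ⊕ L) := fun s t => ∑ a : I, ∑ a' : I,
    if a = F.root c ∨ a' = F.root c then 0 else h _ ((F.graft a s).graft (Sum.inl a') t)
  -- grafting `s` on such a vertex and `t` on a vertex of `s`
  let X : ∀ {J L : Type} [Fintype J] [Fintype L] (s : RootedTreeOn J) (t : RootedTreeOn L),
      E.obj ((I ⊕ J) ⊕ L) := fun {J L} _ _ s t => ∑ a : I, ∑ b : J,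
    if a = F.root c then 0 else h _ ((F.graft a s).graft (Sum.inr b) t)
  let U : ∀ {J L : Type} [Fintype J] [Fintype L] (s : RootedTreeOn J) (t : RootedTreeOn L),
      E.obj ((I ⊕ J) ⊕ L) := fun s t =>
    ∑ a : I, E.act (graftValue E c h F a s) (treeSingle K t)
  have hV : ∀ {J L : Type} [Fintype J] [Fintype L] (s : RootedTreeOn J) (t : RootedTreeOn L),
      E.map (sumRightSwap I J L) (V s t) = V t s := by
    intro J L _ _ s t
    simp only [V, map_sum]
    rw [Finset.sum_comm]
    refine Finset.sum_congr rfl fun a _ => Finset.sum_congr rfl fun a' _ => ?_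
    by_cases ha : a = F.root c
    · rw [if_pos (Or.inr ha), if_pos (Or.inl ha), map_zero]
    by_cases ha' : a' = F.root c
    · rw [if_pos (Or.inl ha'), if_pos (Or.inr ha'), map_zero]
    rw [if_neg (by tauto), if_neg (by tauto), ← graft_graft_inl F a' s a t, hn]
    rw [numChildren_graft_of_ne c (F.graft a' s) (v := Sum.inl a)
      (fun h => ha (Sum.inl_injective h)), numChildren_graft_of_ne c F ha']
    exact Nat.le_succ _
  have hT1 : ∀ {J L : Type} [Fintype J] [Fintype L] (s : RootedTreeOn J) (t : RootedTreeOn L),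
      E.act (h _ (F.graft (F.root c) s)) (treeSingle K t) =
        E.act (E.act (h I F) (treeSingle K s)) (treeSingle K t) - U s t := by
    intro J L _ _ s t
    simp only [U]
    rw [hs _ _ F s rfl, stepValue_eq, map_sub, LinearMap.sub_apply, map_sum, LinearMap.sum_apply]
  have hT2 : ∀ {J L : Type} [Fintype J] [Fintype L] (s : RootedTreeOn J) (t : RootedTreeOn L),
      ∑ a : I, graftValue E c h (F.graft (F.root c) s) (Sum.inl a) t =
        E.map (sumRightSwap I L J) (U t s - V t s - X t s) := by
    intro J L _ _ s t
    simp only [U, V, X]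
    rw [← Finset.sum_sub_distrib, ← Finset.sum_sub_distrib, map_sum]
    refine Finset.sum_congr rfl fun a _ => ?_
    by_cases ha : a = F.root c
    · subst ha
      rw [graftValue_root, map_zero, LinearMap.zero_apply]
      simp only [true_or, if_true, Finset.sum_const_zero, sub_zero, map_zero]
      exact graftValue_root E c h (F.graft (F.root c) s) t
    · have h1 : graftValue E c h (F.graft (F.root c) s) (Sum.inl a) t =
          E.map (sumRightSwap I L J) (stepValue E c h (F.graft a t) s) := by
        rw [graftValue_of_ne _ _ _ _ fun h => ha (Sum.inl_injective h), ← graft_graft_inl, hn]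
        · congr 1
          exact hs _ _ (F.graft a t) s (numChildren_graft_of_ne c F ha t)
        · refine (numChildren_graft_root c (F.graft a t) s).le.trans ?_
          rw [numChildren_graft_of_ne c F ha]
      rw [h1, stepValue_eq, Fintype.sum_sum_type, graftValue_of_ne _ _ _ _ ha, sub_sub]
      congr 3
      · refine Finset.sum_congr rfl fun a' _ => ?_
        by_cases ha' : a' = F.root c
        · rw [if_pos (Or.inr ha'), ha']
          exact graftValue_root E c h (F.graft a t) s
        · rw [if_neg (by tauto)]
          exact graftValue_of_ne _ _ _ _ (fun h => ha' (Sum.inl_injective h)) s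
      · refine Finset.sum_congr rfl fun b _ => ?_
        rw [if_neg ha]
        exact graftValue_of_ne _ _ _ _ Sum.inr_ne_inl s
  have hT3 : ∀ {J L : Type} [Fintype J] [Fintype L] (s : RootedTreeOn J) (t : RootedTreeOn L),
      ∑ b : J, graftValue E c h (F.graft (F.root c) s) (Sum.inr b) t =
        E.map (Equiv.sumAssoc I J L).symm (∑ b : J, E.act (h I F) (treeSingle K (s.graft b t))) -
          X s t := by
    intro J L _ _ s t
    simp only [X]
    rw [Finset.sum_comm (s := Finset.univ (α := I)), map_sum, ← Finset.sum_sub_distrib]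
    refine Finset.sum_congr rfl fun b _ => ?_
    have h1 : ∀ G : LabeledForest Q ((I ⊕ J) ⊕ L),
        (G.map (Equiv.sumAssoc I J L)).map (Equiv.sumAssoc I J L).symm = G := fun G => by
      rw [map_map, map_eq_self]
      simp
    rw [graftValue_of_ne _ _ _ _ Sum.inr_ne_inl, ← h1 (LabeledForest.graft _ _ _),
      graft_graft_inr, hn _ _ _ _ (numChildren_graft_root c F _).le, hs _ _ _ _ rfl, stepValue_eq,
      map_sub, map_sum]
    congr 1
    refine Finset.sum_congr rfl fun a _ => ?_
    by_cases ha : a = F.root c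
    · rw [if_pos ha, ha, graftValue_root, map_zero]
    · rw [if_neg ha, graftValue_of_ne _ _ _ _ ha, ← hn, ← graft_graft_inr, h1]
      rw [numChildren_graft_of_ne c F ha]
      exact Nat.le_succ _
  have key : ∀ {J L : Type} [Fintype J] [Fintype L] (s : RootedTreeOn J) (t : RootedTreeOn L),
      stepValue E c h (F.graft (F.root c) s) t =
        (E.act (E.act (h I F) (treeSingle K s)) (treeSingle K t) -
          E.map (Equiv.sumAssoc I J L).symm (∑ b : J, E.act (h I F) (treeSingle K (s.graft b t)))) -
        U s t - E.map (sumRightSwap I L J) (U t s) + V s t + E.map (sumRightSwap I L J) (X t s) +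
        X s t := by
    intro J L _ _ s t
    rw [stepValue_eq, Fintype.sum_sum_type, hT1, hT2, hT3, map_sub, map_sub, hV]
    abel
  have hsw : ∀ x, E.map (sumRightSwap I J L) (E.map (sumRightSwap I L J) x) = x := fun x => by
    rw [E.map_map]
    refine E.map_eq_self ?_ x
    rintro ((i | i) | i) <;> rfl
  rw [key s t, key t s, map_add, map_add, map_add, map_sub, map_sub, map_act_act_sub, hV, hsw, hsw]
  abel

/-- The function `extend` is natural, and its value on a forest does not depend on the child of the
root used to compute it. -/
theorem extend_map_and_graft_root
    (hgen : ∀ (I J : Type) [Finite I] [Finite J] (e : I ≃ J) (F : LabeledForest Q I),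
      gen J (F.map e) = E.map e (gen I F)) (n : ℕ) :
    (∀ (I J : Type) [Finite I] [Finite J] (e : I ≃ J) (F : LabeledForest Q I),
      F.numChildren c = n → extend E c gen J (F.map e) = E.map e (extend E c gen I F)) ∧
    ∀ (I J : Type) [Finite I] [Finite J] (F : LabeledForest Q I) (t : RootedTreeOn J),
      F.numChildren c + 1 = n →
        extend E c gen (I ⊕ J) (F.graft (F.root c) t) = stepValue E c (extend E c gen) F t := by
  induction n using Nat.strong_induction_on with
  | _ n ih =>
  obtain _ | n := n
  · refine ⟨fun I J _ _ e F hF => ?_, fun I J _ _ F t hF => absurd hF (Nat.succ_ne_zero _)⟩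
    rw [extend_of_numChildren_eq_zero _ _ _ F hF, extend_of_numChildren_eq_zero, hgen]
    rw [numChildren_map, hF]
  have hn : ∀ (I J : Type) [Finite I] [Finite J] (e : I ≃ J) (F : LabeledForest Q I),
      F.numChildren c ≤ n → extend E c gen J (F.map e) = E.map e (extend E c gen I F) :=
    fun I J _ _ e F hF => (ih _ (Nat.lt_succ_of_le hF)).1 I J e F rfl
  have hs : ∀ (I J : Type) [Finite I] [Finite J] (F : LabeledForest Q I) (t : RootedTreeOn J),
      F.numChildren c < n →
        extend E c gen (I ⊕ J) (F.graft (F.root c) t) = stepValue E c (extend E c gen) F t :=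
    fun I J _ _ F t hF => (ih _ (Nat.succ_lt_succ hF)).2 I J F t rfl
  -- isomorphic graftings give the same value
  have key : ∀ (I J I₁ J₁ : Type) [Finite I] [Finite J] [Finite I₁] [Finite J₁]
      (F : LabeledForest Q I) (t : RootedTreeOn J) (F₁ : LabeledForest Q I₁)
      (t₁ : RootedTreeOn J₁) (e : I ⊕ J ≃ I₁ ⊕ J₁), F.numChildren c = n →
      (F.graft (F.root c) t).map e = F₁.graft (F₁.root c) t₁ →
      E.map e (stepValue E c (extend E c gen) F t) = stepValue E c (extend E c gen) F₁ t₁ := by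
    intro I J I₁ J₁ _ _ _ _ F t F₁ t₁ e hF he
    have aligned : ∀ (I₁ J₁ : Type) [Finite I₁] [Finite J₁] (F₁ : LabeledForest Q I₁)
        (t₁ : RootedTreeOn J₁) (e : I ⊕ J ≃ I₁ ⊕ J₁),
        (F.graft (F.root c) t).map e = F₁.graft (F₁.root c) t₁ →
        e (Sum.inr t.root) = Sum.inr t₁.root →
        E.map e (stepValue E c (extend E c gen) F t) = stepValue E c (extend E c gen) F₁ t₁ := by
      intro I₁ J₁ _ _ F₁ t₁ e he hr
      obtain ⟨a, b, rfl, rfl, rfl⟩ := exists_sumCongr_of_map_graft e he hr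
      rw [stepValue_map _ _ _ _ _ fun I J _ _ e G hG => hn I J e G (hG.trans hF).le]
    have hF₁ : F₁.numChildren c = n := by
      have h := congrArg (numChildren c) he
      rw [numChildren_map, numChildren_graft_root, numChildren_graft_root, hF] at h
      exact (Nat.succ_injective h).symm
    have hr : e (Sum.inr t.root) ∈ (F₁.graft (F₁.root c) t₁).children c := by
      rw [← he, children_map, children_graft_root]
      exact Set.mem_image_of_mem _ (Set.mem_insert _ _)
    rw [children_graft_root] at hr
    obtain hr | ⟨b, hb, hbr⟩ := hr
    · exact aligned I₁ J₁ F₁ t₁ e he hr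
    -- the two grafted trees are distinct: split off both of them and exchange their order
    obtain ⟨D, hD⟩ := F₁.exists_rootSplit c hb
    have := Fintype.ofFinite D.A
    have := Fintype.ofFinite D.B
    have := Fintype.ofFinite J₁
    have hDn : D.forest.numChildren c + 1 = n := by rw [← D.numChildren_eq, hF₁]
    let ε : D.A ⊕ D.B ≃ I₁ := D.e
    have h1 : F₁.graft (F₁.root c) t₁ =
        (((D.forest.graft (D.forest.root c) t₁).graft (Sum.inl (D.forest.root c)) D.tree).map
          (sumRightSwap D.A J₁ D.B)).map (Equiv.sumCongr ε (Equiv.refl J₁)) := by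
      rw [graft_graft_inl, map_graft]
      change F₁.graft (F₁.root c) t₁ =
        ((D.forest.graft (D.forest.root c) D.tree).map D.e).graft
          (((D.forest.graft (D.forest.root c) D.tree).map D.e).root c) t₁
      rw [D.map_graft]
    let f : (D.A ⊕ J₁) ⊕ D.B ≃ I₁ ⊕ J₁ :=
      (sumRightSwap D.A J₁ D.B).trans (Equiv.sumCongr ε (Equiv.refl J₁))
    have h2 := aligned _ _ (D.forest.graft (D.forest.root c) t₁) D.tree (e.trans f.symm) (by
      rw [← map_map, he, h1, map_map, map_map, map_eq_self]
      · rfl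
      · exact f.symm_apply_apply) (by
      rw [Equiv.trans_apply, Equiv.symm_apply_eq, ← hbr, ← hD]
      rfl)
    have h3 := congrArg (E.map f) h2
    rw [E.map_map, E.map_congr (f := e) (by simp)] at h3
    rw [h3, ← E.map_map, stepValue_graft_root]
    · have h4 := stepValue_map E c (extend E c gen) (D.forest.graft (D.forest.root c) D.tree) t₁
        (fun I J _ _ e G hG => hn I J e G (by rw [hG, numChildren_graft_root, hDn])) ε (Equiv.refl J₁)
      rw [← h4]
      congr 1
      exact D.map_graft
    · intro I J _ _ e G hG
      exact hn I J e G (hG.trans hDn.le)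
    · intro I J _ _ G t hG
      exact hs I J G t (by omega)
  refine ⟨fun I J _ _ e F hF => ?_, fun I J _ _ F t hF => ?_⟩
  · obtain ⟨D, hD⟩ := exists_extend_eq E c gen F (by omega)
    obtain ⟨D₁, hD₁⟩ := exists_extend_eq E c gen (F.map e) (by rw [numChildren_map]; omega)
    rw [hD, hD₁, E.map_map, ← key _ _ _ _ D.forest D.tree D₁.forest D₁.tree
      ((D.e.trans e).trans D₁.e.symm) _ _, E.map_map]
    · exact E.map_congr (fun i => by simp) _
    · have := D.numChildren_eq
      omega
    · rw [← map_map, ← map_map, D.map_graft]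
      refine (congrArg (LabeledForest.map D₁.e.symm) D₁.map_graft.symm).trans ?_
      rw [map_map, map_eq_self]
      simp
  · obtain ⟨D, hD⟩ := exists_extend_eq E c gen (F.graft (F.root c) t)
      (by rw [numChildren_graft_root]; omega)
    rw [hD]
    refine key _ _ _ _ _ _ _ _ _ ?_ D.map_graft
    have := D.numChildren_eq
    rw [numChildren_graft_root] at this
    omega

/-- The recursion is equivalent to the compatibility of `h` with the action of `t`. -/
theorem graft_root_eq_stepValue_iff {I J : Type} [Fintype I] [Finite J] (F : LabeledForest Q I)
    (t : RootedTreeOn J) :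
    h (I ⊕ J) (F.graft (F.root c) t) = stepValue E c h F t ↔
      ∑ v : I, h (I ⊕ J) (F.graft v t) = E.act (h I F) (treeSingle K t) := by
  classical
  rw [stepValue_eq, ← Finset.add_sum_erase _ (fun v => h (I ⊕ J) (F.graft v t))
      (Finset.mem_univ (F.root c)),
    ← Finset.add_sum_erase _ (fun v => graftValue E c h F v t)
      (Finset.mem_univ (F.root c)), graftValue_root, zero_add,
    Finset.sum_congr rfl fun v hv =>
      graftValue_of_ne E c h F (Finset.ne_of_mem_erase hv) t]
  exact eq_sub_iff_add_eq

theorem extend_map (hgen : ∀ (I J : Type) [Finite I] [Finite J] (e : I ≃ J)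
    (F : LabeledForest Q I), gen J (F.map e) = E.map e (gen I F)) (e : I ≃ J)
    (F : LabeledForest Q I) :
    extend E c gen J (F.map e) = E.map e (extend E c gen I F) :=
  (extend_map_and_graft_root E c gen hgen _).1 I J e F rfl

theorem sum_extend_graft {I J : Type} [Fintype I] [Finite J]
    (hgen : ∀ (I J : Type) [Finite I] [Finite J] (e : I ≃ J)
      (F : LabeledForest Q I), gen J (F.map e) = E.map e (gen I F))
    (F : LabeledForest Q I) (t : RootedTreeOn J) :
    ∑ v : I, extend E c gen (I ⊕ J) (F.graft v t) =
      E.act (extend E c gen I F) (treeSingle K t) :=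
  (graft_root_eq_stepValue_iff E c (extend E c gen) F t).1
    ((extend_map_and_graft_root E c gen hgen _).2 I J F t rfl)

/-- A function on forests on which trees act by grafting is determined by its values on the forests
in which the root labelled by `c` has no child. -/
theorem map_extend {X : SLieModule (treeSLie K)}
    (g : ∀ (I : Type) [Finite I], E.obj I →ₗ[K] X.obj I)
    (hg : ∀ {I J : Type} [Finite I] [Finite J] (e : I ≃ J) (x : E.obj I),
      g J (E.map e x) = X.map e (g I x))
    (hg' : ∀ {I J : Type} [Finite I] [Finite J] (x : E.obj I) (t : RootedTreeOn J),
      g (I ⊕ J) (E.act x (treeSingle K t)) = X.act (g I x) (treeSingle K t))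
    (φ : ∀ (I : Type) [Finite I], LabeledForest Q I → X.obj I)
    (hφ : ∀ (I J : Type) [Finite I] [Finite J] (e : I ≃ J) (F : LabeledForest Q I),
      φ J (F.map e) = X.map e (φ I F))
    (hφ' : ∀ (I J : Type) [Fintype I] [Finite J] (F : LabeledForest Q I) (t : RootedTreeOn J),
      ∑ v : I, φ (I ⊕ J) (F.graft v t) = X.act (φ I F) (treeSingle K t))
    (h₀ : ∀ (I : Type) [Finite I] (F : LabeledForest Q I), F.numChildren c = 0 →
      g I (gen I F) = φ I F) (F : LabeledForest Q I) : g I (extend E c gen I F) = φ I F := by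
  suffices key : ∀ (n : ℕ) (I : Type) [Finite I] (F : LabeledForest Q I), F.numChildren c = n →
      g I (extend E c gen I F) = φ I F from key _ I F rfl
  intro n
  induction n with
  | zero =>
    intro I _ F hF
    rw [extend_of_numChildren_eq_zero _ _ _ _ hF, h₀ _ _ hF]
  | succ n ih =>
    intro I _ F hF
    obtain ⟨D, hD⟩ := exists_extend_eq E c gen F (by omega)
    have := Fintype.ofFinite D.A
    have hn : D.forest.numChildren c = n := by
      have := D.numChildren_eq
      omega
    have h := (graft_root_eq_stepValue_iff X c φ D.forest D.tree).2 (hφ' _ _ _ _)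
    have hF' : φ I F = X.map D.e (φ _ (D.forest.graft (D.forest.root c) D.tree)) := by
      rw [← hφ, D.map_graft]
    rw [hF', hD, hg, h, stepValue_eq, stepValue_eq, map_sub, map_sum, hg', ih _ _ hn]
    congr 2
    refine Finset.sum_congr rfl fun v _ => ?_
    by_cases hv : v = D.forest.root c
    · rw [hv, graftValue_root, graftValue_root, map_zero]
    · rw [graftValue_of_ne _ _ _ _ hv, graftValue_of_ne _ _ _ _ hv,
        ih _ _ ((numChildren_graft_of_ne c _ hv _).trans hn)]

end

end LabeledForest

/-! ### Forests as pure tensors of the composition with the module of trees -/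

namespace LabeledForest

variable {Q R I J : Type}

/-- The label of the component of a vertex. -/
noncomputable def cell (F : LabeledForest Q I) (i : I) : Q := (F.reaches_root i).choose_spec.choose

theorem cell_eq_of_comp_parent (F : LabeledForest Q I) (f : I → Q) (h : ∀ q, f (F.root q) = q)
    (h' : ∀ i, f (F.parent i) = f i) (i : I) : F.cell i = f i := by
  have hn := (F.reaches_root i).choose_spec.choose_spec
  have hf : ∀ n i, f (F.parent^[n] i) = f i := by
    intro n
    induction n with
    | zero => exact fun i => rfl
    | succ n ih => exact fun i => (ih _).trans (h' i)
  rw [← hf (F.reaches_root i).choose i, hn, h]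
  rfl

theorem eq_of_iterate_parent (F : LabeledForest Q I) {i : I} {m n : ℕ} {q q' : Q}
    (h : F.parent^[m] i = F.root q) (h' : F.parent^[n] i = F.root q') : q = q' := by
  have hm : F.parent^[n + m] i = F.root q := by
    rw [Function.iterate_add_apply, h, Function.iterate_fixed (F.parent_root q)]
  have hn : F.parent^[m + n] i = F.root q' := by
    rw [Function.iterate_add_apply, h', Function.iterate_fixed (F.parent_root q')]
  rw [add_comm] at hm
  exact F.root_injective (hm.symm.trans hn)

theorem iterate_parent_eq (F : LabeledForest Q I) (i : I) :
    ∃ n, F.parent^[n] i = F.root (F.cell i) :=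
  ⟨_, (F.reaches_root i).choose_spec.choose_spec⟩

theorem cell_root (F : LabeledForest Q I) (q : Q) : F.cell (F.root q) = q :=
  F.eq_of_iterate_parent (F.reaches_root (F.root q)).choose_spec.choose_spec
    (show F.parent^[0] (F.root q) = F.root q from rfl)

theorem cell_parent (F : LabeledForest Q I) (i : I) : F.cell (F.parent i) = F.cell i := by
  obtain ⟨n, hn⟩ := F.iterate_parent_eq (F.parent i)
  obtain ⟨m, hm⟩ := F.iterate_parent_eq i
  exact F.eq_of_iterate_parent (m := n + 1) hn hm

theorem cell_surjective (F : LabeledForest Q I) : Function.Surjective F.cell := fun q =>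
  ⟨_, F.cell_root q⟩

theorem cell_map (e : I ≃ J) (F : LabeledForest Q I) (j : J) :
    (F.map e).cell j = F.cell (e.symm j) := by
  refine cell_eq_of_comp_parent _ (fun j => F.cell (e.symm j)) (fun q => ?_) (fun j => ?_) j
  · simp [map_root, cell_root]
  · obtain ⟨i, rfl⟩ := e.surjective j
    simp [map_parent, cell_parent]

theorem cell_relabel (σ : Q ≃ R) (F : LabeledForest Q I) (i : I) :
    (F.relabel σ).cell i = σ (F.cell i) := by
  refine cell_eq_of_comp_parent _ (fun i => σ (F.cell i)) (fun q => ?_) (fun i => ?_) i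
  · change σ (F.cell (F.root (σ.symm q))) = q
    simp [cell_root]
  · exact congrArg σ (F.cell_parent i)

theorem cell_graft (F : LabeledForest Q I) (v : I) (t : RootedTreeOn J) (x : I ⊕ J) :
    (F.graft v t).cell x = Sum.elim F.cell (fun _ => F.cell v) x := by
  refine cell_eq_of_comp_parent (F.graft v t) (Sum.elim F.cell fun _ => F.cell v)
    (fun q => F.cell_root q) ?_ x
  rintro (i | j)
  · exact F.cell_parent i
  · by_cases h : j = t.root
    · rw [h, graft_parent_inr_root]
      rfl
    · rw [graft_parent_inr_ne _ _ _ h]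
      rfl

/-- The component labelled by `q`, as a rooted tree. -/
noncomputable def tree (F : LabeledForest Q I) (q : Q) : RootedTreeOn {i // F.cell i = q} where
  root := ⟨F.root q, F.cell_root q⟩
  parent i := ⟨F.parent i.1, (F.cell_parent i.1).trans i.2⟩
  parent_root := Subtype.ext (F.parent_root q)
  reaches_root := by
    rintro ⟨i, rfl⟩
    obtain ⟨n, hn⟩ := F.iterate_parent_eq i
    refine ⟨n, Subtype.ext (Eq.trans ?_ hn)⟩
    have h : Function.Semiconj Subtype.val
      (fun j : {j // F.cell j = F.cell i} => (⟨F.parent j.1, (F.cell_parent j.1).trans j.2⟩ :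
        {j // F.cell j = F.cell i})) F.parent := fun _ => rfl
    exact h.iterate_right n ⟨i, rfl⟩

/-- The forest whose components are given rooted trees on the fibres of a map. -/
def assemble (p : I → Q) (t : ∀ q, RootedTreeOn {i // p i = q}) : LabeledForest Q I where
  root q := (t q).root.1
  parent i := ((t (p i)).parent ⟨i, rfl⟩).1
  root_injective q q' h := by
    rw [← (t q).root.2, ← (t q').root.2]
    exact congrArg p h
  parent_root q := by
    have h : ∀ (q' : Q) (i : {i // p i = q'}),
        ((t (p i.1)).parent ⟨i.1, rfl⟩).1 = ((t q').parent i).1 := by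
      rintro _ ⟨i, rfl⟩
      rfl
    rw [h q (t q).root, (t q).parent_root]
  reaches_root i := by
    obtain ⟨n, hn⟩ := (t (p i)).reaches_root ⟨i, rfl⟩
    refine ⟨n, p i, ?_⟩
    rw [← hn]
    have h : Function.Semiconj Subtype.val (t (p i)).parent
        (fun i => ((t (p i)).parent ⟨i, rfl⟩).1) := by
      rintro ⟨j, hj⟩
      generalize p i = q at hj
      subst hj
      rfl
    exact (h.iterate_right n ⟨i, rfl⟩).symm

theorem assemble_parent (p : I → Q) (t : ∀ q, RootedTreeOn {i // p i = q}) {q : Q}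
    (i : {i // p i = q}) : (assemble p t).parent i.1 = ((t q).parent i).1 := by
  obtain ⟨i, rfl⟩ := i
  rfl

theorem cell_assemble (p : I → Q) (t : ∀ q, RootedTreeOn {i // p i = q}) (i : I) :
    (assemble p t).cell i = p i :=
  cell_eq_of_comp_parent _ p (fun q => (t q).root.2) (fun i => ((t (p i)).parent ⟨i, rfl⟩).2) i

end LabeledForest

section

variable (K : Type u) [Field K]

/-- The element of the module `W_pL` given by a rooted tree. -/
noncomputable def plSingle {I : Type} [Finite I] (t : RootedTreeOn I) : (treePL K).obj I :=
  (Finsupp.single t 1 : RootedTreeOn I →₀ K)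

theorem map_plSingle {I J : Type} [Finite I] [Finite J] (e : I ≃ J) (t : RootedTreeOn I) :
    (treePL K).map e (plSingle K t) = plSingle K (t.map e) :=
  treeMap_single K e t

theorem act_plSingle {I J : Type} [Fintype I] [Finite J] (s : RootedTreeOn I)
    (t : RootedTreeOn J) :
    (treePL K).act (plSingle K s) (treeSingle K t) = ∑ v : I, plSingle K (s.graft v t) :=
  treeOp_single K s t

variable {K}

/-- Linear maps on `W(J)` are determined by their values on the rooted trees. -/
theorem treeSLie_hom_ext {J : Type} [Finite J] {V : Type*} [AddCommGroup V] [Module K V]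
    {f g : (treeSLie K).obj J →ₗ[K] V} (h : ∀ t, f (treeSingle K t) = g (treeSingle K t)) :
    f = g :=
  Finsupp.lhom_ext' (R := K) (M := K) (α := RootedTreeOn J) fun t => LinearMap.ext_ring (h t)

variable {Q : Type} [Finite Q] {A : Q → Type} [∀ q, Finite (A q)]

/-- Linear maps on a tensor product of modules of trees are determined by their values on the
tensors of trees. -/
theorem piTensor_hom_ext {V : Type*} [AddCommGroup V] [Module K V]
    {f g : (⨂[K] q, (treePL K).obj (A q)) →ₗ[K] V}
    (h : ∀ t : ∀ q, RootedTreeOn (A q), f (PiTensorProduct.tprod K fun q => plSingle K (t q)) =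
      g (PiTensorProduct.tprod K fun q => plSingle K (t q))) : f = g := by
  refine PiTensorProduct.ext (Module.Basis.ext_multilinear
    (fun q => (Finsupp.basisSingleOne : Module.Basis (RootedTreeOn (A q)) K
      (RootedTreeOn (A q) →₀ K))) fun t => ?_)
  have hb : (fun q => (Finsupp.basisSingleOne : Module.Basis (RootedTreeOn (A q)) K
      (RootedTreeOn (A q) →₀ K)) (t q)) = fun q => plSingle K (t q) :=
    funext fun q => congrFun Finsupp.coe_basisSingleOne (t q)
  exact (congrArg (fun m => f (PiTensorProduct.tprod K m)) hb).trans
    ((h t).trans (congrArg (fun m => g (PiTensorProduct.tprod K m)) hb.symm))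

/-- Linear maps on a tensor product of modules of trees may be prescribed on the tensors of
trees. -/
theorem exists_piTensor_lift {V : Type*} [AddCommGroup V] [Module K V]
    (φ : (∀ q, RootedTreeOn (A q)) → V) :
    ∃ f : (⨂[K] q, (treePL K).obj (A q)) →ₗ[K] V,
      ∀ t, f (PiTensorProduct.tprod K fun q => plSingle K (t q)) = φ t := by
  classical
  have := Fintype.ofFinite Q
  refine ⟨Finsupp.linearCombination K φ ∘ₗ (PiTensorProduct.ofFinsuppEquiv' (R := K)
    (κ := fun q => RootedTreeOn (A q))).toLinearMap, fun t => ?_⟩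
  have h := PiTensorProduct.ofFinsuppEquiv'_tprod_single (R := K) t fun _ => 1
  refine (congrArg (Finsupp.linearCombination K φ) h).trans ?_
  simp

end

section

variable {K : Type u} [Field K] (S : SModule K) {Q R I J : Type} [Finite Q] [Finite R] [Finite I]
  [Finite J]

open SModule LabeledForest

/-- The pure tensor of `S ∘ W_pL` given by an element of `S` on the set of components of a
forest. -/
noncomputable def compForest (F : LabeledForest Q I) :
    S.obj Q →ₗ[K] CompObj S (treePL K).toSModule I :=
  compIncl S (treePL K).toSModule F.cell F.cell_surjective ∘ₗ
    (TensorProduct.mk K _ _).flip (PiTensorProduct.tprod K fun q => plSingle K (F.tree q))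

theorem compForest_apply (F : LabeledForest Q I) (a : S.obj Q) :
    compForest S F a = compMk S (treePL K).toSModule F.cell F.cell_surjective a
      (fun q => plSingle K (F.tree q)) := rfl

theorem compMk_plSingle (p : I → Q) (hp : Function.Surjective p) (a : S.obj Q)
    (t : ∀ q, RootedTreeOn {i // p i = q}) :
    compMk S (treePL K).toSModule p hp a (fun q => plSingle K (t q)) =
      compForest S (assemble p t) a := by
  rw [compForest_apply]
  refine compMk_congr' S (treePL K).toSModule (fun i => (cell_assemble p t i).symm) fun q => ?_
  rw [map_plSingle]
  refine congrArg (plSingle K) (RootedTreeOn.ext_of_map _ (Subtype.ext rfl) fun i =>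
    Subtype.ext ?_)
  exact (assemble_parent p t i).symm

theorem compMap_compForest (e : I ≃ J) (F : LabeledForest Q I) (a : S.obj Q) :
    compMap S (treePL K).toSModule e (compForest S F a) = compForest S (F.map e) a := by
  rw [compForest_apply, compMap_compMk, compForest_apply]
  refine compMk_congr' S (treePL K).toSModule (fun j => (cell_map e F j).symm) fun q => ?_
  rw [map_plSingle, map_plSingle]
  refine congrArg (plSingle K) (RootedTreeOn.ext_of_map _ (Subtype.ext rfl) fun j =>
    Subtype.ext ?_)
  rfl

theorem compForest_relabel (σ : Q ≃ R) (F : LabeledForest Q I) (a : S.obj Q) :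
    compForest S (F.relabel σ) (S.map σ a) = compForest S F a := by
  rw [compForest_apply, compForest_apply]
  refine (compMk_congr S (treePL K).toSModule σ (fun i => (cell_relabel σ F i).symm) rfl
    fun q => ⟨fiberEquiv (Equiv.refl I) _ _ _ _ fun i => ?_, fun i => rfl, ?_⟩).symm
  · rw [Equiv.refl_apply, cell_relabel, σ.apply_eq_iff_eq]
  · rw [map_plSingle]
    refine congrArg (plSingle K) (RootedTreeOn.ext_of_map _ (Subtype.ext ?_) fun j =>
      Subtype.ext rfl)
    exact congrArg F.root (σ.symm_apply_apply q).symm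

theorem compMk_update_sum {L : SLieAlgebra K} (M : SLieModule L) {p : I → Q}
    (hp : Function.Surjective p) [DecidableEq Q] (a : S.obj Q)
    (m : ∀ q, M.obj {i // p i = q}) (q : Q) {ι : Type*} (s : Finset ι)
    (x : ι → M.obj {i // p i = q}) :
    compMk S M.toSModule p hp a (Function.update m q (∑ i ∈ s, x i)) =
      ∑ i ∈ s, compMk S M.toSModule p hp a (Function.update m q (x i)) := by
  simp only [compMk, MultilinearMap.map_update_sum, TensorProduct.tmul_sum, map_sum]

/-- The action of a tree on the tensor given by a forest is the sum over all graftings. -/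
theorem compAct_compForest {I J : Type} [Fintype I] [Finite J] (F : LabeledForest Q I) (a : S.obj Q)
    (t : RootedTreeOn J) :
    (treePL K).compAct S (compForest S F a) (treeSingle K t) =
      ∑ v : I, compForest S (F.graft v t) a := by
  classical
  have := Fintype.ofFinite Q
  have hf : ∀ q, Fintype {i // F.cell i = q} := fun q => Fintype.ofFinite _
  rw [compForest_apply, SLieModule.compAct_compMk, ← (Equiv.sigmaFiberEquiv F.cell).sum_comp,
    Fintype.sum_sigma]
  refine Finset.sum_congr rfl fun q₀ _ => ?_
  have h : (treePL K).actFamily F.cell q₀ (treeSingle K t) (fun q => plSingle K (F.tree q)) q₀ =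
      ∑ v : {i // F.cell i = q₀}, plSingle K (((F.tree q₀).graft v t).map
        (SLieModule.extendFiberSelf J F.cell q₀)) := by
    rw [SLieModule.actFamily_self, act_plSingle, map_sum]
    exact Finset.sum_congr rfl fun v _ => map_plSingle K _ _
  rw [← Function.update_eq_self q₀ ((treePL K).actFamily F.cell q₀ (treeSingle K t) _), h,
    compMk_update_sum]
  refine Finset.sum_congr rfl ?_
  rintro ⟨v, rfl⟩ _
  rw [compForest_apply]
  refine compMk_congr' S (treePL K).toSModule (fun x => (cell_graft F v t x).symm) fun q => ?_
  by_cases hq : q = F.cell v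
  · subst hq
    rw [Function.update_self, map_plSingle]
    refine congrArg (plSingle K) (RootedTreeOn.ext_of_map _ (Subtype.ext rfl) ?_)
    intro x
    obtain ⟨x, rfl⟩ := (SLieModule.extendFiberSelf J F.cell (F.cell v)).surjective x
    rw [RootedTreeOn.map_parent]
    refine Subtype.ext ?_
    rcases x with i | j
    · rfl
    · by_cases hj : j = t.root
      · subst hj
        rw [RootedTreeOn.graft_parent_inr_root]
        exact (graft_parent_inr_root F v t).symm
      · rw [RootedTreeOn.graft_parent_inr_ne _ _ _ hj]
        exact (graft_parent_inr_ne F v t hj).symm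
  · rw [Function.update_of_ne hq, SLieModule.actFamily_ne _ _ hq, map_plSingle, map_plSingle]
    refine congrArg (plSingle K) (RootedTreeOn.ext_of_map _ (Subtype.ext rfl) ?_)
    intro x
    obtain ⟨x, rfl⟩ := (SLieModule.extendFiberOther J F.cell hq).surjective x
    rw [RootedTreeOn.map_parent]
    rfl

variable {S}

/-- The tensors given by forests span `S ∘ W_pL`. -/
theorem compForest_hom_ext {V : Type*} [AddCommGroup V] [Module K V]
    {f g : CompObj S (treePL K).toSModule I →ₗ[K] V}
    (h : ∀ (r : Setoid I) (F : LabeledForest (Quotient r) I) (a : S.obj (Quotient r)),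
      f (compForest S F a) = g (compForest S F a)) : f = g := by
  classical
  refine DirectSum.linearMap_ext K fun r => TensorProduct.ext <| LinearMap.ext fun a =>
    piTensor_hom_ext fun t => ?_
  have h' := h r (assemble (Quotient.mk r) t) a
  rw [← compMk_plSingle S _ Quotient.mk_surjective, compMk_mk] at h'
  exact h'

end

section

variable {K : Type u} [Field K] (μ : YoungDiagram) {I : Type} [Finite I]

open SModule LabeledForest

/-- The inclusion of `S^μ(Q)` in the space of fillings. -/
noncomputable def spechtIncl (Q : Type) [Finite Q] :
    (specht K μ).obj Q →ₗ[K] ((μ.cells ≃ Q) →₀ K) :=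
  (spechtSubmodule K μ Q).subtype

/-- Linear maps on `S^μ ∘ W_pL` may be prescribed by a function on the forests whose components are
labelled by the cells of `μ`. -/
theorem exists_specht_lift {V : Type*} [AddCommGroup V] [Module K V]
    (φ : LabeledForest μ.cells I → V) :
    ∃ f : CompObj (specht K μ) (treePL K).toSModule I →ₗ[K] V,
      ∀ (Q : Type) [Finite Q] (F : LabeledForest Q I) (a : (specht K μ).obj Q),
        f (compForest (specht K μ) F a) =
          Finsupp.linearCombination K (fun σ : μ.cells ≃ Q => φ (F.relabel σ.symm))
            (spechtIncl μ Q a) := by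
  classical
  choose g hg using fun (r : Setoid I) (σ : μ.cells ≃ Quotient r) =>
    exists_piTensor_lift (K := K) (A := fun c : Quotient r => {i // Quotient.mk r i = c})
      fun t => φ ((assemble (Quotient.mk r) t).relabel σ.symm)
  refine ⟨DirectSum.toModule K (Setoid I) V fun r => TensorProduct.lift
    (Finsupp.linearCombination K (g r) ∘ₗ spechtIncl μ (Quotient r)), ?_⟩
  intro Q _ F a
  have key : ∀ (r : Setoid I) (F : LabeledForest (Quotient r) I)
      (a : (specht K μ).obj (Quotient r)), (∀ i, F.cell i = Quotient.mk r i) →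
      DirectSum.toModule K (Setoid I) V (fun r => TensorProduct.lift
        (Finsupp.linearCombination K (g r) ∘ₗ spechtIncl μ (Quotient r)))
          (compForest (specht K μ) F a) =
        Finsupp.linearCombination K (fun σ : μ.cells ≃ Quotient r => φ (F.relabel σ.symm))
          (spechtIncl μ (Quotient r) a) := by
    intro r F a hF
    let t : ∀ c, RootedTreeOn {i // Quotient.mk r i = c} := fun c =>
      (F.tree c).map (Equiv.subtypeEquivRight fun i => by rw [hF])
    have hFt : F = assemble (Quotient.mk r) t := by
      ext i
      · rfl
      · rfl
    rw [hFt, ← compMk_plSingle _ _ Quotient.mk_surjective, compMk_mk, DirectSum.toModule_lof]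
    refine (TensorProduct.lift.tmul _ _).trans ?_
    change (Finsupp.linearCombination K (g r) (spechtIncl μ (Quotient r) a)) _ = _
    rw [Finsupp.linearCombination_apply, Finsupp.linearCombination_apply, Finsupp.sum, Finsupp.sum,
      LinearMap.sum_apply]
    refine Finset.sum_congr rfl fun σ _ => ?_
    rw [LinearMap.smul_apply, hg]
  let κ : Q ≃ Quotient (Setoid.ker F.cell) := (kerEquiv F.cell F.cell_surjective).symm
  rw [← compForest_relabel (specht K μ) κ F a]
  refine (key _ (F.relabel κ) ((specht K μ).map κ a) fun i => ?_).trans ?_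
  · rw [cell_relabel]
    exact (Equiv.symm_apply_eq _).2 rfl
  · refine (Finsupp.linearCombination_mapDomain K (f := fun σ : μ.cells ≃ Q => σ.trans κ)
      (v' := fun σ => φ ((F.relabel κ).relabel σ.symm)) (spechtIncl μ Q a)).trans ?_
    congr 1
    congr 1
    ext σ
    refine congrArg φ (LabeledForest.ext ?_ rfl)
    ext c
    exact congrArg F.root (κ.symm_apply_apply (σ c))

end

/-! ### Lifting morphisms along epimorphisms -/

section

variable {K : Type u} [Field K] (μ : YoungDiagram)

open SModule LabeledForest SLieAlgebra

/-- A natural function `H` on the forests labelled by the cells of `μ`, on which trees act by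
grafting, defines a morphism on `S^μ ∘ W_pL`. -/
theorem exists_specht_hom (E : SRightModule (treeSLie K).env)
    (H : ∀ (I : Type) [Finite I], LabeledForest μ.cells I → E.obj I)
    (hH : ∀ {I J : Type} [Finite I] [Finite J] (e : I ≃ J) (F : LabeledForest μ.cells I),
      H J (F.map e) = E.map e (H I F))
    (hH' : ∀ {I J : Type} [Fintype I] [Finite J] (F : LabeledForest μ.cells I)
      (t : RootedTreeOn J),
      ∑ v : I, H (I ⊕ J) (F.graft v t) = E.act (H I F) (envι (treeSingle K t))) :
    ∃ h : ((treePL K).compLeft (specht K μ)).toEnv ⟶ E,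
      ∀ (I : Type) [Finite I] (Q : Type) [Finite Q] (F : LabeledForest Q I)
        (a : (specht K μ).obj Q),
        SRightModule.Hom.app h I (compForest (specht K μ) F a) =
          Finsupp.linearCombination K (fun σ : μ.cells ≃ Q => H I (F.relabel σ.symm))
            (spechtIncl μ Q a) := by
  choose h hh using fun (I : Type) (_ : Finite I) => exists_specht_lift (K := K) μ (H I)
  refine ⟨SRightModule.homOfLie _ E (fun I hI => h I hI) ?_ ?_, fun I hI => hh I hI⟩
  · intro I J hI hJ e m
    have key : h J hJ ∘ₗ compMap (specht K μ) (treePL K).toSModule e = E.map e ∘ₗ h I hI := by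
      refine compForest_hom_ext fun r F a => ?_
      rw [LinearMap.comp_apply, LinearMap.comp_apply, compMap_compForest, hh, hh,
        Finsupp.apply_linearCombination]
      congr 1
      congr 1
      ext σ
      exact hH e (F.relabel σ.symm)
    exact LinearMap.congr_fun key m
  · intro I J hI hJ m x
    have := Fintype.ofFinite I
    have key : ((treePL K).compAct (J := J) (specht K μ)).compr₂ (h (I ⊕ J) inferInstance) =
        (E.act.compl₂ envι) ∘ₗ h I hI := by
      refine compForest_hom_ext fun r F a => treeSLie_hom_ext fun t => ?_
      rw [LinearMap.compr₂_apply, compAct_compForest, map_sum, LinearMap.comp_apply,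
        LinearMap.compl₂_apply, hh]
      simp only [hh]
      rw [Finsupp.linearCombination_apply, Finsupp.sum, map_sum, LinearMap.sum_apply]
      simp only [Finsupp.linearCombination_apply, Finsupp.sum]
      rw [Finset.sum_comm]
      refine Finset.sum_congr rfl fun σ _ => ?_
      rw [← Finset.smul_sum, map_smul, LinearMap.smul_apply, ← hH']
      rfl
    have h1 := LinearMap.congr_fun (LinearMap.congr_fun key m) x
    exact (congrArg (h (I ⊕ J) inferInstance) (SLieModule.toEnv_act_envι _ m x)).trans h1

/-- A natural function on forests, on which trees act by grafting, lifts along an epimorphism. -/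
theorem exists_forest_lift [CharZero K] {Q : Type} (c : Q) {E X : SRightModule (treeSLie K).env}
    (g : E ⟶ X) [CategoryTheory.Epi g] (φ : ∀ (I : Type) [Finite I], LabeledForest Q I → X.obj I)
    (hφ : ∀ (I J : Type) [Finite I] [Finite J] (e : I ≃ J) (F : LabeledForest Q I),
      φ J (F.map e) = X.map e (φ I F))
    (hφ' : ∀ (I J : Type) [Fintype I] [Finite J] (F : LabeledForest Q I) (t : RootedTreeOn J),
      ∑ v : I, φ (I ⊕ J) (F.graft v t) = X.act (φ I F) (envι (treeSingle K t))) :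
    ∃ H : ∀ (I : Type) [Finite I], LabeledForest Q I → E.obj I,
      (∀ {I J : Type} [Finite I] [Finite J] (e : I ≃ J) (F : LabeledForest Q I),
        H J (F.map e) = E.map e (H I F)) ∧
      (∀ {I J : Type} [Fintype I] [Finite J] (F : LabeledForest Q I) (t : RootedTreeOn J),
        ∑ v : I, H (I ⊕ J) (F.graft v t) = E.act (H I F) (envι (treeSingle K t))) ∧
      ∀ (I : Type) [Finite I] (F : LabeledForest Q I),
        SRightModule.Hom.app g I (H I F) = φ I F := by
  obtain ⟨s, hs, hgs⟩ := SModule.exists_natural_section (fun I _ => SRightModule.Hom.app g I)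
    (fun e x => SRightModule.Hom.naturality g e x)
    fun I _ => SRightModule.app_surjective_of_epi g I
  let gen : ∀ (I : Type) [Finite I], LabeledForest Q I → E.toLieModule.obj I :=
    fun I _ F => s I (φ I F)
  have hgen : ∀ (I J : Type) [Finite I] [Finite J] (e : I ≃ J) (F : LabeledForest Q I),
      gen J (F.map e) = E.toLieModule.map e (gen I F) := fun I J _ _ e F =>
    (congrArg (s J) (hφ I J e F)).trans (hs e _)
  exact ⟨fun I _ => extend E.toLieModule c gen I,
    fun e F => extend_map E.toLieModule c gen hgen e F,
    fun F t => sum_extend_graft E.toLieModule c gen hgen F t,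
    fun I _ F => map_extend E.toLieModule c gen (X := X.toLieModule)
      (fun I _ => SRightModule.Hom.app g I) (fun e x => SRightModule.Hom.naturality g e x)
      (fun x t => SRightModule.Hom.app_act g x _) φ hφ hφ' (fun I _ F _ => hgs _) F⟩

end

/-- Over a field `K` of characteristic zero, for every non-empty partition `μ`, the `W`-module
`S^μ ∘ W_pL` is a projective object of the category of right `U(W)`-modules. -/
theorem mainTheorem7 (K : Type u) [Field K] [CharZero K] (μ : YoungDiagram) (hμ : μ ≠ ⊥) :
    CategoryTheory.Projective
      (((treePL K).compLeft (specht K μ)).toEnv : SRightModule (treeSLie K).env) := by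
  obtain ⟨c⟩ : Nonempty μ.cells := by
    by_contra h
    refine hμ (YoungDiagram.ext ?_)
    exact Finset.not_nonempty_iff_eq_empty.1 fun h' => h h'.to_subtype
  refine ⟨fun {E X} f g hg => ?_⟩
  obtain ⟨π, hπ, hπ'⟩ := exists_specht_retraction K μ
  -- the values of `f` on the tensors given by forests with labels in the cells of `μ`
  let a₀ : (specht K μ).obj μ.cells := π μ.cells (Finsupp.single (Equiv.refl _) 1)
  let φ : ∀ (I : Type) [Finite I], LabeledForest μ.cells I → X.obj I := fun I _ F =>
    SRightModule.Hom.app f I (compForest (specht K μ) F a₀)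
  have hφ : ∀ (I J : Type) [Finite I] [Finite J] (e : I ≃ J) (F : LabeledForest μ.cells I),
      φ J (F.map e) = X.map e (φ I F) := fun I J _ _ e F =>
    (congrArg (SRightModule.Hom.app f J) (compMap_compForest (specht K μ) e F a₀).symm).trans
      (SRightModule.Hom.naturality f e _)
  have hφ' : ∀ (I J : Type) [Fintype I] [Finite J] (F : LabeledForest μ.cells I)
      (t : RootedTreeOn J), ∑ v : I, φ (I ⊕ J) (F.graft v t) =
        X.act (φ I F) (SLieAlgebra.envι (treeSingle K t)) := fun I J _ _ F t =>
    (map_sum (SRightModule.Hom.app f (I ⊕ J)) _ _).symm.trans <|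
      (congrArg (SRightModule.Hom.app f (I ⊕ J))
        ((compAct_compForest (specht K μ) F a₀ t).symm.trans
          (SLieModule.toEnv_act_envι ((treePL K).compLeft (specht K μ)) _ _).symm)).trans
        (SRightModule.Hom.app_act f _ _)
  obtain ⟨H, hH, hH', hgφ⟩ := exists_forest_lift c g φ hφ hφ'
  obtain ⟨h, hh⟩ := exists_specht_hom μ E H hH hH'
  refine ⟨h, SRightModule.Hom.ext (funext fun I => funext fun _ => ?_)⟩
  refine compForest_hom_ext fun r F a => ?_
  refine (congrArg (SRightModule.Hom.app g I) (hh I _ F a)).trans ?_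
  rw [Finsupp.apply_linearCombination]
  -- `a` is the value of the retraction `π` on the corresponding combination of fillings
  have ha : Finsupp.linearCombination K (fun σ : μ.cells ≃ Quotient r => (specht K μ).map σ a₀)
      (spechtIncl μ _ a) = a := by
    have h1 : π _ ∘ₗ LinearMap.id = Finsupp.linearCombination K
        (fun σ : μ.cells ≃ Quotient r => (specht K μ).map σ a₀) := by
      refine Finsupp.lhom_ext' fun σ => LinearMap.ext_ring ?_
      simp only [LinearMap.comp_apply, Finsupp.lsingle_apply, LinearMap.id_apply,
        Finsupp.linearCombination_single, one_smul]
      have h0 : fillingMap K μ σ (Finsupp.single (Equiv.refl _) 1) = Finsupp.single σ 1 :=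
        Finsupp.mapDomain_single
      rw [← h0, hπ]
    rw [← h1]
    exact hπ' a
  have h2 : ∀ σ : μ.cells ≃ Quotient r,
      SRightModule.Hom.app g I (H I (F.relabel σ.symm)) =
        SRightModule.Hom.app f I (compForest (specht K μ) F ((specht K μ).map σ a₀)) := by
    intro σ
    rw [hgφ]
    refine congrArg (SRightModule.Hom.app f I) ?_
    rw [← compForest_relabel (specht K μ) σ.symm F, SModule.map_map, SModule.map_eq_self]
    simp
  nth_rewrite 2 [← ha]
  rw [Finsupp.linearCombination_apply, Finsupp.linearCombination_apply, Finsupp.sum, Finsupp.sum]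
  refine Eq.trans ?_ (map_sum (SRightModule.Hom.app f I ∘ₗ compForest (specht K μ) F) _ _).symm
  refine Finset.sum_congr rfl fun σ _ => ?_
  rw [map_smul]
  exact congrArg _ (h2 σ)
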